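/- **Setting.** Let $n\ge 3$ and let $F:\mathbb R^n\times\mathbb R\to\mathbb R^n$ be $C^\infty$, with Jacobian $J=\partial_xF$. Let $\Lambda\ni\lambda^\star$ be open and let $T(\lambda)$ (with $T(\lambda^\star)>0$), $v(\theta;\lambda)\in\mathbb R^n$, $P(\theta;\lambda)\in\mathbb R^{n\times n}$ (non-singular), $\alpha_R(\lambda),\alpha_I(\lambda)\in\mathbb R$, $\widetilde E(\lambda)\in\mathbb R^{(n-3)\times(n-3)}$ be $C^\infty$ for $\lambda\in\Lambda$, $\theta\in\mathbb R$, with $v,P$ $2\pi$-periodic in $\theta$, and $$T(\lambda)F(v,\lambda)-\partial_\theta v=0,\qquad T(\lambda)J(v,\lambda)P-\partial_\theta P=P\,E(\lambda),\qquad E(\lambda)=\mathrm{diag}\big(\widehat E(\lambda),\widetilde E(\lambda),0\big),\quad \widehat E=\begin{pmatrix}\alpha_R&-\alpha_I\\ \alpha_I&\alpha_R\end{pmatrix}.$$ Assume $\alpha_R(\lambda^\star)=0$, $\alpha_I(\lambda^\star)=\omega^\star$ with $0<\omega^\star<\frac12$, that $\widetilde E(\lambda^\star)$ has no eigenvalue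 on the imaginary axis, that $\dot\alpha_R(\lambda^\star)\ne0$, and that $\omega^\star\notin\{\frac13,\frac14\}$. Write $z=(\hat z,\tilde z,\mathring z)\in\mathbb R^2\times\mathbb R^{n-3}\times\mathbb R$, let $e_n$ be the last unit vector, $\hat a(\phi)=(\cos\phi,\sin\phi)$, $a(\phi)=(\hat a(\phi),0,0)$, $\langle\cdot\rangle$ and $\langle\langle\cdot\rangle\rangle$ the means over the circle and over the 2-torus, $S$ the truncation of Fourier series in $\phi$ to the modes $0,\dots,3$, and, for $\varepsilon\neq0$, $$G(z,\lambda,\eta,\theta;\varepsilon)=\tfrac1\varepsilon P^{-1}\big\{T F(v+\varepsilon Pz,\lambda)-T F(v,\lambda)-\varepsilon(1+\varepsilon\eta)(\partial_\theta P)z\big\}.$$ **The Fourier approximation.** The $M=3$ equations are, for $z(\theta,\phi)$ of class $C^1$, $2\pi$-periodic in $\theta$ and with $Sz=z$, and for real $\lambda,\omega,\eta$, $$S\,G(z,\lambda,\eta,\theta;\varepsilon)-\eta e_n-[(1+\varepsilon\eta)\partial_\theta+\omega\partial_\phi]z=0,\quad \langle\langle \hat z\cdot\hat a(\phi)\rangle\rangle=1,\quad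 \langle\langle \hat z\cdot\hat a'(\phi)\rangle\rangle=0,\quad \langle\langle\mathring z\rangle\rangle=0.$$ **The normal form at $\lambda^\star$.** It consists of numbers $\kappa,\beta_R,\beta_I$ and of smooth $2\pi$-periodic coefficient functions of $\theta$ defining $$\hat h(y;\theta)=|y|^2\hat a_0+(y_1^2-y_2^2)\hat a_2+2y_1y_2\hat b_2+y_1|y|^2\hat a_1+y_2|y|^2\hat b_1+y_1(y_1^2-3y_2^2)\hat a_3+y_2(3y_1^2-y_2^2)\hat b_3,$$ $$\tilde h(y;\theta)=|y|^2\tilde a_0+(y_1^2-y_2^2)\tilde a_2+2y_1y_2\tilde b_2,\qquad \mathring h(y;\theta)=|y|^2\mathring a_0+(y_1^2-y_2^2)\mathring a_2+2y_1y_2\mathring b_2,$$ with $\langle\hat a_{1}\cdot\hat e_1\rangle+\langle\hat b_{1}\cdot\hat e_2\rangle=0=\langle\hat a_{1}\cdot\hat e_2\rangle-\langle\hat b_{1}\cdot\hat e_1\rangle$ and $\langle\mathring a_0\rangle=0$. Substituting $z=y+\frac1\varepsilon(\hat h,\tilde h,\mathring h)(\varepsilon\hat y;\theta)$ and $\eta=\zeta+\varepsilon\kappa$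 turns $G-\eta e_n-[(1+\varepsilon\eta)\partial_\theta+\omega\partial_\phi]z=0$ (at $\lambda=\lambda^\star$) into $G^\dagger(y,\zeta,\theta;\varepsilon)-(\zeta+\varepsilon\kappa)e_n-[(1+\varepsilon\eta)\partial_\theta+\omega\partial_\phi]y=0$, and it is required that for $\tilde y=0$, $\mathring y=0$, $\zeta=0$, every $\theta$ and every $\hat y$ with $|\hat y|=1$, as $\varepsilon\to0$, $$\widehat G^\dagger=\widehat E(\lambda^\star)\hat y+\varepsilon^2|\hat y|^2\begin{pmatrix}\beta_R&-\beta_I\\ \beta_I&\beta_R\end{pmatrix}\hat y+O(\varepsilon^3),\qquad \widetilde G^\dagger=O(\varepsilon^2),\qquad \mathring G^\dagger=\varepsilon\kappa|\hat y|^2+O(\varepsilon^2).$$ **Theorem.** The normal form at $\lambda^\star$ exists and is unique; denote its data by $\beta_R(\lambda^\star)$, $\hat a_m(\theta,\lambda^\star)$, etc. For all sufficiently small $\varepsilon\ne0$ the $M=3$ equations have a solution $(z^F,\lambda^F,\omega^F,\eta^F)(\varepsilon)$ which is unique in a fixed uniform neighbourhood of $(a(\phi),\lambda^\star,\omega^\star,0)$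 and tends uniformly to $(a(\phi),\lambda^\star,\omega^\star,0)$ as $\varepsilon\to0$. Writing $z^F=a(\phi)+a_0^F(\theta;\varepsilon)+\sum_{m=1}^3a_m^F(\theta;\varepsilon)\cos m\phi+b_m^F(\theta;\varepsilon)\sin m\phi$, we have, as $\varepsilon\to0$, $$\beta_R(\lambda^\star)=-\dot\alpha_R(\lambda^\star)\frac{\lambda^F(\varepsilon)-\lambda^\star}{\varepsilon^2}+O(\varepsilon^2),\qquad \beta_I(\lambda^\star)=\frac{\omega^F(\varepsilon)-\omega^\star}{\varepsilon^2}-\dot\alpha_I(\lambda^\star)\frac{\lambda^F(\varepsilon)-\lambda^\star}{\varepsilon^2}+O(\varepsilon^2),\qquad \kappa(\lambda^\star)=\frac{\eta^F(\varepsilon)}\varepsilon+O(\varepsilon^2);$$ for $m=0,2$: $\hat a_m=\frac1\varepsilon\hat a_m^F+O(\varepsilon^2)$, $\tilde a_m=\frac1\varepsilon\tilde a_m^F+O(\varepsilon^2)$, $\mathring a_m=\frac1\varepsilon\mathring a_m^F+O(\varepsilon^2)$; for $m=2$: $\hat b_m=\frac1\varepsilon\hat b_m^F+O(\varepsilon^2)$,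 $\tilde b_m=\frac1\varepsilon\tilde b_m^F+O(\varepsilon^2)$, $\mathring b_m=\frac1\varepsilon\mathring b_m^F+O(\varepsilon^2)$; and for $m=1,3$: $\hat a_m=\frac1{\varepsilon^2}\hat a_m^F+O(\varepsilon^2)$, $\hat b_m=\frac1{\varepsilon^2}\hat b_m^F+O(\varepsilon^2)$. Here the coefficients on the left are taken at $(\theta,\lambda^\star)$, and these estimates between functions of $\theta$ hold uniformly in $\theta$ together with their first $\theta$-derivatives. -/

import Mathlib

open Filter Topology Asymptotics Set
open scoped ContDiff

noncomputable section

namespace NeimarkSacker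

/-- The state space `ℝⁿ` with `n = k + 3`. -/
abbrev State (k : ℕ) := EuclideanSpace ℝ (Fin (k + 3))

/-- The space `ℝ² × ℝⁿ⁻³ × ℝ` of Floquet variables `z = (ẑ, z̃, z̊)`. -/
abbrev Floq (k : ℕ) := EuclideanSpace ℝ (Fin 2) × EuclideanSpace ℝ (Fin k) × ℝ

/-- The linear map of `ℝ²` with matrix `((a, -b), (b, a))`. -/
def conf (a b : ℝ) : EuclideanSpace ℝ (Fin 2) →L[ℝ] EuclideanSpace ℝ (Fin 2) :=
  Matrix.toEuclideanCLM (𝕜 := ℝ) !![a, -b; b, a]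

/-- The data: a vector field `F x lam`, its family of periodic orbits `v θ lam` of period
`2π T lam` (rescaled to period `2π`), the Floquet vectors `P θ lam`, and the Floquet exponents,
given by `αR lam ± i αI lam`, by the eigenvalues of `Et lam`, and by `0`. -/
structure Family (k : ℕ) where
  F : State k → ℝ → State k
  T : ℝ → ℝ
  v : ℝ → ℝ → State k
  P : ℝ → ℝ → (Floq k →L[ℝ] State k)
  αR : ℝ → ℝ
  αI : ℝ → ℝ
  Et : ℝ → Matrix (Fin k) (Fin k) ℝ

variable {k : ℕ}

/-- The block-diagonal matrix `E(lam) = diag (Ê(lam), Ẽ(lam), 0)`. -/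
def Family.E (S : Family k) (lam : ℝ) : Floq k →L[ℝ] Floq k :=
  (conf (S.αR lam) (S.αI lam)).prodMap
    ((Matrix.toEuclideanCLM (𝕜 := ℝ) (S.Et lam)).prodMap (0 : ℝ →L[ℝ] ℝ))

/-- The standing assumptions for a Neimark–Sacker point `(lamS, omS)`: a smooth curve of periodic
orbits together with its smoothly continued Floquet decomposition for `lam` in an open set `Λ`
around `lamS`, critical exponents `± i omS` at `lamS`, hyperbolicity of the remaining block,
transversal crossing, and no strong resonance. -/
structure Family.IsNSPoint (S : Family k) (Λ : Set ℝ) (lamS omS : ℝ) : Prop where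
  isOpen : IsOpen Λ
  mem : lamS ∈ Λ
  smooth_F : ContDiff ℝ ∞ (fun p : State k × ℝ => S.F p.1 p.2)
  smooth_T : ContDiffOn ℝ ∞ S.T Λ
  smooth_v : ContDiffOn ℝ ∞ (fun p : ℝ × ℝ => S.v p.1 p.2) (univ ×ˢ Λ)
  smooth_P : ContDiffOn ℝ ∞ (fun p : ℝ × ℝ => S.P p.1 p.2) (univ ×ˢ Λ)
  smooth_αR : ContDiffOn ℝ ∞ S.αR Λ
  smooth_αI : ContDiffOn ℝ ∞ S.αI Λ
  smooth_Et : ∀ i j, ContDiffOn ℝ ∞ (fun lam => S.Et lam i j) Λ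
  T_pos : 0 < S.T lamS
  periodic_v : ∀ lam ∈ Λ, ∀ θ, S.v (θ + 2 * Real.pi) lam = S.v θ lam
  periodic_P : ∀ lam ∈ Λ, ∀ θ, S.P (θ + 2 * Real.pi) lam = S.P θ lam
  orbit : ∀ lam ∈ Λ, ∀ θ,
    HasDerivAt (fun s => S.v s lam) (S.T lam • S.F (S.v θ lam) lam) θ
  floquet : ∀ lam ∈ Λ, ∀ θ,
    HasDerivAt (fun s => S.P s lam)
      (S.T lam • (fderiv ℝ (fun x => S.F x lam) (S.v θ lam)).comp (S.P θ lam)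
        - (S.P θ lam).comp (S.E lam)) θ
  invertible_P : ∀ lam ∈ Λ, ∀ θ, (S.P θ lam).IsInvertible
  αR_crit : S.αR lamS = 0
  αI_crit : S.αI lamS = omS
  om_pos : 0 < omS
  om_lt : omS < 1 / 2
  hyperbolic : ∀ μ ∈ spectrum ℂ ((S.Et lamS).map (algebraMap ℝ ℂ)), μ.re ≠ 0
  transversal : deriv S.αR lamS ≠ 0
  no_strong_resonance : omS ≠ 1 / 3 ∧ omS ≠ 1 / 4

/-- The Crandall–Rabinowitz map
`G(z, lam, η, θ; ε) = ε⁻¹ P⁻¹ {T F(v + ε P z) - T F(v) - ε (1 + ε η) (∂P/∂θ) z}`. -/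
def Family.G (S : Family k) (z : Floq k) (lam η θ ε : ℝ) : Floq k :=
  ε⁻¹ • (S.P θ lam).inverse
    (S.T lam • S.F (S.v θ lam + ε • S.P θ lam z) lam
      - S.T lam • S.F (S.v θ lam) lam
      - (ε * (1 + ε * η)) • (deriv (fun s => S.P s lam) θ) z)

/-- `(cos φ, sin φ)`. -/
def aHat (φ : ℝ) : EuclideanSpace ℝ (Fin 2) := !₂[Real.cos φ, Real.sin φ]

/-- `(-sin φ, cos φ)`. -/
def aHatDot (φ : ℝ) : EuclideanSpace ℝ (Fin 2) := !₂[-Real.sin φ, Real.cos φ]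

/-- `(cos φ, sin φ, 0, …, 0)`. -/
def aStar (k : ℕ) (φ : ℝ) : Floq k := (aHat φ, 0, 0)

/-- The last unit vector. -/
def eLast (k : ℕ) : Floq k := (0, 0, 1)

/-- The mean over one period. -/
def mean (f : ℝ → ℝ) : ℝ := (2 * Real.pi)⁻¹ * ∫ θ in (0 : ℝ)..2 * Real.pi, f θ

/-- The mean over the two-dimensional torus. -/
def mean₂ (f : ℝ → ℝ → ℝ) : ℝ :=
  ((2 * Real.pi) ^ 2)⁻¹ *
    ∫ φ in (0 : ℝ)..2 * Real.pi, ∫ θ in (0 : ℝ)..2 * Real.pi, f θ φ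

/-- The coefficient of `cos (m φ)` in the Fourier series of `f` (its mean for `m = 0`). -/
def cosCoeff (m : ℕ) (f : ℝ → Floq k) : Floq k :=
  (if m = 0 then (2 * Real.pi)⁻¹ else Real.pi⁻¹) •
    ∫ φ in (0 : ℝ)..2 * Real.pi, Real.cos (m * φ) • f φ

/-- The coefficient of `sin (m φ)` in the Fourier series of `f`. -/
def sinCoeff (m : ℕ) (f : ℝ → Floq k) : Floq k :=
  Real.pi⁻¹ • ∫ φ in (0 : ℝ)..2 * Real.pi, Real.sin (m * φ) • f φ

/-- Truncation of the Fourier series of `f` to the modes `0, …, M`. -/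
def trunc (M : ℕ) (f : ℝ → Floq k) (φ : ℝ) : Floq k :=
  ∑ m ∈ Finset.range (M + 1),
    (Real.cos (m * φ) • cosCoeff m f + Real.sin (m * φ) • sinCoeff m f)

/-- The unknowns of the torus equations: `z(θ, φ)`, `lam`, `ω` and `η`. -/
@[ext] structure Torus (k : ℕ) where
  z : ℝ → ℝ → Floq k
  lam : ℝ
  om : ℝ
  eta : ℝ

/-- The coefficient function `a_m(θ)` in
`z(θ, φ) = a⋆(φ) + a_0(θ) + ∑ (a_m(θ) cos mφ + b_m(θ) sin mφ)`. -/
def Torus.a (u : Torus k) (m : ℕ) (θ : ℝ) : Floq k :=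
  cosCoeff m (fun φ => u.z θ φ - aStar k φ)

/-- The coefficient function `b_m(θ)` in
`z(θ, φ) = a⋆(φ) + a_0(θ) + ∑ (a_m(θ) cos mφ + b_m(θ) sin mφ)`. -/
def Torus.b (u : Torus k) (m : ℕ) (θ : ℝ) : Floq k :=
  sinCoeff m (fun φ => u.z θ φ - aStar k φ)

/-- `u` solves the Crandall–Rabinowitz torus equations with `M = 3` Fourier `φ`-modes. -/
structure Family.IsFourierSol (S : Family k) (ε : ℝ) (u : Torus k) : Prop where
  contDiff : ContDiff ℝ 1 (fun p : ℝ × ℝ => u.z p.1 p.2)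
  periodic : ∀ θ φ, u.z (θ + 2 * Real.pi) φ = u.z θ φ
  modes : ∀ θ φ, trunc 3 (u.z θ) φ = u.z θ φ
  equation : ∀ θ φ,
    trunc 3 (fun ψ => S.G (u.z θ ψ) u.lam u.eta θ ε) φ - u.eta • eLast k
      - ((1 + ε * u.eta) • deriv (fun s => u.z s φ) θ
          + u.om • deriv (fun s => u.z θ s) φ) = 0
  amplitude : mean₂ (fun θ φ => inner ℝ (u.z θ φ).1 (aHat φ)) = 1
  phase : mean₂ (fun θ φ => inner ℝ (u.z θ φ).1 (aHatDot φ)) = 0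
  phase_last : mean₂ (fun θ φ => (u.z θ φ).2.2) = 0

/-- `u` lies within `r` (uniformly) of `z = a⋆(φ)`, `lam = lamS`, `ω = omS`, `η = 0`. -/
def Torus.Near (u : Torus k) (lamS omS r : ℝ) : Prop :=
  (∀ θ φ, ‖u.z θ φ - aStar k φ‖ < r) ∧ |u.lam - lamS| < r ∧ |u.om - omS| < r ∧ |u.eta| < r

/-- The coefficients, at a fixed parameter value, of the near-identity maps `ĥ` (`ah`, `bh`),
`h̃` (`at`, `bt`) and `h̊` (`ar`, `br`), as functions of `θ`, together with `κ` and the Lyapunov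
coefficients `βR`, `βI`. -/
@[ext] structure NormalForm (k : ℕ) where
  ah0 : ℝ → EuclideanSpace ℝ (Fin 2)
  ah1 : ℝ → EuclideanSpace ℝ (Fin 2)
  ah2 : ℝ → EuclideanSpace ℝ (Fin 2)
  ah3 : ℝ → EuclideanSpace ℝ (Fin 2)
  bh1 : ℝ → EuclideanSpace ℝ (Fin 2)
  bh2 : ℝ → EuclideanSpace ℝ (Fin 2)
  bh3 : ℝ → EuclideanSpace ℝ (Fin 2)
  at0 : ℝ → EuclideanSpace ℝ (Fin k)
  at2 : ℝ → EuclideanSpace ℝ (Fin k)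
  bt2 : ℝ → EuclideanSpace ℝ (Fin k)
  ar0 : ℝ → ℝ
  ar2 : ℝ → ℝ
  br2 : ℝ → ℝ
  κ : ℝ
  βR : ℝ
  βI : ℝ

/-- `ĥ(y; θ)`, a sum of a quadratic and a cubic form in `y`. -/
def NormalForm.hHat (N : NormalForm k) (θ : ℝ) (y : EuclideanSpace ℝ (Fin 2)) :
    EuclideanSpace ℝ (Fin 2) :=
  (y 0 ^ 2 + y 1 ^ 2) • N.ah0 θ + (y 0 ^ 2 - y 1 ^ 2) • N.ah2 θ + (2 * y 0 * y 1) • N.bh2 θ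
    + (y 0 * (y 0 ^ 2 + y 1 ^ 2)) • N.ah1 θ + (y 1 * (y 0 ^ 2 + y 1 ^ 2)) • N.bh1 θ
    + (y 0 * (y 0 ^ 2 - 3 * y 1 ^ 2)) • N.ah3 θ + (y 1 * (3 * y 0 ^ 2 - y 1 ^ 2)) • N.bh3 θ

/-- `h̃(y; θ)`, a quadratic form in `y`. -/
def NormalForm.hTilde (N : NormalForm k) (θ : ℝ) (y : EuclideanSpace ℝ (Fin 2)) :
    EuclideanSpace ℝ (Fin k) :=
  (y 0 ^ 2 + y 1 ^ 2) • N.at0 θ + (y 0 ^ 2 - y 1 ^ 2) • N.at2 θ + (2 * y 0 * y 1) • N.bt2 θ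

/-- `h̊(y; θ)`, a quadratic form in `y`. -/
def NormalForm.hRing (N : NormalForm k) (θ : ℝ) (y : EuclideanSpace ℝ (Fin 2)) : ℝ :=
  (y 0 ^ 2 + y 1 ^ 2) * N.ar0 θ + (y 0 ^ 2 - y 1 ^ 2) * N.ar2 θ + (2 * y 0 * y 1) * N.br2 θ

/-- The near-identity transformation `z = y + ε⁻¹ (ĥ, h̃, h̊)(ε ŷ; θ)`. -/
def NormalForm.Z (N : NormalForm k) (ε θ : ℝ) (y : Floq k) : Floq k :=
  y + ε⁻¹ • (N.hHat θ (ε • y.1), N.hTilde θ (ε • y.1), N.hRing θ (ε • y.1))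

/-- The transformed map `G†(y, lam, ζ, θ; ε)`: substituting `z = Z(y, θ)` and `η = ζ + ε κ`,
the equation `G - η eₙ - [(1 + ε η) ∂_θ + ω ∂_φ] z = 0` becomes
`G† - (ζ + ε κ) eₙ - [(1 + ε η) ∂_θ + ω ∂_φ] y = 0`, by the chain rule and because the
derivative of `Z` in `y` fixes `eₙ`. -/
def Family.Gdag (S : Family k) (N : NormalForm k) (y : Floq k) (lam ζ θ ε : ℝ) : Floq k :=
  (fderiv ℝ (fun w => N.Z ε θ w) y).inverse
    (S.G (N.Z ε θ y) lam (ζ + ε * N.κ) θ ε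
      - (1 + ε * (ζ + ε * N.κ)) • deriv (fun s => N.Z ε s y) θ)

/-- `N` is the normal form at parameter value `lam`. The last three conditions, for `ŷ` on the unit
circle, `ỹ = 0`, `ẙ = 0`, `ζ = 0`, are the expansions of the three components of `G†`:
`Ĝ† = Ê ŷ + ε² |ŷ|² B̂ ŷ + O(ε³)`, `G̃† = O(ε²)` and `G̊† = ε κ |ŷ|² + O(ε²)`. Homogeneous polynomials
are determined by their values on `|ŷ| = 1`. The restriction to `|ŷ| = 1` only matters for the
one contribution to `G†` that is not homogeneous, the linear term that
`η = ε κ` produces at order `ε²`; on the circle it counts as a cubic term, being multiplied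
by `|ŷ|² = 1`. -/
structure Family.IsNormalForm (S : Family k) (lam : ℝ) (N : NormalForm k) : Prop where
  smooth_hat : ∀ f ∈ [N.ah0, N.ah1, N.ah2, N.ah3, N.bh1, N.bh2, N.bh3],
    ContDiff ℝ ∞ f ∧ ∀ θ, f (θ + 2 * Real.pi) = f θ
  smooth_tilde : ∀ f ∈ [N.at0, N.at2, N.bt2],
    ContDiff ℝ ∞ f ∧ ∀ θ, f (θ + 2 * Real.pi) = f θ
  smooth_ring : ∀ f ∈ [N.ar0, N.ar2, N.br2],
    ContDiff ℝ ∞ f ∧ ∀ θ, f (θ + 2 * Real.pi) = f θ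
  restrict_amp : mean (fun θ => N.ah1 θ 0) + mean (fun θ => N.bh1 θ 1) = 0
  restrict_phase : mean (fun θ => N.ah1 θ 1) - mean (fun θ => N.bh1 θ 0) = 0
  restrict_ring : mean N.ar0 = 0
  hat : ∀ θ φ,
    (fun ε : ℝ => (S.Gdag N (aStar k φ) lam 0 θ ε).1 - conf (S.αR lam) (S.αI lam) (aHat φ)
      - ε ^ 2 • conf N.βR N.βI (aHat φ)) =O[𝓝[≠] 0] fun ε : ℝ => ε ^ 3
  tilde : ∀ θ φ,
    (fun ε : ℝ => (S.Gdag N (aStar k φ) lam 0 θ ε).2.1) =O[𝓝[≠] 0] fun ε : ℝ => ε ^ 2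
  ring : ∀ θ φ,
    (fun ε : ℝ => (S.Gdag N (aStar k φ) lam 0 θ ε).2.2 - ε * N.κ) =O[𝓝[≠] 0]
      fun ε : ℝ => ε ^ 2

/-- `f ε θ = O(ε²)` as `ε → 0`, uniformly in `θ` and together with the derivative in `θ`. -/
def IsOSq {V : Type*} [NormedAddCommGroup V] [NormedSpace ℝ V] (f : ℝ → ℝ → V) : Prop :=
  ∃ C : ℝ, ∀ᶠ ε in 𝓝[≠] (0 : ℝ), ∀ θ, ‖f ε θ‖ ≤ C * ε ^ 2 ∧ ‖deriv (f ε) θ‖ ≤ C * ε ^ 2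

end NeimarkSacker

end

set_option linter.unusedSectionVars false
set_option maxSynthPendingDepth 3

namespace NeimarkSacker

/-! ### Smooth parametric integrals and Hadamard quotients -/

section Calculus

variable {E X Y W W₁ W₂ : Type}
  [NormedAddCommGroup E] [NormedSpace ℝ E] [NormedAddCommGroup X] [NormedSpace ℝ X]
  [NormedAddCommGroup Y] [NormedSpace ℝ Y] [NormedAddCommGroup W] [NormedSpace ℝ W]
  [NormedAddCommGroup W₁] [NormedSpace ℝ W₁] [NormedAddCommGroup W₂] [NormedSpace ℝ W₂]

/-! Written in the Fourier modes 0, …, 3 of φ, the torus equations are a 2π-periodic ordinary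
differential equation in θ for seven coefficient functions, with three free parameters (λ, ω, η) and
three integral conditions. Hadamard quotients give G = E z + ε B(z, z) + ε² C(εz)(z, z, z) − εη Q z,
which extends smoothly through ε = 0 (`exists_expansion`). At ε = 0 the system is autonomous and
linear in the coefficients, and a(φ), λ*, ω*, 0 solves it.

In mode m the linearisation has frequencies (m ± 1)ω* in the critical plane, exponents off the
imaginary axis in the hyperbolic block, and frequency mω* in the last direction. As jω* is not an
integer for 1 ≤ j ≤ 4, only frequency zero is resonant: one complex combination in mode 1 and the
mode 0 of the last component. The three integral conditions remove this kernel, and the three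
parameters fill the cokernel because the derivative of α_R is nonzero (`nondegenerate_lin`). A
Fredholm alternative and the inverse function theorem on continuous functions of the circle then
give a smooth, locally unique branch (`exists_branch`).

Replacing z(θ, φ), η, ε by −z(θ, φ + π), −η, −ε preserves the equations. By uniqueness λ and ω are
even in ε, η is odd, even modes are odd in ε and odd modes are even (`Branch.parity`). Expansions
therefore advance two orders at a time, which explains the O(ε²) accuracy.

On |ŷ| = 1 the quadratic and cubic forms of the near-identity map are trigonometric polynomials with
modes 0, 2 and 1, 3. The normal form conditions become linear periodic equations for these
coefficients (`gdag_iff`). Their forcing has degree at most 3, so truncation loses nothing. The ε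
and ε² coefficients of the branch solve the same equations, the second-order shifts of λ and ω
supplying β_R and β_I. This gives existence (`isNormalForm`) and the estimates together; uniqueness
is nondegeneracy again (`normalForm_unique`). -/

theorem hasFDerivAt_intervalIntegral_of_contDiff {f : E → ℝ → W}
    (hf : ContDiff ℝ 1 (fun p : E × ℝ => f p.1 p.2)) (a b : ℝ) (x₀ : E) :
    HasFDerivAt (fun x => ∫ s in a..b, f x s)
      (∫ s in a..b, fderiv ℝ (fun x => f x s) x₀) x₀ := by
  have hd : Continuous (fun p : E × ℝ => fderiv ℝ (fun x => f x p.2) p.1) := by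
    have h : ContDiff ℝ 1 (Function.uncurry (fun (p : E × ℝ) (x : E) => f x p.2)) :=
      hf.comp (contDiff_snd.prodMk (contDiff_snd.comp contDiff_fst))
    exact (ContDiff.fderiv (n := 0) h contDiff_fst (by norm_num)).continuous
  have hfs : ∀ x, Continuous (f x) := fun x =>
    hf.continuous.comp (continuous_const.prodMk continuous_id)
  obtain ⟨M, hM⟩ : ∃ M, ∀ p ∈ ({x₀} : Set E) ×ˢ uIcc a b,
      ‖fderiv ℝ (fun x => f x p.2) p.1‖ ≤ M := by
    obtain ⟨M, hM⟩ := ((isCompact_singleton.prod isCompact_uIcc).image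
      hd.norm).bddAbove
    exact ⟨M, fun p hp => hM ⟨p, hp, rfl⟩⟩
  have hopen : IsOpen {p : E × ℝ | ‖fderiv ℝ (fun x => f x p.2) p.1‖ < M + 1} :=
    isOpen_lt hd.norm continuous_const
  -- `E` need not be locally compact, so the bound on the compact slice over `x₀` is carried to
  -- nearby slices by the tube lemma, at the price of `M + 1`. It serves as the dominating function.
  obtain ⟨U, V, hU, -, hxU, hV, hUV⟩ := generalized_tube_lemma (isCompact_singleton (x := x₀))
    (isCompact_uIcc (a := a) (b := b)) hopen
    (fun p hp => lt_of_le_of_lt (hM p hp) (lt_add_one M))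
  refine intervalIntegral.hasFDerivAt_integral_of_dominated_of_fderiv_le
    (F' := fun x s => fderiv ℝ (fun x => f x s) x) (bound := fun _ => M + 1)
    (hU.mem_nhds (hxU rfl)) (Eventually.of_forall fun x => (hfs x).aestronglyMeasurable)
    ((hfs x₀).intervalIntegrable _ _) ?_ ?_ intervalIntegrable_const ?_
  · exact (hd.comp (continuous_const.prodMk continuous_id)).aestronglyMeasurable
  · exact Eventually.of_forall fun t ht x hx =>
      (hUV (mk_mem_prod hx (hV (uIoc_subset_uIcc ht)))).le
  · refine Eventually.of_forall fun t _ x _ => ?_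
    have : ContDiff ℝ 1 (fun x => f x t) := hf.comp (contDiff_id.prodMk contDiff_const)
    exact (this.differentiable one_ne_zero x).hasFDerivAt

/-- The target space is quantified inside the induction because the derivative is an integral of the
same kind with values in `E →L[ℝ] W`. -/
theorem contDiff_intervalIntegral (n : ℕ) (a b : ℝ) : ∀ {W : Type} [NormedAddCommGroup W]
    [NormedSpace ℝ W] {f : E → ℝ → W}, ContDiff ℝ n (fun p : E × ℝ => f p.1 p.2) →
    ContDiff ℝ n (fun x => ∫ s in a..b, f x s) := by
  induction n with
  | zero =>
    intro W _ _ f hf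
    exact contDiff_zero.2
      (intervalIntegral.continuous_parametric_intervalIntegral_of_continuous' hf.continuous a b)
  | succ n ih =>
    intro W _ _ f hf
    have h1 : ContDiff ℝ 1 (fun p : E × ℝ => f p.1 p.2) :=
      hf.of_le (by exact_mod_cast Nat.le_add_left 1 n)
    have hder := hasFDerivAt_intervalIntegral_of_contDiff h1 a b
    have hd : ContDiff ℝ n (fun p : E × ℝ => fderiv ℝ (fun x => f x p.2) p.1) := by
      have h : ContDiff ℝ (n + 1 : ℕ) (Function.uncurry (fun (p : E × ℝ) (x : E) => f x p.2)) :=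
        hf.comp (contDiff_snd.prodMk (contDiff_snd.comp contDiff_fst))
      exact ContDiff.fderiv h contDiff_fst (by simp)
    have key : ContDiff ℝ ((n : ℕ∞ω) + 1) (fun x => ∫ s in a..b, f x s) := by
      rw [contDiff_succ_iff_hasFDerivAt]
      refine ⟨_, ?_, fun x => hder x⟩
      exact ih hd
    exact_mod_cast key

theorem contDiff_infty_intervalIntegral {f : E → ℝ → W} (a b : ℝ)
    (hf : ContDiff ℝ ∞ (fun p : E × ℝ => f p.1 p.2)) :
    ContDiff ℝ ∞ (fun x => ∫ s in a..b, f x s) :=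
  contDiff_infty.2 fun n => contDiff_intervalIntegral n a b (contDiff_infty.1 hf n)

/-- The Hadamard quotient: `f y x = f y 0 + hquot f y x x`. -/
noncomputable def hquot (f : Y → X → W) (y : Y) (x : X) : X →L[ℝ] W :=
  ∫ s in (0 : ℝ)..1, fderiv ℝ (f y) (s • x)

theorem contDiff_hquot {f : Y → X → W} {n : ℕ}
    (hf : ContDiff ℝ (n + 1 : ℕ) (fun p : Y × X => f p.1 p.2)) :
    ContDiff ℝ n (fun p : Y × X => hquot f p.1 p.2) := by
  refine contDiff_intervalIntegral n 0 1 (f := fun (p : Y × X) s => fderiv ℝ (f p.1) (s • p.2)) ?_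
  have h : ContDiff ℝ (n + 1 : ℕ) (Function.uncurry (fun (p : (Y × X) × ℝ) (x : X) => f p.1.1 x)) :=
    hf.comp ((contDiff_fst.comp (contDiff_fst.comp contDiff_fst)).prodMk contDiff_snd)
  exact ContDiff.fderiv h (by fun_prop) (by simp)

theorem contDiff_infty_hquot {f : Y → X → W}
    (hf : ContDiff ℝ ∞ (fun p : Y × X => f p.1 p.2)) :
    ContDiff ℝ ∞ (fun p : Y × X => hquot f p.1 p.2) :=
  contDiff_infty.2 fun n => contDiff_hquot (contDiff_infty.1 hf (n + 1))

theorem hquot_zero [CompleteSpace W] (f : Y → X → W) (y : Y) :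
    hquot f y 0 = fderiv ℝ (f y) 0 := by
  simp [hquot]

theorem eq_add_hquot [CompleteSpace W] {f : Y → X → W} {y : Y} (hf : ContDiff ℝ 1 (f y)) (x : X) :
    f y x = f y 0 + hquot f y x x := by
  have hc : Continuous (fun s : ℝ => fderiv ℝ (f y) (s • x)) :=
    (hf.continuous_fderiv one_ne_zero).comp (by fun_prop)
  have hd : ∀ s ∈ uIcc (0 : ℝ) 1,
      HasDerivAt (fun s : ℝ => f y (s • x)) (fderiv ℝ (f y) (s • x) x) s := by
    intro s _
    have h1 := (hf.differentiable one_ne_zero (s • x)).hasFDerivAt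
    have h2 : HasDerivAt (fun s : ℝ => s • x) ((1 : ℝ) • x) s := (hasDerivAt_id s).smul_const x
    rw [one_smul] at h2
    exact h1.comp_hasDerivAt s h2
  have := intervalIntegral.integral_eq_sub_of_hasDerivAt hd
    ((hc.clm_apply continuous_const).intervalIntegrable _ _)
  rw [hquot, ContinuousLinearMap.intervalIntegral_apply (hc.intervalIntegrable _ _), this]
  simp

/-- Each use costs one derivative and leaves a quotient that is differentiable jointly in the
parameter and ε, so it can be iterated. -/
theorem exists_taylor_one [CompleteSpace W] {f : Y → ℝ → W} {n : ℕ}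
    (hf : ContDiff ℝ (n + 1 : ℕ) (fun p : Y × ℝ => f p.1 p.2)) :
    ∃ q : Y → ℝ → W, ContDiff ℝ n (fun p : Y × ℝ => q p.1 p.2) ∧
      ∀ y ε, f y ε = f y 0 + ε • q y ε := by
  refine ⟨fun y ε => hquot f y ε 1, (contDiff_hquot hf).clm_apply contDiff_const, fun y ε => ?_⟩
  have h1 : ContDiff ℝ 1 (f y) :=
    (hf.comp (contDiff_const.prodMk contDiff_id)).of_le (by exact_mod_cast Nat.le_add_left 1 n)
  conv_lhs => rw [eq_add_hquot h1 ε]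
  rw [← ContinuousLinearMap.map_smul, smul_eq_mul, mul_one]

theorem exists_taylor_three [CompleteSpace W] {f : Y → ℝ → W} {n : ℕ}
    (hf : ContDiff ℝ (n + 3 : ℕ) (fun p : Y × ℝ => f p.1 p.2)) :
    ∃ (q₁ q₂ : Y → W) (r : Y → ℝ → W), ContDiff ℝ n q₁ ∧ ContDiff ℝ n q₂ ∧
      ContDiff ℝ n (fun p : Y × ℝ => r p.1 p.2) ∧
      ∀ y ε, f y ε = f y 0 + ε • q₁ y + ε ^ 2 • q₂ y + ε ^ 3 • r y ε := by
  obtain ⟨a, ha, ha'⟩ := exists_taylor_one (n := n + 2) hf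
  obtain ⟨b, hb, hb'⟩ := exists_taylor_one (n := n + 1) ha
  obtain ⟨c, hc, hc'⟩ := exists_taylor_one (n := n) hb
  refine ⟨fun y => a y 0, fun y => b y 0, c, ?_, ?_, hc, fun y ε => ?_⟩
  · exact (ha.comp (contDiff_id.prodMk contDiff_const)).of_le
      (by exact_mod_cast Nat.le_add_right n 2)
  · exact (hb.comp (contDiff_id.prodMk contDiff_const)).of_le
      (by exact_mod_cast Nat.le_add_right n 1)
  · conv_lhs => rw [ha' y ε, hb' y ε, hc' y ε]
    module

/-- A bump function times the identity. Precomposing with it turns objects that are smooth only near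
a point into globally smooth ones without changing them near that point. -/
theorem exists_cutoff {r : ℝ} (hr : 0 < r) :
    ∃ χ : ℝ → ℝ, ContDiff ℝ ∞ χ ∧ (∀ x, |χ x| < r) ∧ ∃ δ > 0, ∀ x, |x| < δ → χ x = x := by
  let b : ContDiffBump (0 : ℝ) := ⟨r / 2, r, half_pos hr, half_lt_self hr⟩
  refine ⟨fun x => x * b x, contDiff_id.mul b.contDiff, fun x => ?_, r / 2, half_pos hr,
    fun x hx => ?_⟩
  · by_cases hx : |x| < r
    · rw [abs_mul, abs_of_nonneg b.nonneg]
      exact lt_of_le_of_lt (mul_le_of_le_one_right (abs_nonneg x) b.le_one) hx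
    · have : b x = 0 := b.zero_of_le_dist (by simpa [b, Real.dist_eq] using not_lt.1 hx)
      simpa [this] using hr
  · have : b x = 1 := b.one_of_mem_closedBall (by simpa [b, Real.dist_eq] using hx.le)
    simp [this]

end Calculus

/-! ### Second-order jets at `ε = 0` -/

section Jets

variable {W W₁ W₂ : Type} [NormedAddCommGroup W] [NormedSpace ℝ W]
  [NormedAddCommGroup W₁] [NormedSpace ℝ W₁] [NormedAddCommGroup W₂] [NormedSpace ℝ W₂]

/-- `f ε = p₀ + ε p₁ + ε² p₂ + O(ε³)`. -/
def Jet (f : ℝ → W) (p₀ p₁ p₂ : W) : Prop :=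
  (fun ε : ℝ => f ε - (p₀ + ε • p₁ + ε ^ 2 • p₂)) =O[𝓝[≠] 0] fun ε : ℝ => ε ^ 3

theorem isBigO_pow_pow {m n : ℕ} (h : n ≤ m) :
    (fun ε : ℝ => ε ^ m) =O[𝓝[≠] 0] fun ε : ℝ => ε ^ n := by
  obtain ⟨j, rfl⟩ := Nat.exists_eq_add_of_le h
  have : (fun ε : ℝ => ε ^ j) =O[𝓝[≠] 0] fun _ => (1 : ℝ) :=
    ((continuous_pow j).continuousAt.isBigO_one ℝ).mono nhdsWithin_le_nhds
  simpa [pow_add] using (isBigO_refl (fun ε : ℝ => ε ^ n) _).mul this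

theorem Jet.congr {f g : ℝ → W} {p₀ p₁ p₂ : W} (h : Jet f p₀ p₁ p₂) (hfg : f =ᶠ[𝓝[≠] 0] g) :
    Jet g p₀ p₁ p₂ :=
  h.congr' (hfg.mono fun ε hε => by simp [hε]) EventuallyEq.rfl

theorem Jet.of_poly (p₀ p₁ p₂ : W) : Jet (fun ε => p₀ + ε • p₁ + ε ^ 2 • p₂) p₀ p₁ p₂ := by
  simpa [Jet] using isBigO_zero _ _

theorem Jet.const (p : W) : Jet (fun _ => p) p 0 0 := by simpa using Jet.of_poly p 0 0

theorem Jet.add {f g : ℝ → W} {p₀ p₁ p₂ q₀ q₁ q₂ : W} (hf : Jet f p₀ p₁ p₂)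
    (hg : Jet g q₀ q₁ q₂) : Jet (fun ε => f ε + g ε) (p₀ + q₀) (p₁ + q₁) (p₂ + q₂) :=
  (IsBigO.add hf hg).congr_left fun ε => by module

theorem Jet.sub {f g : ℝ → W} {p₀ p₁ p₂ q₀ q₁ q₂ : W} (hf : Jet f p₀ p₁ p₂)
    (hg : Jet g q₀ q₁ q₂) : Jet (fun ε => f ε - g ε) (p₀ - q₀) (p₁ - q₁) (p₂ - q₂) :=
  (IsBigO.sub hf hg).congr_left fun ε => by module

theorem Jet.clm {f : ℝ → W} {p₀ p₁ p₂ : W} (L : W →L[ℝ] W₁) (hf : Jet f p₀ p₁ p₂) :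
    Jet (fun ε => L (f ε)) (L p₀) (L p₁) (L p₂) :=
  ((L.isBigO_comp _ _).trans hf).congr_left fun ε => by simp

theorem Jet.isBigO_one {f : ℝ → W} {p₀ p₁ p₂ : W} (hf : Jet f p₀ p₁ p₂) :
    f =O[𝓝[≠] 0] fun _ => (1 : ℝ) := by
  have h3 : (fun ε : ℝ => ε ^ 3) =O[𝓝[≠] 0] fun _ => (1 : ℝ) := by
    simpa using isBigO_pow_pow (Nat.zero_le 3)
  have hp : (fun ε : ℝ => p₀ + ε • p₁ + ε ^ 2 • p₂) =O[𝓝[≠] 0] fun _ => (1 : ℝ) := by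
    have : Continuous (fun ε : ℝ => p₀ + ε • p₁ + ε ^ 2 • p₂) := by fun_prop
    exact (this.continuousAt.isBigO_one ℝ).mono nhdsWithin_le_nhds
  exact ((IsBigO.trans hf h3).add hp).congr_left fun ε => by abel

theorem Jet.sub_isBigO {f : ℝ → W} {p₀ p₁ p₂ : W} (hf : Jet f p₀ p₁ p₂) :
    (fun ε => f ε - p₀) =O[𝓝[≠] 0] fun ε : ℝ => ε := by
  have h3 : (fun ε : ℝ => ε ^ 3) =O[𝓝[≠] 0] fun ε : ℝ => ε := by
    simpa using isBigO_pow_pow (show 1 ≤ 3 by norm_num)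
  have hp : (fun ε : ℝ => ε • (p₁ + ε • p₂)) =O[𝓝[≠] 0] fun ε : ℝ => ε := by
    have : Continuous (fun ε : ℝ => p₁ + ε • p₂) := by fun_prop
    have h := (this.continuousAt (x := 0).isBigO_one ℝ).mono (nhdsWithin_le_nhds (s := {0}ᶜ))
    simpa using (isBigO_refl (fun ε : ℝ => ε) (𝓝[≠] 0)).smul h
  exact ((IsBigO.trans hf h3).add hp).congr_left fun ε => by module

theorem Jet.bilin {f : ℝ → W₁} {g : ℝ → W₂} {p₀ p₁ p₂ : W₁} {q₀ q₁ q₂ : W₂}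
    (B : W₁ →L[ℝ] W₂ →L[ℝ] W) (hf : Jet f p₀ p₁ p₂) (hg : Jet g q₀ q₁ q₂) :
    Jet (fun ε => B (f ε) (g ε)) (B p₀ q₀) (B p₀ q₁ + B p₁ q₀)
      (B p₀ q₂ + B p₁ q₁ + B p₂ q₀) := by
  have hB : ∀ {l : Filter ℝ} {u : ℝ → W₁} {v : ℝ → W₂} {a b : ℝ → ℝ}, u =O[l] a → v =O[l] b →
      (fun ε => B (u ε) (v ε)) =O[l] fun ε => a ε * b ε := fun hu hv =>
    (IsBigO.of_bound ‖B‖ (Eventually.of_forall fun ε => by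
      simpa [mul_assoc] using B.le_opNorm₂ _ _)).trans (hu.norm_left.mul hv.norm_left)
  have h1 := hB hf hg.isBigO_one
  have h2 : (fun ε : ℝ => p₀ + ε • p₁ + ε ^ 2 • p₂) =O[𝓝[≠] 0] fun _ => (1 : ℝ) :=
    (Jet.of_poly p₀ p₁ p₂).isBigO_one
  have h3 := hB h2 hg
  have h4 : (fun ε : ℝ => ε ^ 3 • (B p₁ q₂ + B p₂ q₁ + ε • B p₂ q₂)) =O[𝓝[≠] 0]
      fun ε : ℝ => ε ^ 3 := by
    have : Continuous (fun ε : ℝ => B p₁ q₂ + B p₂ q₁ + ε • B p₂ q₂) := by fun_prop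
    have h := (this.continuousAt (x := 0).isBigO_one ℝ).mono (nhdsWithin_le_nhds (s := {0}ᶜ))
    simpa using (isBigO_refl (fun ε : ℝ => ε ^ 3) (𝓝[≠] 0)).smul h
  simp only [mul_one, one_mul] at h1 h3
  refine ((h1.add h3).add h4).congr_left fun ε => ?_
  simp only [map_add, map_sub, map_smul, add_apply, sub_apply,
    smul_apply]
  module

theorem Jet.clm_apply {A : ℝ → W₁ →L[ℝ] W} {g : ℝ → W₁} {a₀ a₁ a₂ : W₁ →L[ℝ] W} {q₀ q₁ q₂ : W₁}
    (hA : Jet A a₀ a₁ a₂) (hg : Jet g q₀ q₁ q₂) :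
    Jet (fun ε => A ε (g ε)) (a₀ q₀) (a₀ q₁ + a₁ q₀) (a₀ q₂ + a₁ q₁ + a₂ q₀) :=
  Jet.bilin (ContinuousLinearMap.id ℝ (W₁ →L[ℝ] W)) hA hg

theorem Jet.smul {a : ℝ → ℝ} {g : ℝ → W} {a₀ a₁ a₂ : ℝ} {q₀ q₁ q₂ : W}
    (ha : Jet a a₀ a₁ a₂) (hg : Jet g q₀ q₁ q₂) :
    Jet (fun ε => a ε • g ε) (a₀ • q₀) (a₀ • q₁ + a₁ • q₀) (a₀ • q₂ + a₁ • q₁ + a₂ • q₀) :=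
  Jet.bilin (ContinuousLinearMap.lsmul ℝ ℝ : ℝ →L[ℝ] W →L[ℝ] W) ha hg

theorem Jet.id : Jet (fun ε : ℝ => ε) 0 1 0 := by simpa using Jet.of_poly (0 : ℝ) 1 0

theorem Jet.id_smul {g : ℝ → W} {q₀ q₁ q₂ : W} (hg : Jet g q₀ q₁ q₂) :
    Jet (fun ε => ε • g ε) 0 q₀ q₁ := by simpa using Jet.id.smul hg

/-- The prefactor ε² means that only the limit of `g`, with error O(ε), matters; no jet of `g` is
required. -/
theorem Jet.sq_smul {g : ℝ → W} {q : W} (hg : (fun ε => g ε - q) =O[𝓝[≠] 0] fun ε : ℝ => ε) :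
    Jet (fun ε => ε ^ 2 • g ε) 0 0 q := by
  refine ((isBigO_refl (fun ε : ℝ => ε ^ 2) (𝓝[≠] 0)).smul hg).congr (fun ε => ?_) fun ε => ?_
  · module
  · simp [pow_succ]

theorem eq_zero_of_isBigO_one_sub {p : W} (h : (fun _ : ℝ => p) =O[𝓝[≠] 0] fun ε : ℝ => ε) :
    p = 0 := by
  have h0 : Tendsto (fun ε : ℝ => ε) (𝓝[≠] 0) (𝓝 0) := nhdsWithin_le_nhds
  exact tendsto_nhds_unique tendsto_const_nhds (h.trans_tendsto h0)

/-- The coefficients are peeled off one by one: let ε tend to zero, divide by ε, and repeat. -/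
theorem Jet.eq_zero {p₀ p₁ p₂ : W} (h : Jet (fun _ => 0) p₀ p₁ p₂) :
    p₀ = 0 ∧ p₁ = 0 ∧ p₂ = 0 := by
  have h0 : p₀ = 0 := by
    simpa using eq_zero_of_isBigO_one_sub (p := 0 - p₀) h.sub_isBigO
  have cancel : ∀ (n : ℕ) (q : ℝ → W) , (fun ε : ℝ => ε • q ε) =O[𝓝[≠] 0] (fun ε : ℝ => ε ^ (n + 1))
      → q =O[𝓝[≠] 0] fun ε : ℝ => ε ^ n := by
    intro n q hq
    refine ((isBigO_refl (fun ε : ℝ => ε⁻¹) (𝓝[≠] 0)).smul hq).congr' ?_ ?_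
    · filter_upwards [self_mem_nhdsWithin] with ε hε
      simp [smul_smul, inv_mul_cancel₀ (show ε ≠ 0 from hε)]
    · filter_upwards [self_mem_nhdsWithin] with ε hε
      simp [pow_succ, inv_mul_cancel_left₀ (show ε ≠ 0 from hε), mul_comm]
  have h1 : (fun ε : ℝ => p₁ + ε • p₂) =O[𝓝[≠] 0] fun ε : ℝ => ε ^ 2 := by
    apply cancel
    refine (IsBigO.neg_left h).congr_left fun ε => ?_
    rw [h0]; module
  have h1' : p₁ = 0 := by
    apply eq_zero_of_isBigO_one_sub
    have ha : (fun ε : ℝ => ε • p₂) =O[𝓝[≠] 0] fun ε : ℝ => ε := by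
      simpa using (isBigO_refl (fun ε : ℝ => ε) (𝓝[≠] 0)).smul
        (isBigO_const_const p₂ (one_ne_zero (α := ℝ)) (𝓝[≠] 0))
    have hb := h1.trans (isBigO_pow_pow (show 1 ≤ 2 by norm_num))
    simp only [pow_one] at hb
    exact (hb.sub ha).congr_left fun ε => by module
  refine ⟨h0, h1', eq_zero_of_isBigO_one_sub ?_⟩
  have := cancel 1 (fun _ => p₂) (h1.congr_left fun ε => by rw [h1']; module)
  simpa using this

theorem Jet.unique {f : ℝ → W} {p₀ p₁ p₂ q₀ q₁ q₂ : W} (hp : Jet f p₀ p₁ p₂)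
    (hq : Jet f q₀ q₁ q₂) : p₀ = q₀ ∧ p₁ = q₁ ∧ p₂ = q₂ := by
  have h := hp.sub hq
  simp only [sub_self] at h
  obtain ⟨h0, h1, h2⟩ := h.eq_zero
  exact ⟨sub_eq_zero.1 h0, sub_eq_zero.1 h1, sub_eq_zero.1 h2⟩

/-- Since `l` has no linear term, `l - l₀` is O(ε²) and the quadratic Taylor remainder of `f` is
O(ε⁴). Hence only the first derivative of `f` is visible. -/
theorem Jet.comp_contDiff [CompleteSpace W] {f : ℝ → W} {l : ℝ → ℝ} {l₀ l₂ : ℝ}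
    (hf : ContDiff ℝ ∞ f) (hl : Jet l l₀ 0 l₂) :
    Jet (fun ε => f (l ε)) (f l₀) 0 (l₂ • deriv f l₀) := by
  have hd : HasDerivAt f (deriv f l₀) l₀ := (hf.differentiable (by simp) l₀).hasDerivAt
  obtain ⟨q, hq, hq'⟩ := exists_taylor_one (Y := ℝ) (n := 1)
    (f := fun _ s => f (l₀ + s)) (((contDiff_infty.1 hf 2).comp (contDiff_const.add contDiff_snd)))
  obtain ⟨r, hr, hr'⟩ := exists_taylor_one (Y := ℝ) (n := 0) hq
  have hqd : q 0 0 = deriv f l₀ := by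
    have h1 : HasDerivAt (fun s => f l₀ + s • q 0 s) (deriv f l₀) 0 := by
      have h2 : HasDerivAt (fun s => f (l₀ + s)) (deriv f l₀) 0 := by
        have h3 := HasDerivAt.comp_const_add (f := f) (f' := deriv f l₀) l₀ 0 (by rwa [add_zero])
        exact h3
      refine h2.congr_of_eventuallyEq (Eventually.of_forall fun s => ?_)
      simpa using (hq' 0 s).symm
    have hqc : ContDiff ℝ 1 (q 0) := hq.comp (contDiff_const.prodMk contDiff_id)
    have h4 := ((hasDerivAt_id (0 : ℝ)).smul
      (hqc.differentiable one_ne_zero 0).hasDerivAt).const_add (f l₀)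
    have := h1.unique h4
    simpa using this.symm
  have hlO : (fun ε => l ε - l₀) =O[𝓝[≠] 0] fun ε : ℝ => ε ^ 2 := by
    have h3 := IsBigO.trans hl (isBigO_pow_pow (show 2 ≤ 3 by norm_num))
    have h2 : (fun ε : ℝ => ε ^ 2 * l₂) =O[𝓝[≠] 0] fun ε : ℝ => ε ^ 2 := by
      simpa using (isBigO_refl (fun ε : ℝ => ε ^ 2) (𝓝[≠] 0)).mul
        (isBigO_const_const l₂ (one_ne_zero (α := ℝ)) (𝓝[≠] 0))
    exact (h3.add h2).congr_left fun ε => by simp only [smul_eq_mul]; ring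
  have hl0 : Tendsto (fun ε => l ε - l₀) (𝓝[≠] 0) (𝓝 0) := by
    refine hlO.trans_tendsto ?_
    have : Continuous (fun ε : ℝ => ε ^ 2) := by fun_prop
    simpa using (this.tendsto 0).mono_left (nhdsWithin_le_nhds (s := {0}ᶜ))
  have hrc : Continuous (r 0) := hr.continuous.comp (continuous_const.prodMk continuous_id)
  have hrb : (fun ε => r 0 (l ε - l₀)) =O[𝓝[≠] 0] fun _ => (1 : ℝ) :=
    ((hrc.tendsto 0).comp hl0).isBigO_one ℝ
  have hsq : (fun ε => (l ε - l₀) * (l ε - l₀)) =O[𝓝[≠] 0] fun ε : ℝ => ε ^ 3 :=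
    (hlO.mul hlO).trans ((isBigO_pow_pow (show 3 ≤ 4 by norm_num)).congr_left
      fun ε => by ring)
  have hA := hsq.smul hrb
  have hB : (fun ε => (l ε - (l₀ + ε • (0 : ℝ) + ε ^ 2 • l₂)) • deriv f l₀) =O[𝓝[≠] 0]
      fun ε : ℝ => ε ^ 3 • (1 : ℝ) :=
    IsBigO.smul hl (isBigO_const_const (deriv f l₀) (one_ne_zero (α := ℝ)) (𝓝[≠] 0))
  refine (hA.add hB).congr (fun ε => ?_) fun ε => by simp
  have h1 := hq' 0 (l ε - l₀)
  rw [hr' 0 (l ε - l₀), hqd] at h1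
  simp only [add_sub_cancel, add_zero] at h1
  simp only [smul_eq_mul, mul_zero, add_zero, smul_zero, h1]
  module

end Jets

end NeimarkSacker

namespace NeimarkSacker

/-! ### Superposition operators on the circle -/

section Superposition

variable {V W X : Type}
  [NormedAddCommGroup V] [NormedSpace ℝ V] [NormedAddCommGroup W] [NormedSpace ℝ W]
  [NormedAddCommGroup X] [NormedSpace ℝ X]

instance fact_two_pi_pos : Fact ((0 : ℝ) < 2 * Real.pi) := ⟨Real.two_pi_pos⟩

/-- The circle `ℝ / 2πℤ`. -/
abbrev Circ := AddCircle (2 * Real.pi)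

theorem isOpenQuotientMap_coe : IsOpenQuotientMap (fun θ : ℝ => (θ : Circ)) :=
  QuotientAddGroup.isOpenQuotientMap_mk

theorem circ_forall {p : Circ → Prop} (h : ∀ θ : ℝ, p θ) (t : Circ) : p t := by
  obtain ⟨θ, rfl⟩ := isOpenQuotientMap_coe.surjective t
  exact h θ

theorem coe_add_two_pi (θ : ℝ) : ((θ + 2 * Real.pi : ℝ) : Circ) = θ := by
  simp

/-- A continuous periodic function as a function on the circle. -/
noncomputable def toCirc (f : ℝ → W) (hc : Continuous f) (hp : Function.Periodic f (2 * Real.pi)) : C(Circ, W) :=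
  ⟨hp.lift, by
    rw [← isOpenQuotientMap_coe.continuous_comp_iff]
    exact hc⟩

@[simp] theorem toCirc_coe (f : ℝ → W) (hc : Continuous f)
    (hp : Function.Periodic f (2 * Real.pi)) (θ : ℝ) : toCirc f hc hp θ = f θ := rfl

/-- A smooth function on `ℝ × X` which is periodic in the first variable. -/
structure PerFam (X W : Type) [NormedAddCommGroup X] [NormedSpace ℝ X]
    [NormedAddCommGroup W] [NormedSpace ℝ W] where
  toFun : ℝ → X → W
  smooth : ContDiff ℝ ∞ (fun p : ℝ × X => toFun p.1 p.2)
  periodic : ∀ θ x, toFun (θ + 2 * Real.pi) x = toFun θ x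

/-- The derivative in the second variable. -/
noncomputable def PerFam.deriv (g : PerFam X W) : PerFam X (X →L[ℝ] W) where
  toFun θ x := fderiv ℝ (g.toFun θ) x
  smooth := by
    have h : ContDiff ℝ ∞ (Function.uncurry (fun (p : ℝ × X) (x : X) => g.toFun p.1 x)) :=
      g.smooth.comp ((contDiff_fst.comp contDiff_fst).prodMk contDiff_snd)
    exact ContDiff.fderiv h contDiff_snd (by simp)
  periodic θ x := by rw [show g.toFun (θ + 2 * Real.pi) = g.toFun θ from funext (g.periodic θ)]

/-- The induced function on `Circ × X`. -/
noncomputable def PerFam.lift (g : PerFam X W) (t : Circ) (x : X) : W :=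
  Function.Periodic.lift (f := fun θ => g.toFun θ x) (fun θ => g.periodic θ x) t

@[simp] theorem PerFam.lift_coe (g : PerFam X W) (θ : ℝ) (x : X) :
    g.lift (θ : Circ) x = g.toFun θ x := rfl

theorem PerFam.continuous_lift (g : PerFam X W) :
    Continuous (fun p : Circ × X => g.lift p.1 p.2) := by
  rw [← (isOpenQuotientMap_coe.prodMap (IsOpenQuotientMap.id (X := X))).continuous_comp_iff]
  exact g.smooth.continuous

theorem PerFam.hasFDerivAt_lift (g : PerFam X W) (t : Circ) (x : X) :
    HasFDerivAt (g.lift t) (g.deriv.lift t x) x := by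
  induction t using circ_forall with | _ θ
  have : ContDiff ℝ ∞ (g.toFun θ) := g.smooth.comp (contDiff_const.prodMk contDiff_id)
  exact (this.differentiable (by simp) x).hasFDerivAt

/-- The superposition operator `y ↦ (θ ↦ g θ (y θ))`. -/
noncomputable def PerFam.superpose (g : PerFam X W) (y : C(Circ, X)) : C(Circ, W) :=
  ⟨fun t => g.lift t (y t), g.continuous_lift.comp (continuous_id.prodMk y.continuous)⟩

@[simp] theorem PerFam.superpose_apply (g : PerFam X W) (y : C(Circ, X)) (t : Circ) :
    g.superpose y t = g.lift t (y t) := rfl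

theorem PerFam.continuous_superpose (g : PerFam X W) : Continuous g.superpose := by
  refine ContinuousMap.continuous_of_continuous_uncurry _ ?_
  have : Continuous fun p : C(Circ, X) × Circ => p.1 p.2 := continuous_eval
  exact g.continuous_lift.comp (continuous_snd.prodMk this)

/-- A bounded bilinear map applied pointwise. -/
noncomputable def pointwiseBilin {U : Type} [NormedAddCommGroup U] [NormedSpace ℝ U]
    (B : U →L[ℝ] X →L[ℝ] W) : C(Circ, U) →L[ℝ] C(Circ, X) →L[ℝ] C(Circ, W) :=
  LinearMap.mkContinuous₂
    (LinearMap.mk₂ ℝ (fun (A : C(Circ, U)) (y : C(Circ, X)) =>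
      (⟨fun t => B (A t) (y t), (B.continuous.comp A.continuous).clm_apply y.continuous⟩ :
        C(Circ, W)))
      (fun _ _ _ => by ext; simp) (fun _ _ _ => by ext; simp)
      (fun _ _ _ => by ext; simp) (fun _ _ _ => by ext; simp)) ‖B‖ (fun A y => by
        refine (ContinuousMap.norm_le _ (by positivity)).2 fun t => ?_
        exact (B.le_opNorm₂ _ _).trans (by gcongr <;> exact ContinuousMap.norm_coe_le_norm _ t))

/-- Pointwise application of operators. -/
noncomputable def pointwise :=
  pointwiseBilin (ContinuousLinearMap.id ℝ (X →L[ℝ] W))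

@[simp] theorem pointwise_apply (g : PerFam X (X →L[ℝ] W)) (x y : C(Circ, X)) (t : Circ) :
    pointwise (g.superpose x) y t = g.lift t (x t) (y t) := rfl

/-- The mean value inequality is applied pointwise on the segment from `y t` to `y t + h t`. It is
uniform in `t` because the superposition operator of the derivative is continuous in the supremum
norm. -/
theorem PerFam.hasFDerivAt_superpose (g : PerFam X W) (y : C(Circ, X)) :
    HasFDerivAt g.superpose (pointwise (g.deriv.superpose y)) y := by
  rw [hasFDerivAt_iff_isLittleO_nhds_zero, isLittleO_iff]
  intro c hc
  have hcont := (g.deriv.continuous_superpose.tendsto y)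
  rw [Metric.tendsto_nhds_nhds] at hcont
  obtain ⟨δ, hδ, hcont⟩ := hcont c hc
  filter_upwards [Metric.ball_mem_nhds (0 : C(Circ, X)) hδ] with h hh
  have hh' : ‖h‖ < δ := by simpa using hh
  refine (ContinuousMap.norm_le _ (by positivity)).2 fun t => ?_
  have key := (convex_segment (y t) (y t + h t)).norm_image_sub_le_of_norm_hasFDerivWithin_le'
    (f := g.lift t) (f' := fun x => g.deriv.lift t x) (φ := g.deriv.lift t (y t)) (C := c)
    (fun x _ => (g.hasFDerivAt_lift t x).hasFDerivWithinAt) ?_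
    (left_mem_segment ℝ _ _) (right_mem_segment ℝ _ _)
  · rw [add_sub_cancel_left] at key
    exact key.trans (mul_le_mul_of_nonneg_left (h.norm_coe_le_norm t) hc.le)
  · intro x hx
    rw [segment_eq_image'] at hx
    obtain ⟨s, hs, rfl⟩ := hx
    -- A point of the segment is the value at `t` of the function `y + s • h`, so sup-norm closeness
    -- of functions controls the derivative at that point.
    have h1 : dist (y + s • h) y < δ := by
      rw [dist_eq_norm, add_sub_cancel_left, norm_smul, Real.norm_eq_abs, abs_of_nonneg hs.1]
      exact lt_of_le_of_lt (mul_le_of_le_one_left (norm_nonneg _) hs.2) hh'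
    have h2 := (hcont h1).le
    rw [dist_eq_norm] at h2
    have h3 := (ContinuousMap.norm_coe_le_norm _ t).trans h2
    simpa using h3

/-- The derivative is pointwise application of the superposition operator of `g.deriv`, which is
again of the same form with another target; this drives the induction. -/
theorem PerFam.contDiff_superpose_nat (n : ℕ) : ∀ {W : Type} [NormedAddCommGroup W]
    [NormedSpace ℝ W] (g : PerFam X W), ContDiff ℝ n g.superpose := by
  induction n with
  | zero => exact fun g => contDiff_zero.2 g.continuous_superpose
  | succ n ih =>
    intro W _ _ g
    have key : ContDiff ℝ ((n : ℕ∞ω) + 1) g.superpose := by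
      rw [contDiff_succ_iff_hasFDerivAt]
      have h1 : ContDiff ℝ n (pointwise (X := X) (W := W)) :=
        ContinuousLinearMap.contDiff (pointwise (X := X) (W := W))
      exact ⟨fun y => pointwise (g.deriv.superpose y), h1.comp (ih g.deriv),
        g.hasFDerivAt_superpose⟩
    exact_mod_cast key

/-- The integral over a period. -/
noncomputable def circInt [CompleteSpace V] : C(Circ, V) →L[ℝ] V where
  toFun y := ∫ s in (0 : ℝ)..2 * Real.pi, y s
  map_add' y z := by
    have h : ∀ y : C(Circ, V), Continuous fun s : ℝ => y s := fun y =>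
      y.continuous.comp isOpenQuotientMap_coe.continuous
    exact intervalIntegral.integral_add ((h y).intervalIntegrable _ _)
      ((h z).intervalIntegrable _ _)
  map_smul' c y := by simp
  cont := by
    refine intervalIntegral.continuous_parametric_intervalIntegral_of_continuous' ?_ _ _
    have : Continuous fun p : C(Circ, V) × Circ => p.1 p.2 := continuous_eval
    exact this.comp (continuous_fst.prodMk (isOpenQuotientMap_coe.continuous.comp continuous_snd))

theorem circInt_apply [CompleteSpace V] (y : C(Circ, V)) :
    circInt y = ∫ s in (0 : ℝ)..2 * Real.pi, y s := rfl

theorem continuous_coe_circ (y : C(Circ, V)) : Continuous fun s : ℝ => y s :=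
  y.continuous.comp isOpenQuotientMap_coe.continuous

/-- The mean over the circle. -/
noncomputable def circMean [CompleteSpace V] : C(Circ, V) →L[ℝ] V := (2 * Real.pi)⁻¹ • circInt

theorem circMean_const [CompleteSpace V] (c : V) : circMean (ContinuousMap.const Circ c) = c := by
  simp [circMean, circInt_apply, smul_smul]
  rw [show Real.pi⁻¹ * 2⁻¹ * (2 * Real.pi) = 1 by field_simp, one_smul]

theorem two_pi_smul_circMean [CompleteSpace V] (y : C(Circ, V)) :
    (2 * Real.pi) • circMean y = circInt y := by
  simp [circMean, smul_smul]
  rw [show 2 * Real.pi * (Real.pi⁻¹ * 2⁻¹) = 1 by field_simp, one_smul]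

theorem periodic_primitive [CompleteSpace V] (f : C(Circ, V)) : Function.Periodic
    (fun θ : ℝ => circMean f + ∫ s in (0 : ℝ)..θ, (f s - circMean f)) (2 * Real.pi) := by
  have hp : Function.Periodic (fun s : ℝ => f s - circMean f) (2 * Real.pi) := fun s => by
    simp only [coe_add_two_pi]
  have hc : Continuous (fun s : ℝ => f s - circMean f) :=
    (continuous_coe_circ f).sub continuous_const
  intro θ
  have h1 := hp.intervalIntegral_add_eq θ 0
  have h2 : ∫ s in (0 : ℝ)..2 * Real.pi, (f s - circMean f) = 0 := by
    rw [intervalIntegral.integral_sub ((continuous_coe_circ f).intervalIntegrable _ _)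
      intervalIntegrable_const, ← circInt_apply, ← two_pi_smul_circMean]
    simp
  rw [zero_add, h2] at h1
  simp only
  rw [← intervalIntegral.integral_add_adjacent_intervals (b := θ) (hc.intervalIntegrable _ _)
    (hc.intervalIntegrable _ _), h1, add_zero]

/-- `f ↦ mean f + ∫₀^θ (f - mean f)`. -/
noncomputable def circPrim [CompleteSpace V] : C(Circ, V) →L[ℝ] C(Circ, V) where
  toFun f := toCirc (fun θ : ℝ => circMean f + ∫ s in (0 : ℝ)..θ, (f s - circMean f))
    (continuous_const.add (intervalIntegral.continuous_primitive
      (fun _ _ => ((continuous_coe_circ f).sub continuous_const).intervalIntegrable _ _) _))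
    (periodic_primitive f)
  map_add' f g := by
    ext t
    induction t using circ_forall with | _ θ
    have hi : ∀ f : C(Circ, V), IntervalIntegrable (fun s : ℝ => f s - circMean f)
        MeasureTheory.volume 0 θ := fun f =>
      ((continuous_coe_circ f).sub continuous_const).intervalIntegrable _ _
    simp only [toCirc_coe, map_add, ContinuousMap.add_apply]
    rw [add_add_add_comm, ← intervalIntegral.integral_add (hi f) (hi g)]
    congr 1
    exact intervalIntegral.integral_congr fun s _ => by abel
  map_smul' c f := by
    ext t
    induction t using circ_forall with | _ θ
    simp only [toCirc_coe, map_smul, ContinuousMap.smul_apply, RingHom.id_apply, ← smul_sub,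
      intervalIntegral.integral_smul, smul_add]
  cont := by
    refine ContinuousMap.continuous_of_continuous_uncurry _ ?_
    rw [← ((IsOpenQuotientMap.id (X := C(Circ, V))).prodMap
      isOpenQuotientMap_coe).continuous_comp_iff]
    have he : Continuous fun p : (C(Circ, V) × ℝ) × ℝ => p.1.1 (p.2 : Circ) - circMean p.1.1 := by
      have : Continuous fun p : C(Circ, V) × Circ => p.1 p.2 := continuous_eval
      exact (this.comp ((continuous_fst.comp continuous_fst).prodMk
        (isOpenQuotientMap_coe.continuous.comp continuous_snd))).sub
        (circMean.continuous.comp (continuous_fst.comp continuous_fst))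
    exact (circMean.continuous.comp continuous_fst).add
      (intervalIntegral.continuous_parametric_intervalIntegral_of_continuous
        (f := fun (p : C(Circ, V) × ℝ) (s : ℝ) => p.1 (s : Circ) - circMean p.1) (a₀ := 0)
        he continuous_snd)

theorem circPrim_coe [CompleteSpace V] (f : C(Circ, V)) (θ : ℝ) :
    circPrim f θ = circMean f + ∫ s in (0 : ℝ)..θ, (f s - circMean f) := rfl

theorem circPrim_zero [CompleteSpace V] (f : C(Circ, V)) :
    circPrim f ((0 : ℝ) : Circ) = circMean f :=
  (circPrim_coe f 0).trans (by simp)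

/-- `y` solves `y = y 0 + circPrim f` iff `y' = f`. -/
theorem hasDerivAt_iff_circPrim [CompleteSpace V] (y f : C(Circ, V)) :
    y = ContinuousMap.const Circ (y ((0 : ℝ) : Circ)) + circPrim f ↔
      ∀ θ : ℝ, HasDerivAt (fun s : ℝ => y s) (f θ) θ := by
  have hcf := continuous_coe_circ f
  have hint : ∀ a b, IntervalIntegrable (fun s : ℝ => f s) MeasureTheory.volume a b :=
    fun a b => hcf.intervalIntegrable a b
  constructor
  · intro h θ
    -- At θ = 0 the integral vanishes and `y 0` cancels, so the fixed-point equation itself contains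
    -- the solvability condition that `f` has mean zero.
    have h0 : circMean f = 0 := by
      have := DFunLike.congr_fun h ((0 : ℝ) : Circ)
      rw [ContinuousMap.add_apply, circPrim_zero, ContinuousMap.const_apply] at this
      simpa using this
    have h1 : (fun s : ℝ => y s) = fun s : ℝ => y ((0 : ℝ) : Circ) + ∫ r in (0 : ℝ)..s, f r := by
      funext s
      have := DFunLike.congr_fun h (s : Circ)
      rw [ContinuousMap.add_apply, circPrim_coe, ContinuousMap.const_apply, h0] at this
      simpa using this
    rw [h1]
    exact (intervalIntegral.integral_hasDerivAt_right (hint _ _)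
      (hcf.stronglyMeasurableAtFilter _ _) hcf.continuousAt).const_add _
  · intro h
    have hftc : ∀ θ : ℝ, ∫ r in (0 : ℝ)..θ, f r = y θ - y ((0 : ℝ) : Circ) := fun θ =>
      intervalIntegral.integral_eq_sub_of_hasDerivAt (fun s _ => h s) (hint _ _)
    have h0 : circMean f = 0 := by
      have h2 : circInt f = 0 := by
        have h3 := coe_add_two_pi 0
        rw [zero_add] at h3
        rw [circInt_apply, hftc, h3, sub_self]
      simp [circMean, h2]
    ext t
    induction t using circ_forall with | _ θ
    rw [ContinuousMap.add_apply, circPrim_coe, ContinuousMap.const_apply, h0]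
    simp [hftc]

end Superposition

/-! ### Linear periodic problems -/

section LinearODE

variable {V M : Type} [NormedAddCommGroup V] [NormedSpace ℝ V] [FiniteDimensional ℝ V]
  [NormedAddCommGroup M] [NormedSpace ℝ M] [FiniteDimensional ℝ M]

theorem linearODE_unique {A : V →L[ℝ] V} {f : ℝ → V} {y z : ℝ → V}
    (hy : ∀ θ, HasDerivAt y (A (y θ) + f θ) θ) (hz : ∀ θ, HasDerivAt z (A (z θ) + f θ) θ)
    (h0 : y 0 = z 0) : y = z :=
  ODE_solution_unique_univ (v := fun θ x => A x + f θ) (s := fun _ => univ) (K := ‖A‖₊) (t₀ := 0)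
    (fun t => (LipschitzWith.of_dist_le_mul fun a b => by
      simpa [dist_eq_norm, ← map_sub] using A.le_opNorm (a - b)).lipschitzOnWith)
    (fun t => ⟨hy t, mem_univ _⟩) (fun t => ⟨hz t, mem_univ _⟩) h0

/-- Variation of constants with the group exp(θA). -/
theorem linearODE_exists (A : V →L[ℝ] V) {f : ℝ → V} (hf : Continuous f) :
    ∃ y : ℝ → V, y 0 = 0 ∧ ∀ θ, HasDerivAt y (A (y θ) + f θ) θ := by
  have : CompleteSpace V := FiniteDimensional.complete ℝ V
  let E : ℝ → V →L[ℝ] V := fun θ => NormedSpace.exp (θ • A)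
  have hE : ∀ θ, HasDerivAt E (A * E θ) θ := fun θ => hasDerivAt_exp_smul_const' A θ
  have hEE : ∀ θ, E θ * E (-θ) = 1 := by
    intro θ
    let _ : NormedAlgebra ℚ (V →L[ℝ] V) := NormedAlgebra.restrictScalars ℚ ℝ _
    have hcomm : Commute (θ • A) ((-θ) • A) :=
      ((Commute.refl A).smul_left θ).smul_right (-θ)
    have := NormedSpace.exp_add_of_commute hcomm
    simp only [E]
    rw [← this]
    simp
  have hEc : Continuous E := continuous_iff_continuousAt.2 fun θ => (hE θ).continuousAt
  have hg : Continuous fun s => E (-s) (f s) := (hEc.comp continuous_neg).clm_apply hf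
  refine ⟨fun θ => E θ (∫ s in (0 : ℝ)..θ, E (-s) (f s)), by simp, fun θ => ?_⟩
  have h1 : HasDerivAt (fun θ => ∫ s in (0 : ℝ)..θ, E (-s) (f s)) (E (-θ) (f θ)) θ :=
    intervalIntegral.integral_hasDerivAt_right (hg.intervalIntegrable _ _)
      (hg.stronglyMeasurableAtFilter _ _) hg.continuousAt
  have h2 := (hE θ).clm_apply h1
  have h3 : E θ (E (-θ) (f θ)) = f θ := by
    rw [← mul_apply_eq_comp, hEE, one_apply_eq_self]
  simpa [h3] using h2

theorem linearODE_periodic {A : V →L[ℝ] V} {f : ℝ → V} {y : ℝ → V}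
    (hf : Function.Periodic f (2 * Real.pi)) (hy : ∀ θ, HasDerivAt y (A (y θ) + f θ) θ)
    (h : y (2 * Real.pi) = y 0) : Function.Periodic y (2 * Real.pi) := by
  have := linearODE_unique (A := A) (f := f) (y := fun θ => y (θ + 2 * Real.pi)) (z := y)
    (fun θ => by
      have := (hy (θ + 2 * Real.pi)).comp_add_const θ (2 * Real.pi)
      rwa [hf θ] at this) hy (by simpa using h)
  exact fun θ => congrFun this θ

/-- Unique solvability of the homogeneous bordered periodic problem. -/
def Nondegenerate (A : V →L[ℝ] V) (C : M →L[ℝ] V) (l : V →L[ℝ] M) : Prop :=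
  ∀ (y : ℝ → V) (ν : M), Function.Periodic y (2 * Real.pi) →
    (∀ θ, HasDerivAt y (A (y θ) + C ν) θ) → l (∫ s in (0 : ℝ)..2 * Real.pi, y s) = 0 →
    (∀ θ, y θ = 0) ∧ ν = 0

/-- A Fredholm alternative by finite dimension. The initial value and the multiplier `(y 0, ν)`
determine the solution, and the periodicity defect together with `l` of the integral is an
endomorphism of `V × M`. Nondegeneracy says that it is injective, hence it is surjective. -/
theorem Nondegenerate.exists_periodic {A : V →L[ℝ] V} {C : M →L[ℝ] V} {l : V →L[ℝ] M}
    (hU : Nondegenerate A C l) {f : ℝ → V} (hf : Continuous f)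
    (hfp : Function.Periodic f (2 * Real.pi)) (m : M) :
    ∃ (y : ℝ → V) (ν : M), Function.Periodic y (2 * Real.pi) ∧
      (∀ θ, HasDerivAt y (A (y θ) + C ν + f θ) θ) ∧
      l (∫ s in (0 : ℝ)..2 * Real.pi, y s) = m := by
  have : CompleteSpace V := FiniteDimensional.complete ℝ V
  have : CompleteSpace M := FiniteDimensional.complete ℝ M
  obtain ⟨p, hp0, hp⟩ := linearODE_exists A hf
  -- The multiplier is adjoined as a constant unknown, ν' = 0, which makes the bordered homogeneous
  -- problem one autonomous linear equation.
  let B : V × M →L[ℝ] V × M := (A.comp (.fst ℝ V M) + C.comp (.snd ℝ V M)).prod 0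
  let R : ℝ → V × M →L[ℝ] V × M := fun θ => NormedSpace.exp (θ • B)
  have hR : ∀ θ, HasDerivAt R (B * R θ) θ := fun θ => hasDerivAt_exp_smul_const' B θ
  have hR0 : R 0 = 1 := by simp [R]
  let Q : ℝ → V × M →L[ℝ] V := fun θ => (ContinuousLinearMap.fst ℝ V M).comp (R θ)
  have hQ1 : ∀ θ, HasDerivAt Q ((ContinuousLinearMap.fst ℝ V M).comp (B * R θ)) θ := fun θ =>
    ((ContinuousLinearMap.compL ℝ (V × M) (V × M) V
      (ContinuousLinearMap.fst ℝ V M)).hasFDerivAt.comp_hasDerivAt θ (hR θ))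
  have hsnd : ∀ (θ : ℝ) (w : V × M), (R θ w).2 = w.2 := by
    intro θ w
    have hd : ∀ s, HasDerivAt (fun s => (R s w).2) 0 s := fun s => by
      have h1 := (ContinuousLinearMap.snd ℝ V M).hasFDerivAt.comp_hasDerivAt s
        ((hR s).clm_apply (hasDerivAt_const s w))
      have h2 : (ContinuousLinearMap.snd ℝ V M) ((B * R s) w + (R s) 0) = 0 := by simp [B]
      rw [h2] at h1
      exact h1
    have := is_const_of_deriv_eq_zero (fun s => (hd s).differentiableAt)
      (fun s => (hd s).deriv) θ 0
    rw [this, hR0]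
    rfl
  have hQ : ∀ (θ : ℝ) (w : V × M), HasDerivAt (fun s => Q s w) (A (Q θ w) + C w.2) θ := by
    intro θ w
    have h1 := (hQ1 θ).clm_apply (hasDerivAt_const θ w)
    have h2 : ((ContinuousLinearMap.fst ℝ V M).comp (B * R θ)) w + (Q θ) 0
        = A (Q θ w) + C w.2 := by simp [B, Q, hsnd]
    rwa [h2] at h1
  have hQ0 : ∀ w, Q 0 w = w.1 := fun w => by simp [Q, hR0]
  have hQc : Continuous Q := continuous_iff_continuousAt.2 fun θ => (hQ1 θ).continuousAt
  let T : V × M →L[ℝ] V × M := (Q (2 * Real.pi) - .fst ℝ V M).prod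
    (l.comp (∫ s in (0 : ℝ)..2 * Real.pi, Q s))
  have hT2 : ∀ w, (T w).2 = l (∫ s in (0 : ℝ)..2 * Real.pi, Q s w) := fun w => by
    simp [T, ContinuousLinearMap.intervalIntegral_apply (hQc.intervalIntegrable _ _)]
  have hT1 : ∀ w, (T w).1 = Q (2 * Real.pi) w - w.1 := fun w => rfl
  have hinj : Function.Injective T := by
    rw [injective_iff_map_eq_zero]
    intro w hw
    have h1 : Q (2 * Real.pi) w = Q 0 w := by
      have := hT1 w
      rw [hw] at this
      rw [hQ0]
      exact (sub_eq_zero.1 this.symm)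
    have hper : Function.Periodic (fun s => Q s w) (2 * Real.pi) :=
      linearODE_periodic (A := A) (f := fun _ => C w.2) (fun _ => rfl) (fun θ => hQ θ w) h1
    have h2 := hU (fun s => Q s w) w.2 hper (fun θ => hQ θ w) (by rw [← hT2, hw]; rfl)
    have h3 := h2.1 0
    rw [hQ0] at h3
    exact Prod.ext h3 h2.2
  have hsurj : Function.Surjective T :=
    (LinearMap.injective_iff_surjective (f := (T : V × M →ₗ[ℝ] V × M))).1 hinj
  -- The homogeneous solution is chosen to cancel the periodicity defect of the particular solution
  -- `p` and to correct its integral to `m`.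
  obtain ⟨w, hw⟩ := hsurj (-p (2 * Real.pi), m - l (∫ s in (0 : ℝ)..2 * Real.pi, p s))
  have hder : ∀ θ, HasDerivAt (fun s => Q s w + p s) (A (Q θ w + p θ) + (C w.2 + f θ)) θ := by
    intro θ
    refine ((hQ θ w).add (hp θ)).congr_deriv ?_
    rw [map_add]; abel
  have hpc : Continuous p := continuous_iff_continuousAt.2 fun θ => (hp θ).continuousAt
  refine ⟨fun s => Q s w + p s, w.2, ?_, fun θ => ?_, ?_⟩
  · refine linearODE_periodic (A := A) (f := fun θ => C w.2 + f θ)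
      (fun θ => by simp only [hfp θ]) hder ?_
    have h1 := hT1 w
    rw [hw] at h1
    simp only at h1
    simp only [hQ0, hp0]
    rw [show Q (2 * Real.pi) w = w.1 + -p (2 * Real.pi) by rw [h1]; abel]
    abel
  · simpa [add_assoc] using hder θ
  · rw [intervalIntegral.integral_add
      ((hQc.clm_apply continuous_const).intervalIntegrable _ _) (hpc.intervalIntegrable _ _),
      map_add, ← hT2, hw]
    simp

end LinearODE

end NeimarkSacker

namespace NeimarkSacker

/-! ### The branch of periodic solutions -/

section Branch

variable {V M : Type} [NormedAddCommGroup V] [NormedSpace ℝ V] [FiniteDimensional ℝ V]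
  [NormedAddCommGroup M] [NormedSpace ℝ M] [FiniteDimensional ℝ M]

/-- Constant functions on the circle. -/
noncomputable def circConst {W : Type} [NormedAddCommGroup W] [NormedSpace ℝ W] : W →L[ℝ] C(Circ, W) where
  toFun c := ContinuousMap.const Circ c
  map_add' _ _ := rfl
  map_smul' _ _ := rfl
  cont := ContinuousMap.continuous_const'

@[simp] theorem circConst_apply {W : Type} [NormedAddCommGroup W] [NormedSpace ℝ W] (c : W)
    (t : Circ) : circConst c t = c := rfl

/-- Pairing a function with constants. -/
noncomputable def pairConst {W : Type} [NormedAddCommGroup W] [NormedSpace ℝ W] :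
    C(Circ, V) × W →L[ℝ] C(Circ, V × W) :=
  ((ContinuousLinearMap.inl ℝ V W).compLeftContinuous ℝ Circ).comp (.fst ℝ _ _) +
    circConst.comp ((ContinuousLinearMap.inr ℝ V W).comp (.snd ℝ _ _))

@[simp] theorem pairConst_apply {W : Type} [NormedAddCommGroup W] [NormedSpace ℝ W]
    (u : C(Circ, V) × W) (t : Circ) : pairConst u t = (u.1 t, u.2) := by
  simp [pairConst]

/-- The periodic boundary value problem as an operator equation. -/
noncomputable def bvpMap [CompleteSpace V] (f : PerFam (V × M × ℝ) V) (l : V →L[ℝ] M) (y₀ : V)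
    (u : C(Circ, V) × M × ℝ) : C(Circ, V) × M × ℝ :=
  (u.1 - circConst (u.1 ((0 : ℝ) : Circ)) - circPrim (f.superpose (pairConst u)),
    l (circInt u.1) - l ((2 * Real.pi) • y₀), u.2.2)

/-- The derivative of `bvpMap`. -/
noncomputable def bvpDeriv [CompleteSpace V] (f : PerFam (V × M × ℝ) V) (l : V →L[ℝ] M)
    (u : C(Circ, V) × M × ℝ) : C(Circ, V) × M × ℝ →L[ℝ] C(Circ, V) × M × ℝ :=
  ((ContinuousLinearMap.fst ℝ _ _ -
      circConst.comp ((ContinuousMap.evalCLM ℝ ((0 : ℝ) : Circ)).comp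
        (ContinuousLinearMap.fst ℝ _ _)) -
      circPrim.comp ((pointwise (f.deriv.superpose (pairConst u))).comp pairConst)).prod
    ((l.comp (circInt.comp (ContinuousLinearMap.fst ℝ _ _))).prod
      ((ContinuousLinearMap.snd ℝ _ _).comp (ContinuousLinearMap.snd ℝ _ _))))

theorem hasFDerivAt_bvpMap [CompleteSpace V] (f : PerFam (V × M × ℝ) V) (l : V →L[ℝ] M) (y₀ : V)
    (u : C(Circ, V) × M × ℝ) : HasFDerivAt (bvpMap f l y₀) (bvpDeriv f l u) u := by
  have h1 : HasFDerivAt (fun u : C(Circ, V) × M × ℝ => u.1) (ContinuousLinearMap.fst ℝ _ _) u :=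
    hasFDerivAt_fst
  have h2 := (circConst (W := V)).hasFDerivAt.comp u
    ((ContinuousMap.evalCLM ℝ ((0 : ℝ) : Circ)).hasFDerivAt.comp u h1)
  have h3 := (circPrim (V := V)).hasFDerivAt.comp u
    ((f.hasFDerivAt_superpose (pairConst u)).comp u
      (pairConst (V := V) (W := M × ℝ)).hasFDerivAt)
  have h4 := (l.hasFDerivAt.comp u ((circInt (V := V)).hasFDerivAt.comp u h1)).sub_const
    (l ((2 * Real.pi) • y₀))
  have h5 : HasFDerivAt (fun u : C(Circ, V) × M × ℝ => u.2.2)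
    ((ContinuousLinearMap.snd ℝ _ _).comp (ContinuousLinearMap.snd ℝ _ _)) u :=
    ((ContinuousLinearMap.snd ℝ M ℝ).comp (ContinuousLinearMap.snd ℝ C(Circ, V) (M × ℝ))).hasFDerivAt
  exact ((h1.sub h2).sub h3).prodMk (h4.prodMk h5)

theorem contDiff_bvpMap [CompleteSpace V] (f : PerFam (V × M × ℝ) V) (l : V →L[ℝ] M) (y₀ : V)
    (n : ℕ) : ContDiff ℝ n (bvpMap f l y₀) := by
  have h1 : ContDiff ℝ n (fun u : C(Circ, V) × M × ℝ => u.1) := contDiff_fst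
  have h2 := (circConst (W := V)).contDiff.comp
    ((ContinuousMap.evalCLM ℝ ((0 : ℝ) : Circ)).contDiff.comp h1)
  have h3 := (circPrim (V := V)).contDiff.comp
    ((f.contDiff_superpose_nat n).comp (pairConst (V := V) (W := M × ℝ)).contDiff)
  have h4 := (l.contDiff.comp ((circInt (V := V)).contDiff.comp h1)).sub
    (contDiff_const (c := l ((2 * Real.pi) • y₀)))
  have h5 : ContDiff ℝ n (fun u : C(Circ, V) × M × ℝ => u.2.2) :=
    contDiff_snd.comp contDiff_snd
  exact ((h1.sub h2).sub h3).prodMk (h4.prodMk h5)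

theorem bvpMap_eq_iff [CompleteSpace V] (f : PerFam (V × M × ℝ) V) (l : V →L[ℝ] M) (y₀ : V)
    (y : C(Circ, V)) (ν : M) (ε : ℝ) : bvpMap f l y₀ (y, ν, ε) = (0, 0, ε) ↔
      (∀ θ : ℝ, HasDerivAt (fun s : ℝ => y s) (f.toFun θ (y θ, ν, ε)) θ) ∧
        l (∫ s in (0 : ℝ)..2 * Real.pi, y s) = l ((2 * Real.pi) • y₀) := by
  simp only [bvpMap, Prod.mk.injEq, and_true, sub_eq_zero (b := l _), circInt_apply]
  refine and_congr_left fun _ => ?_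
  rw [sub_sub, sub_eq_zero]
  refine (hasDerivAt_iff_circPrim y (f.superpose (pairConst (y, ν, ε)))).trans ?_
  simp

theorem bvpDeriv_injective [CompleteSpace V] {f : PerFam (V × M × ℝ) V} {A : V →L[ℝ] V}
    {C : M →L[ℝ] V} {l : V →L[ℝ] M} {y₀ : V} {μ₀ : M} (hU : Nondegenerate A C l)
    (hD : ∀ θ h ν, fderiv ℝ (f.toFun θ) (y₀, μ₀, 0) (h, ν, 0) = A h + C ν) :
    Function.Injective (bvpDeriv f l (circConst y₀, μ₀, 0)) := by
  rw [injective_iff_map_eq_zero]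
  rintro ⟨h, ν, e⟩ hw
  have he : e = 0 := congrArg (fun w : C(Circ, V) × M × ℝ => w.2.2) hw
  subst he
  have h2 : l (circInt h) = 0 := congrArg (fun w : C(Circ, V) × M × ℝ => w.2.1) hw
  have h1 : h - circConst (h ((0 : ℝ) : Circ)) - circPrim (pointwise (f.deriv.superpose
    (pairConst (circConst y₀, μ₀, 0))) (pairConst (h, ν, 0))) = 0 :=
    congrArg (fun w : C(Circ, V) × M × ℝ => w.1) hw
  rw [sub_sub, sub_eq_zero] at h1
  have h3 := (hasDerivAt_iff_circPrim h _).1 h1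
  have h4 := hU (fun s => h s) ν (fun s => by simp only [coe_add_two_pi]) (fun θ => by
    refine (h3 θ).congr_deriv ?_
    simpa [PerFam.deriv] using hD θ (h θ) ν) h2
  refine Prod.ext ?_ (Prod.ext h4.2 rfl)
  ext t
  induction t using circ_forall with | _ θ
  exact h4.1 θ

/-- The datum `r` is only continuous, so `h` cannot be sought as a solution of a differential
equation. Writing `h = k + r` leaves a differentiable periodic `k`, whose equation has the forcing A
r + r(0) plus the contribution of `e`. The constant r(0) enters because `circPrim` fixes constants.
-/
theorem bvpDeriv_surjective [CompleteSpace V] {f : PerFam (V × M × ℝ) V} {A : V →L[ℝ] V}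
    {C : M →L[ℝ] V} {l : V →L[ℝ] M} {y₀ : V} {μ₀ : M} (hU : Nondegenerate A C l)
    (hD : ∀ θ h ν, fderiv ℝ (f.toFun θ) (y₀, μ₀, 0) (h, ν, 0) = A h + C ν) :
    Function.Surjective (bvpDeriv f l (circConst y₀, μ₀, 0)) := by
  rintro ⟨r, m, e⟩
  let F : C(Circ, V) × M × ℝ →L[ℝ] C(Circ, V) :=
    (pointwise (f.deriv.superpose (pairConst (circConst y₀, μ₀, 0)))).comp pairConst
  have hF : ∀ h ν (θ : ℝ), F (h, ν, e) θ = A (h θ) + C ν + F (0, 0, e) θ := by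
    intro h ν θ
    rw [← hD θ]
    simp only [F, ContinuousLinearMap.comp_apply, pointwise_apply, pairConst_apply,
      PerFam.lift_coe, ContinuousMap.zero_apply]
    have : ((h θ, ν, e) : V × M × ℝ) = (h θ, ν, 0) + (0, 0, e) := by simp
    rw [this, map_add]
    rfl
  let g : ℝ → V := fun θ => A (r θ) + r ((0 : ℝ) : Circ) + F (0, 0, e) θ
  have hg : Continuous g := ((A.continuous.comp (continuous_coe_circ r)).add continuous_const).add
    (continuous_coe_circ _)
  have hgp : Function.Periodic g (2 * Real.pi) := fun θ => by simp only [g, coe_add_two_pi]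
  obtain ⟨k, ν, hkp, hk, hkl⟩ := hU.exists_periodic hg hgp (m - l (circInt r))
  have hkc : Continuous k := continuous_iff_continuousAt.2 fun θ => (hk θ).continuousAt
  let kC := toCirc k hkc hkp
  let h : C(Circ, V) := kC + r
  have hk' : ∀ θ : ℝ, HasDerivAt (fun s : ℝ => kC s)
      ((F (h, ν, e) + circConst (r ((0 : ℝ) : Circ))) θ) θ := by
    intro θ
    refine (hk θ).congr_deriv ?_
    rw [ContinuousMap.add_apply, hF]
    simp only [g, h, kC, ContinuousMap.add_apply, toCirc_coe, map_add, circConst_apply]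
    abel
  have h1 := (hasDerivAt_iff_circPrim _ _).2 hk'
  have hconst : circPrim (circConst (r ((0 : ℝ) : Circ))) = circConst (r ((0 : ℝ) : Circ)) := by
    ext t
    induction t using circ_forall with | _ θ
    have := circMean_const (r ((0 : ℝ) : Circ))
    rw [circPrim_coe, circConst_apply]
    simp only [circConst_apply]
    rw [show circConst (r ((0 : ℝ) : Circ)) = ContinuousMap.const Circ (r ((0 : ℝ) : Circ)) from rfl,
      this]
    simp
  refine ⟨(h, ν, e), Prod.ext ?_ (Prod.ext ?_ rfl)⟩
  · change h - circConst (h ((0 : ℝ) : Circ)) - circPrim (F (h, ν, e)) = r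
    rw [map_add, hconst] at h1
    have h2 : circConst (h ((0 : ℝ) : Circ)) = ContinuousMap.const Circ (kC ((0 : ℝ) : Circ)) +
      circConst (r ((0 : ℝ) : Circ)) := rfl
    rw [h2, show h = kC + r from rfl]
    conv_lhs => enter [1, 1, 1]; rw [h1]
    abel
  · change l (circInt h) = m
    rw [show h = kC + r from rfl, map_add, map_add]
    have : circInt kC = ∫ s in (0 : ℝ)..2 * Real.pi, k s := rfl
    rw [this, hkl]
    simp

/-- The last component of `bvpMap` returns ε, so the inverse function theorem does the work of the
implicit one: the branch is the local inverse along (0, 0, ε). The derivative is bijective by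
nondegeneracy, and local uniqueness is injectivity on the source of the local homeomorphism. -/
theorem exists_branch [CompleteSpace V] {f : PerFam (V × M × ℝ) V} {A : V →L[ℝ] V}
    {C : M →L[ℝ] V} {l : V →L[ℝ] M} {y₀ : V} {μ₀ : M} (hU : Nondegenerate A C l)
    (h0 : ∀ θ, f.toFun θ (y₀, μ₀, 0) = 0)
    (hD : ∀ θ h ν, fderiv ℝ (f.toFun θ) (y₀, μ₀, 0) (h, ν, 0) = A h + C ν) (n : ℕ) :
    ∃ (Y : ℝ → C(Circ, V)) (μ : ℝ → M), ContDiff ℝ n Y ∧ ContDiff ℝ n μ ∧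
      Y 0 = circConst y₀ ∧ μ 0 = μ₀ ∧
      (∀ᶠ ε in 𝓝 0,
        (∀ θ : ℝ, HasDerivAt (fun s : ℝ => Y ε s) (f.toFun θ (Y ε θ, μ ε, ε)) θ) ∧
        l (∫ s in (0 : ℝ)..2 * Real.pi, Y ε s) = l ((2 * Real.pi) • y₀)) ∧
      ∃ r > 0, ∀ᶠ ε in 𝓝 0, ∀ (y : ℝ → V) (ν : M), Function.Periodic y (2 * Real.pi) →
        (∀ θ : ℝ, HasDerivAt y (f.toFun θ (y θ, ν, ε)) θ) →
        l (∫ s in (0 : ℝ)..2 * Real.pi, y s) = l ((2 * Real.pi) • y₀) →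
        (∀ θ, ‖y θ - y₀‖ < r) → ‖ν - μ₀‖ < r → (∀ θ : ℝ, y θ = Y ε θ) ∧ ν = μ ε := by
  have : CompleteSpace M := FiniteDimensional.complete ℝ M
  let a : C(Circ, V) × M × ℝ := (circConst y₀, μ₀, 0)
  let D := ContinuousLinearEquiv.ofBijective (bvpDeriv f l a)
    (LinearMap.ker_eq_bot.2 (bvpDeriv_injective hU hD))
    (LinearMap.range_eq_top.2 (bvpDeriv_surjective hU hD))
  -- Class `n + 1` instead of `n` ensures at least one derivative, as the inverse function theorem
  -- requires, even when `n = 0`.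
  have hΨ : ContDiffAt ℝ (n + 1 : ℕ) (bvpMap f l y₀) a := (contDiff_bvpMap f l y₀ (n + 1)).contDiffAt
  have hΨ' : HasFDerivAt (bvpMap f l y₀) (D : _ →L[ℝ] _) a := hasFDerivAt_bvpMap f l y₀ a
  have hn : ((n + 1 : ℕ) : ℕ∞ω) ≠ 0 := by exact_mod_cast Nat.succ_ne_zero n
  have hΨa : bvpMap f l y₀ a = (0, 0, 0) := by
    refine (bvpMap_eq_iff f l y₀ _ _ _).2 ⟨fun θ => ?_, ?_⟩
    · simpa [h0] using hasDerivAt_const θ y₀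
    · simp
  let e := hΨ.toOpenPartialHomeomorph (bvpMap f l y₀) hΨ' hn
  have he : ∀ x, e x = bvpMap f l y₀ x := fun x => rfl
  have hsrc : a ∈ e.source := hΨ.mem_toOpenPartialHomeomorph_source hΨ' hn
  have htgt : bvpMap f l y₀ a ∈ e.target := hΨ.image_mem_toOpenPartialHomeomorph_target hΨ' hn
  rw [hΨa] at htgt
  have hsa : e.symm (0, 0, 0) = a := by rw [← hΨa, ← he, e.left_inv hsrc]
  have hsymm : ContDiffAt ℝ (n + 1 : ℕ) e.symm (0, 0, 0) := by
    have := hΨ.to_localInverse hΨ' hn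
    rw [hΨa] at this
    exact this
  let j : ℝ → C(Circ, V) × M × ℝ := fun ε => (0, 0, ε)
  have hj : ContDiff ℝ n j := contDiff_const.prodMk (contDiff_const.prodMk contDiff_id)
  have hnear : ∀ᶠ ε in 𝓝 (0 : ℝ), ContDiffAt ℝ n (e.symm ∘ j) ε ∧ j ε ∈ e.target := by
    have h1 := (hsymm.of_le (show ((n : ℕ) : ℕ∞ω) ≤ (n + 1 : ℕ) by
      exact_mod_cast Nat.le_succ n)).eventually (by simp)
    have h2 : ∀ᶠ w in 𝓝 ((0, 0, 0) : C(Circ, V) × M × ℝ), w ∈ e.target :=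
      e.open_target.mem_nhds htgt
    have h3 := (hj.continuous.tendsto 0).eventually (h1.and h2)
    exact h3.mono fun ε hε => ⟨hε.1.comp ε hj.contDiffAt, hε.2⟩
  obtain ⟨r₁, hr₁, hball⟩ := Metric.eventually_nhds_iff.1 hnear
  -- Replacing ε by `χ ε` keeps the argument inside the domain of the local inverse, so the branch
  -- is smooth on the whole line and is the true solution for small ε.
  obtain ⟨χ, hχ, hχr, δ, hδ, hχδ⟩ := exists_cutoff hr₁
  have hχ' : ∀ x, ContDiffAt ℝ n (e.symm ∘ j) (χ x) ∧ j (χ x) ∈ e.target := fun x =>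
    hball (by simpa [Real.dist_eq] using hχr x)
  let u : ℝ → C(Circ, V) × M × ℝ := fun ε => e.symm (j (χ ε))
  have hu : ContDiff ℝ n u := contDiff_iff_contDiffAt.2 fun x =>
    (hχ' x).1.comp x ((contDiff_infty.1 hχ n).contDiffAt)
  have hχ0 : χ 0 = 0 := hχδ 0 (by simpa using hδ)
  have hu0 : u 0 = a := by simp only [u, hχ0]; exact hsa
  have husrc : ∀ ε, u ε ∈ e.source := fun ε => e.map_target (hχ' ε).2
  have hueq : ∀ ε, bvpMap f l y₀ (u ε) = j (χ ε) := fun ε => e.right_inv (hχ' ε).2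
  have hu3 : ∀ ε, (u ε).2.2 = χ ε := fun ε =>
    congrArg (fun w : C(Circ, V) × M × ℝ => w.2.2) (hueq ε)
  have hloc : ∀ᶠ ε in 𝓝 (0 : ℝ), χ ε = ε := Metric.eventually_nhds_iff.2
    ⟨δ, hδ, fun ε hε => hχδ ε (by simpa [Real.dist_eq] using hε)⟩
  obtain ⟨ρ, hρ, hρs⟩ := Metric.isOpen_iff.1 e.open_source a hsrc
  refine ⟨fun ε => (u ε).1, fun ε => (u ε).2.1, contDiff_fst.comp hu,
    (contDiff_fst.comp contDiff_snd).comp hu, congrArg Prod.fst hu0,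
    congrArg (fun w => w.2.1) hu0, ?_, ρ / 2, by positivity, ?_⟩
  · filter_upwards [hloc] with ε hε
    refine (bvpMap_eq_iff f l y₀ _ _ _).1 ?_
    have h1 := hueq ε
    have h2 := hu3 ε
    rw [hε] at h1 h2
    rw [show ((u ε).1, (u ε).2.1, ε) = u ε from Prod.ext rfl (Prod.ext rfl h2.symm)]
    exact h1
  · filter_upwards [hloc, Metric.ball_mem_nhds (0 : ℝ) hρ] with ε hε hερ y ν hyp hy hyl hyn hν
    have hyc : Continuous y := continuous_iff_continuousAt.2 fun θ => (hy θ).continuousAt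
    have hsol : bvpMap f l y₀ (toCirc y hyc hyp, ν, ε) = j ε :=
      (bvpMap_eq_iff f l y₀ _ _ _).2 ⟨hy, hyl⟩
    have hmem : (toCirc y hyc hyp, ν, ε) ∈ e.source := by
      apply hρs
      rw [Metric.mem_ball, dist_eq_norm]
      have h1 : ‖toCirc y hyc hyp - circConst y₀‖ ≤ ρ / 2 := by
        refine (ContinuousMap.norm_le _ (by positivity)).2 fun t => ?_
        induction t using circ_forall with | _ θ
        exact (hyn θ).le
      have h2 : ‖ε‖ < ρ := by simpa using hερ
      simp only [a, Prod.mk_sub_mk, Prod.norm_mk, sub_zero]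
      exact max_lt (by linarith) (max_lt (by linarith) h2)
    have huε : bvpMap f l y₀ (u ε) = j ε := by rw [hueq, hε]
    have heq : (toCirc y hyc hyp, ν, ε) = u ε :=
      e.injOn hmem (husrc ε) (by rw [he, he, hsol, huε])
    rw [← heq]
    exact ⟨fun θ => rfl, rfl⟩

end Branch

end NeimarkSacker

namespace NeimarkSacker

/-! ### Trigonometric polynomials of degree three -/

section Trig

theorem integral_cos_int_mul (n : ℤ) :
    ∫ φ in (0 : ℝ)..2 * Real.pi, Real.cos (n * φ) = if n = 0 then 2 * Real.pi else 0 := by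
  split_ifs with h
  · simp [h]
  · rw [intervalIntegral.integral_comp_mul_left _ (by exact_mod_cast h), integral_cos]
    have := Real.sin_int_mul_pi (n * 2)
    push_cast at this
    rw [← mul_assoc, this]
    simp

theorem integral_sin_int_mul (n : ℤ) :
    ∫ φ in (0 : ℝ)..2 * Real.pi, Real.sin (n * φ) = 0 := by
  by_cases h : n = 0
  · simp [h]
  · rw [intervalIntegral.integral_comp_mul_left _ (by exact_mod_cast h), integral_sin]
    simp [Real.cos_int_mul_two_pi]

theorem integral_cos_mul_cos (m n : ℕ) :
    ∫ φ in (0 : ℝ)..2 * Real.pi, Real.cos (m * φ) * Real.cos (n * φ) =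
      if m = n then (if m = 0 then 2 * Real.pi else Real.pi) else 0 := by
  have h : ∀ φ : ℝ, Real.cos (m * φ) * Real.cos (n * φ) =
      2⁻¹ * (Real.cos (((m - n : ℤ) : ℝ) * φ) + Real.cos (((m + n : ℤ) : ℝ) * φ)) := by
    intro φ
    push_cast
    rw [sub_mul, add_mul, Real.cos_sub, Real.cos_add]; ring
  simp_rw [h]
  rw [intervalIntegral.integral_const_mul, intervalIntegral.integral_add
    (by apply Continuous.intervalIntegrable; fun_prop)
    (by apply Continuous.intervalIntegrable; fun_prop),
    integral_cos_int_mul, integral_cos_int_mul]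
  by_cases h1 : m = n
  · subst h1
    by_cases h2 : m = 0
    · simp [h2]; ring
    · have : ¬ ((m : ℤ) + m = 0) := by omega
      simp [h2, this]
  · have h2 : ¬ ((m : ℤ) - n = 0) := by omega
    have h3 : ¬ ((m : ℤ) + n = 0) := by omega
    simp [h1, h2, h3]

theorem integral_sin_mul_sin (m n : ℕ) :
    ∫ φ in (0 : ℝ)..2 * Real.pi, Real.sin (m * φ) * Real.sin (n * φ) =
      if m = n then (if m = 0 then 0 else Real.pi) else 0 := by
  have h : ∀ φ : ℝ, Real.sin (m * φ) * Real.sin (n * φ) =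
      2⁻¹ * (Real.cos (((m - n : ℤ) : ℝ) * φ) - Real.cos (((m + n : ℤ) : ℝ) * φ)) := by
    intro φ
    push_cast
    rw [sub_mul, add_mul, Real.cos_sub, Real.cos_add]; ring
  simp_rw [h]
  rw [intervalIntegral.integral_const_mul, intervalIntegral.integral_sub
    (by apply Continuous.intervalIntegrable; fun_prop)
    (by apply Continuous.intervalIntegrable; fun_prop),
    integral_cos_int_mul, integral_cos_int_mul]
  by_cases h1 : m = n
  · subst h1
    by_cases h2 : m = 0
    · simp [h2]
    · have : ¬ ((m : ℤ) + m = 0) := by omega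
      simp [h2, this]
  · have h2 : ¬ ((m : ℤ) - n = 0) := by omega
    have h3 : ¬ ((m : ℤ) + n = 0) := by omega
    simp [h1, h2, h3]

theorem integral_sin_mul_cos (m n : ℕ) :
    ∫ φ in (0 : ℝ)..2 * Real.pi, Real.sin (m * φ) * Real.cos (n * φ) = 0 := by
  have h : ∀ φ : ℝ, Real.sin (m * φ) * Real.cos (n * φ) =
      2⁻¹ * (Real.sin (((m - n : ℤ) : ℝ) * φ) + Real.sin (((m + n : ℤ) : ℝ) * φ)) := by
    intro φ
    push_cast
    rw [sub_mul, add_mul, Real.sin_sub, Real.sin_add]; ring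
  simp_rw [h]
  rw [intervalIntegral.integral_const_mul, intervalIntegral.integral_add
    (by apply Continuous.intervalIntegrable; fun_prop)
    (by apply Continuous.intervalIntegrable; fun_prop),
    integral_sin_int_mul, integral_sin_int_mul]
  simp

theorem integral_cos_mul_sin (m n : ℕ) :
    ∫ φ in (0 : ℝ)..2 * Real.pi, Real.cos (m * φ) * Real.sin (n * φ) = 0 := by
  simp_rw [mul_comm (Real.cos _)]
  exact integral_sin_mul_cos n m

/-- The functions `1, cos φ, sin φ, cos 2φ, sin 2φ, cos 3φ, sin 3φ`. -/
noncomputable def trigB (j : Fin 7) (φ : ℝ) : ℝ :=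
  (![Real.cos ((0 : ℕ) * φ), Real.cos ((1 : ℕ) * φ), Real.sin ((1 : ℕ) * φ),
    Real.cos ((2 : ℕ) * φ), Real.sin ((2 : ℕ) * φ),
    Real.cos ((3 : ℕ) * φ), Real.sin ((3 : ℕ) * φ)] : Fin 7 → ℝ) j

/-- The normalising factors of the Fourier coefficients. -/
noncomputable def trigW (j : Fin 7) : ℝ := if j = 0 then (2 * Real.pi)⁻¹ else Real.pi⁻¹

theorem contDiff_trigB (j : Fin 7) : ContDiff ℝ ∞ (trigB j) := by
  fin_cases j <;>
    first
      | exact Real.contDiff_cos.comp (contDiff_const.mul contDiff_id)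
      | exact Real.contDiff_sin.comp (contDiff_const.mul contDiff_id)

theorem trigB_orthogonal (i j : Fin 7) :
    trigW i * ∫ φ in (0 : ℝ)..2 * Real.pi, trigB i φ * trigB j φ = if i = j then 1 else 0 := by
  have hπ := Real.pi_ne_zero
  fin_cases i <;> fin_cases j <;>
    simp only [trigB, trigW, Fin.zero_eta, Fin.mk_one, Fin.reduceFinMk, Matrix.cons_val,
      integral_cos_mul_cos, integral_sin_mul_sin, integral_sin_mul_cos, integral_cos_mul_sin] <;>
    simp [hπ, Fin.ext_iff]
  field_simp

variable {W W₁ : Type} [NormedAddCommGroup W] [NormedSpace ℝ W] [NormedAddCommGroup W₁]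
  [NormedSpace ℝ W₁]

/-- The trigonometric polynomial with given coefficients. -/
noncomputable def ev (φ : ℝ) : (Fin 7 → W) →L[ℝ] W :=
  ∑ j, trigB j φ • ContinuousLinearMap.proj (R := ℝ) (φ := fun _ : Fin 7 => W) j

theorem ev_apply (φ : ℝ) (c : Fin 7 → W) : ev φ c = ∑ j, trigB j φ • c j := by
  simp [ev]

theorem ev_eq (φ : ℝ) (c : Fin 7 → W) : ev φ c = c 0 + Real.cos φ • c 1 + Real.sin φ • c 2 +
    Real.cos (2 * φ) • c 3 + Real.sin (2 * φ) • c 4 + Real.cos (3 * φ) • c 5 +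
    Real.sin (3 * φ) • c 6 := by
  rw [ev_apply, Fin.sum_univ_seven]
  simp [trigB]

theorem contDiff_ev : ContDiff ℝ ∞ (fun φ => (ev φ : (Fin 7 → W) →L[ℝ] W)) :=
  ContDiff.sum fun j _ => (contDiff_trigB j).smul contDiff_const

theorem norm_trigB_le (j : Fin 7) (φ : ℝ) : |trigB j φ| ≤ 1 := by
  fin_cases j <;> simp only [trigB] <;>
    first
      | exact Real.abs_cos_le_one _
      | exact Real.abs_sin_le_one _

theorem norm_ev_le (φ : ℝ) (c : Fin 7 → W) : ‖ev φ c‖ ≤ 7 * ‖c‖ := by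
  rw [ev_apply]
  refine (norm_sum_le _ _).trans ?_
  have : ∀ j ∈ (Finset.univ : Finset (Fin 7)), ‖trigB j φ • c j‖ ≤ ‖c‖ := fun j _ => by
    rw [norm_smul]
    exact (mul_le_of_le_one_left (norm_nonneg _) (norm_trigB_le j φ)).trans (norm_le_pi_norm c j)
  simpa using Finset.sum_le_sum this

/-- The action of `d/dφ` on coefficients. -/
noncomputable def rot : (Fin 7 → W) →L[ℝ] (Fin 7 → W) :=
  let p := fun j => ContinuousLinearMap.proj (R := ℝ) (φ := fun _ : Fin 7 => W) j
  ContinuousLinearMap.pi ![0, p 2, -p 1, (2 : ℝ) • p 4, -(2 : ℝ) • p 3, (3 : ℝ) • p 6,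
    -(3 : ℝ) • p 5]

theorem rot_apply (c : Fin 7 → W) : rot c = ![0, c 2, -c 1, (2 : ℝ) • c 4, -(2 : ℝ) • c 3,
    (3 : ℝ) • c 6, -(3 : ℝ) • c 5] := by
  funext j
  fin_cases j <;> simp [rot]

theorem hasDerivAt_ev (c : Fin 7 → W) (φ : ℝ) :
    HasDerivAt (fun s => ev s c) (ev φ (rot c)) φ := by
  have hc : ∀ a : ℝ, HasDerivAt (fun s => Real.cos (a * s)) (-Real.sin (a * φ) * a) φ := fun a => by
    simpa using ((hasDerivAt_id φ).const_mul a).cos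
  have hs : ∀ a : ℝ, HasDerivAt (fun s => Real.sin (a * s)) (Real.cos (a * φ) * a) φ := fun a => by
    simpa using ((hasDerivAt_id φ).const_mul a).sin
  simp_rw [ev_eq]
  refine ((((((((Real.hasDerivAt_cos φ).smul_const (c 1)).const_add (c 0)).add
    ((Real.hasDerivAt_sin φ).smul_const (c 2))).add ((hc 2).smul_const (c 3))).add
    ((hs 2).smul_const (c 4))).add ((hc 3).smul_const (c 5))).add
    ((hs 3).smul_const (c 6))).congr_deriv ?_
  rw [rot_apply]
  simp only [Matrix.cons_val]
  module

/-- Applying an operator to each coefficient. -/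
noncomputable def mapCoef (L : W →L[ℝ] W₁) : (Fin 7 → W) →L[ℝ] (Fin 7 → W₁) :=
  ContinuousLinearMap.pi fun j => L.comp (ContinuousLinearMap.proj j)

@[simp] theorem mapCoef_apply (L : W →L[ℝ] W₁) (c : Fin 7 → W) (j : Fin 7) :
    mapCoef L c j = L (c j) := rfl

theorem ev_mapCoef (L : W →L[ℝ] W₁) (c : Fin 7 → W) (φ : ℝ) :
    ev φ (mapCoef L c) = L (ev φ c) := by
  simp [ev_apply]

variable {k : ℕ}

/-- The Fourier coefficients of a function of `φ`. -/
noncomputable def coef (f : ℝ → Floq k) (j : Fin 7) : Floq k :=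
  trigW j • ∫ φ in (0 : ℝ)..2 * Real.pi, trigB j φ • f φ

theorem trunc_eq_ev (f : ℝ → Floq k) (φ : ℝ) : trunc 3 f φ = ev φ (coef f) := by
  simp only [trunc, ev_apply, Finset.sum_range_succ, Finset.sum_range_zero, Fin.sum_univ_seven,
    coef, cosCoeff, sinCoeff, trigB, trigW, Matrix.cons_val]
  norm_num
  abel

theorem cosCoeff_eq (f : ℝ → Floq k) : cosCoeff 0 f = coef f 0 ∧ cosCoeff 1 f = coef f 1 ∧
    cosCoeff 2 f = coef f 3 ∧ cosCoeff 3 f = coef f 5 := by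
  simp [coef, cosCoeff, trigB, trigW]

theorem sinCoeff_eq (f : ℝ → Floq k) : sinCoeff 1 f = coef f 2 ∧
    sinCoeff 2 f = coef f 4 ∧ sinCoeff 3 f = coef f 6 := by
  simp [coef, sinCoeff, trigB, trigW]

theorem coef_ev (c : Fin 7 → Floq k) : coef (fun φ => ev φ c) = c := by
  funext i
  have h1 : ∀ φ, trigB i φ • ev φ c = ∑ j, (trigB i φ * trigB j φ) • c j := fun φ => by
    rw [ev_apply, Finset.smul_sum]
    simp_rw [smul_smul]
  have hc : ∀ j, Continuous (trigB j) := fun j => (contDiff_trigB j).continuous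
  have hi : ∀ j, IntervalIntegrable (fun φ => (trigB i φ * trigB j φ) • c j)
      MeasureTheory.volume 0 (2 * Real.pi) := fun j =>
    ((((hc i).mul (hc j)).smul continuous_const).intervalIntegrable _ _)
  rw [coef]
  simp_rw [h1]
  rw [intervalIntegral.integral_finsetSum fun j _ => hi j]
  simp_rw [intervalIntegral.integral_smul_const, Finset.smul_sum, smul_smul, trigB_orthogonal]
  simp

theorem coef_add {f g : ℝ → Floq k} (hf : Continuous f) (hg : Continuous g) :
    coef (fun φ => f φ + g φ) = coef f + coef g := by
  funext j
  have hc : Continuous (trigB j) := (contDiff_trigB j).continuous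
  have hi : ∀ {f : ℝ → Floq k}, Continuous f → IntervalIntegrable (fun φ => trigB j φ • f φ)
      MeasureTheory.volume 0 (2 * Real.pi) := fun hf => (hc.smul hf).intervalIntegrable _ _
  simp only [coef, Pi.add_apply, smul_add]
  rw [intervalIntegral.integral_add (hi hf) (hi hg), smul_add]

theorem coef_smul (a : ℝ) (f : ℝ → Floq k) : coef (fun φ => a • f φ) = a • coef f := by
  funext j
  simp only [coef, Pi.smul_apply, smul_comm _ a, intervalIntegral.integral_smul]

theorem ev_injective {c d : Fin 7 → Floq k} (h : ∀ φ, ev φ c = ev φ d) : c = d := by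
  rw [← coef_ev c, ← coef_ev d]
  congr 1
  funext φ
  exact h φ

theorem norm_coef_le {f : ℝ → Floq k} {r : ℝ} (hr : 0 ≤ r) (hf : ∀ φ, ‖f φ‖ ≤ r) :
    ‖coef f‖ ≤ 2 * r := by
  refine (pi_norm_le_iff_of_nonneg (by positivity)).2 fun j => ?_
  have h1 : ‖∫ φ in (0 : ℝ)..2 * Real.pi, trigB j φ • f φ‖ ≤ r * |2 * Real.pi - 0| :=
    intervalIntegral.norm_integral_le_of_norm_le_const fun φ _ => by
      rw [norm_smul]
      exact (mul_le_of_le_one_left (norm_nonneg _) (norm_trigB_le j φ)).trans (hf φ)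
  have hπ := Real.pi_pos
  rw [sub_zero, abs_of_pos (by positivity)] at h1
  have h2 : ‖trigW j‖ ≤ Real.pi⁻¹ := by
    rw [trigW]
    split_ifs
    · rw [Real.norm_of_nonneg (by positivity)]
      exact inv_anti₀ hπ (by linarith)
    · rw [Real.norm_of_nonneg (by positivity)]
  rw [coef, norm_smul]
  calc _ ≤ Real.pi⁻¹ * (r * (2 * Real.pi)) := by gcongr
    _ = 2 * r := by field_simp

/-- Trigonometric polynomials of degree at most `n`. -/
def IsTrig (n : ℕ) (f : ℝ → W) : Prop :=
  ∃ α β : ℕ → W, ∀ φ, f φ = ∑ m ∈ Finset.range (n + 1),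
    (Real.cos (m * φ) • α m + Real.sin (m * φ) • β m)

theorem IsTrig.add {n : ℕ} {f g : ℝ → W} (hf : IsTrig n f) (hg : IsTrig n g) :
    IsTrig n (fun φ => f φ + g φ) := by
  obtain ⟨α, β, h⟩ := hf
  obtain ⟨α', β', h'⟩ := hg
  refine ⟨α + α', β + β', fun φ => ?_⟩
  simp only [h, h', ← Finset.sum_add_distrib]
  exact Finset.sum_congr rfl fun m _ => by simp only [Pi.add_apply]; module

theorem IsTrig.clm {n : ℕ} {f : ℝ → W} (L : W →L[ℝ] W₁) (hf : IsTrig n f) :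
    IsTrig n (fun φ => L (f φ)) := by
  obtain ⟨α, β, h⟩ := hf
  exact ⟨fun m => L (α m), fun m => L (β m), fun φ => by simp [h]⟩

theorem IsTrig.congr {n : ℕ} {f g : ℝ → W} (hf : IsTrig n f) (h : ∀ φ, g φ = f φ) :
    IsTrig n g := by
  rwa [show g = f from funext h]

theorem isTrig_zero (n : ℕ) : IsTrig n (fun _ => (0 : W)) := ⟨0, 0, fun φ => by simp⟩

theorem isTrig_sum {ι : Type} {s : Finset ι} {n : ℕ} {f : ι → ℝ → W} (h : ∀ i ∈ s, IsTrig n (f i)) :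
    IsTrig n (fun φ => ∑ i ∈ s, f i φ) := by
  classical
  induction s using Finset.induction_on with
  | empty => simpa using isTrig_zero n
  | insert i s hi ih =>
    refine ((h i (Finset.mem_insert_self _ _)).add
      (ih fun j hj => h j (Finset.mem_insert_of_mem hj))).congr fun φ => ?_
    rw [Finset.sum_insert hi]

theorem isTrig_cos {m n : ℕ} (h : m ≤ n) (x : W) : IsTrig n (fun φ => Real.cos (m * φ) • x) := by
  refine ⟨Pi.single m x, 0, fun φ => ?_⟩
  rw [Finset.sum_eq_single m]
  · simp
  · intro b _ hb
    simp [hb]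
  · intro hm
    exact absurd (Finset.mem_range.2 (Nat.lt_succ_of_le h)) hm

theorem isTrig_sin {m n : ℕ} (h : m ≤ n) (x : W) : IsTrig n (fun φ => Real.sin (m * φ) • x) := by
  refine ⟨0, Pi.single m x, fun φ => ?_⟩
  rw [Finset.sum_eq_single m]
  · simp
  · intro b _ hb
    simp [hb]
  · intro hm
    exact absurd (Finset.mem_range.2 (Nat.lt_succ_of_le h)) hm

theorem IsTrig.mono {m n : ℕ} (h : m ≤ n) {f : ℝ → W} (hf : IsTrig m f) : IsTrig n f := by
  obtain ⟨α, β, hf⟩ := hf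
  refine IsTrig.congr (isTrig_sum (s := Finset.range (m + 1)) fun i hi => ?_) hf
  have : i ≤ n := (Nat.lt_succ_iff.1 (Finset.mem_range.1 hi)).trans h
  exact (isTrig_cos this _).add (isTrig_sin this _)

/-- Product-to-sum formulas: multiplication by cos φ moves mode m to m ± 1. Mode 0 is separate,
since m − 1 would not be a natural number. -/
theorem IsTrig.cos_smul {n : ℕ} {f : ℝ → W} (hf : IsTrig n f) :
    IsTrig (n + 1) (fun φ => Real.cos φ • f φ) := by
  obtain ⟨α, β, hf⟩ := hf
  refine (isTrig_sum (s := Finset.range (n + 1)) (n := n + 1) (f := fun m φ =>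
    Real.cos φ • (Real.cos (m * φ) • α m + Real.sin (m * φ) • β m)) fun m hm => ?_).congr fun φ => ?_
  · have hm := Nat.lt_succ_iff.1 (Finset.mem_range.1 hm)
    cases m with
    | zero =>
      exact (isTrig_cos (show 1 ≤ n + 1 by omega) (α 0)).congr fun φ => by simp
    | succ m =>
      refine (((isTrig_cos (show m + 2 ≤ n + 1 by omega) ((2 : ℝ)⁻¹ • α (m + 1))).add
        (isTrig_cos (show m ≤ n + 1 by omega) ((2 : ℝ)⁻¹ • α (m + 1)))).add
        ((isTrig_sin (show m + 2 ≤ n + 1 by omega) ((2 : ℝ)⁻¹ • β (m + 1))).add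
        (isTrig_sin (show m ≤ n + 1 by omega) ((2 : ℝ)⁻¹ • β (m + 1))))).congr fun φ => ?_
      have h1 : ((m + 2 : ℕ) : ℝ) * φ = (m + 1 : ℕ) * φ + φ := by push_cast; ring
      have h2 : (m : ℝ) * φ = (m + 1 : ℕ) * φ - φ := by push_cast; ring
      rw [h1, h2, Real.cos_add, Real.cos_sub, Real.sin_add, Real.sin_sub]
      module
  · rw [hf, Finset.smul_sum]

theorem IsTrig.sin_smul {n : ℕ} {f : ℝ → W} (hf : IsTrig n f) :
    IsTrig (n + 1) (fun φ => Real.sin φ • f φ) := by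
  obtain ⟨α, β, hf⟩ := hf
  refine (isTrig_sum (s := Finset.range (n + 1)) (n := n + 1) (f := fun m φ =>
    Real.sin φ • (Real.cos (m * φ) • α m + Real.sin (m * φ) • β m)) fun m hm => ?_).congr fun φ => ?_
  · have hm := Nat.lt_succ_iff.1 (Finset.mem_range.1 hm)
    cases m with
    | zero =>
      exact (isTrig_sin (show 1 ≤ n + 1 by omega) (α 0)).congr fun φ => by simp
    | succ m =>
      refine (((isTrig_sin (show m + 2 ≤ n + 1 by omega) ((2 : ℝ)⁻¹ • α (m + 1))).add
        (isTrig_sin (show m ≤ n + 1 by omega) (-(2 : ℝ)⁻¹ • α (m + 1)))).add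
        ((isTrig_cos (show m + 2 ≤ n + 1 by omega) (-(2 : ℝ)⁻¹ • β (m + 1))).add
        (isTrig_cos (show m ≤ n + 1 by omega) ((2 : ℝ)⁻¹ • β (m + 1))))).congr fun φ => ?_
      have h1 : ((m + 2 : ℕ) : ℝ) * φ = (m + 1 : ℕ) * φ + φ := by push_cast; ring
      have h2 : (m : ℝ) * φ = (m + 1 : ℕ) * φ - φ := by push_cast; ring
      rw [h1, h2, Real.cos_add, Real.cos_sub, Real.sin_add, Real.sin_sub]
      module
  · rw [hf, Finset.smul_sum]

theorem IsTrig.exists_ev {f : ℝ → W} (hf : IsTrig 3 f) : ∃ d : Fin 7 → W, ∀ φ, f φ = ev φ d := by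
  obtain ⟨α, β, hf⟩ := hf
  refine ⟨![α 0, α 1, β 1, α 2, β 2, α 3, β 3], fun φ => ?_⟩
  rw [hf, ev_eq]
  simp [Finset.sum_range_succ]
  abel

/-- This is how truncation disappears: it acts as the identity on whatever has degree at most 3. -/
theorem IsTrig.ev_coef {f : ℝ → Floq k} (hf : IsTrig 3 f) (φ : ℝ) : ev φ (coef f) = f φ := by
  obtain ⟨d, hd⟩ := hf.exists_ev
  rw [show f = fun φ => ev φ d from funext hd, coef_ev]

theorem isTrig_ev (c : Fin 7 → W) : IsTrig 3 (fun φ => ev φ c) := by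
  refine ⟨fun m => if m = 0 then c 0 else if m = 1 then c 1 else if m = 2 then c 3 else c 5,
    fun m => if m = 0 then 0 else if m = 1 then c 2 else if m = 2 then c 4 else c 6, fun φ => ?_⟩
  simp only [ev_eq]
  simp [Finset.sum_range_succ]
  abel

theorem isTrig_two_ev {c : Fin 7 → W} (h5 : c 5 = 0) (h6 : c 6 = 0) :
    IsTrig 2 (fun φ => ev φ c) := by
  refine ⟨fun m => if m = 0 then c 0 else if m = 1 then c 1 else c 3,
    fun m => if m = 0 then 0 else if m = 1 then c 2 else c 4, fun φ => ?_⟩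
  simp only [ev_eq]
  simp [Finset.sum_range_succ, h5, h6]
  abel

end Trig

end NeimarkSacker

namespace NeimarkSacker

/-! ### Nondegeneracy of the linearised torus equations -/

section Nondegeneracy

/-- The function exp(−μθ) z(θ) is constant; comparing θ with θ + 2π, a nonzero value of z would
force exp(2πμ) = 1. -/
theorem periodic_eq_zero_of_hasDerivAt {z : ℝ → ℂ} {μ : ℂ}
    (hp : Function.Periodic z (2 * Real.pi)) (hz : ∀ θ, HasDerivAt z (μ * z θ) θ)
    (hμ : Complex.exp (2 * Real.pi * μ) ≠ 1) (θ : ℝ) : z θ = 0 := by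
  have hd : ∀ s : ℝ, HasDerivAt (fun s : ℝ => Complex.exp (-(s * μ)) * z s) 0 s := by
    intro s
    have h1 : HasDerivAt (fun s : ℝ => -((s : ℂ) * μ)) (-μ) s := by
      have h2 := ((Complex.ofRealCLM.hasDerivAt (x := s)).mul_const μ).neg
      rw [Complex.ofRealCLM_apply, Complex.ofReal_one, one_mul] at h2
      exact h2
    refine (h1.cexp.mul (hz s)).congr_deriv ?_
    ring
  have hconst : ∀ s t : ℝ, Complex.exp (-(s * μ)) * z s = Complex.exp (-(t * μ)) * z t :=
    is_const_of_deriv_eq_zero (fun s => (hd s).differentiableAt) (fun s => (hd s).deriv)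
  have h1 := hconst (θ + 2 * Real.pi) θ
  rw [hp θ] at h1
  push_cast at h1
  have h2 : Complex.exp (-((θ + 2 * Real.pi) * μ)) =
      Complex.exp (-(θ * μ)) * Complex.exp (-(2 * Real.pi * μ)) := by
    rw [← Complex.exp_add]; ring_nf
  rw [h2, mul_assoc] at h1
  have h3 := mul_left_cancel₀ (Complex.exp_ne_zero _) h1
  by_contra hne
  apply hμ
  have h4 : Complex.exp (-(2 * Real.pi * μ)) = 1 := by
    have : Complex.exp (-(2 * Real.pi * μ)) * z θ = 1 * z θ := by rw [h3, one_mul]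
    exact mul_right_cancel₀ hne this
  rw [Complex.exp_neg, inv_eq_one] at h4
  exact h4

theorem exp_two_pi_mul_I_ne_one {σ : ℝ} (hσ : ∀ n : ℤ, σ ≠ n) :
    Complex.exp (2 * Real.pi * (Complex.I * σ)) ≠ 1 := by
  intro h
  obtain ⟨n, hn⟩ := Complex.exp_eq_one_iff.1 h
  apply hσ n
  have h1 : (2 * Real.pi * Complex.I : ℂ) ≠ 0 := by simp [Real.pi_ne_zero]
  have h2 : (σ : ℂ) = n := by
    apply mul_left_cancel₀ h1
    linear_combination hn
  exact_mod_cast h2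

theorem exp_two_pi_mul_ne_one_of_re_ne_zero {μ : ℂ} (hμ : μ.re ≠ 0) :
    Complex.exp (2 * Real.pi * μ) ≠ 1 := by
  intro h
  obtain ⟨n, hn⟩ := Complex.exp_eq_one_iff.1 h
  have := congrArg Complex.re hn
  simp [Real.pi_ne_zero] at this
  exact hμ this

/-- Periodic solutions of `a' = - s b`, `b' = s a` vanish unless `s` is an integer. -/
theorem periodic_rotation_eq_zero {a b : ℝ → ℝ} {s : ℝ} (hs : ∀ n : ℤ, s ≠ n)
    (ha : Function.Periodic a (2 * Real.pi)) (hb : Function.Periodic b (2 * Real.pi))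
    (ha' : ∀ θ, HasDerivAt a (-s * b θ) θ) (hb' : ∀ θ, HasDerivAt b (s * a θ) θ) (θ : ℝ) :
    a θ = 0 ∧ b θ = 0 := by
  have h := periodic_eq_zero_of_hasDerivAt (z := fun θ => (a θ : ℂ) + Complex.I * b θ)
    (μ := Complex.I * s) (fun θ => by simp only [ha θ, hb θ])
    (fun θ => by
      refine ((ha' θ).ofReal_comp.add ((hb' θ).ofReal_comp.const_mul Complex.I)).congr_deriv ?_
      push_cast
      linear_combination (-(s * b θ : ℂ)) * Complex.I_mul_I)
    (exp_two_pi_mul_I_ne_one hs) θ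
  have h1 := congrArg Complex.re h
  have h2 := congrArg Complex.im h
  simp at h1 h2
  exact ⟨h1, h2⟩

/-- The combinations of the critical components that satisfy scalar equations. -/
theorem hasDerivAt_critical {a₀ a₁ b₀ b₁ : ℝ → ℝ} {om s f : ℝ} {c : ℂ} {θ : ℝ}
    (f₀ f₁ g₀ g₁ : ℝ) (hf : f = 1 ∨ f = -1)
    (hc : c = (f₀ + Complex.I * g₀) + f * Complex.I * (f₁ + Complex.I * g₁))
    (ha₀ : HasDerivAt a₀ (-om * a₁ θ - s * b₀ θ + f₀) θ)
    (ha₁ : HasDerivAt a₁ (om * a₀ θ - s * b₁ θ + f₁) θ)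
    (hb₀ : HasDerivAt b₀ (-om * b₁ θ + s * a₀ θ + g₀) θ)
    (hb₁ : HasDerivAt b₁ (om * b₀ θ + s * a₁ θ + g₁) θ) :
    HasDerivAt (fun θ => ((a₀ θ : ℂ) + Complex.I * b₀ θ) + f * Complex.I *
      (a₁ θ + Complex.I * b₁ θ))
      (Complex.I * ((s + f * om : ℝ) : ℂ) * (((a₀ θ : ℂ) + Complex.I * b₀ θ) + f * Complex.I *
      (a₁ θ + Complex.I * b₁ θ)) + c) θ := by
  refine ((ha₀.ofReal_comp.add (hb₀.ofReal_comp.const_mul Complex.I)).add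
    ((ha₁.ofReal_comp.add (hb₁.ofReal_comp.const_mul Complex.I)).const_mul
      (f * Complex.I))).congr_deriv ?_
  have hI : Complex.I ^ 2 = -1 := Complex.I_sq
  have hI3 : Complex.I ^ 3 = -Complex.I := by rw [pow_succ, hI]; ring
  rw [hc]
  push_cast
  rcases hf with rfl | rfl <;> push_cast <;> ring_nf <;> simp only [hI, hI3] <;> ring

/-- With A = a + i b the system reads A' = Ê A + i s A, and A₀ ± i A₁ diagonalise it with
frequencies s ± ω. In the application s = mω for the mode m. -/
theorem periodic_critical_eq_zero {a₀ a₁ b₀ b₁ : ℝ → ℝ} {om s : ℝ}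
    (hs : ∀ n : ℤ, s + om ≠ n) (hs' : ∀ n : ℤ, s - om ≠ n)
    (pa₀ : Function.Periodic a₀ (2 * Real.pi)) (pa₁ : Function.Periodic a₁ (2 * Real.pi))
    (pb₀ : Function.Periodic b₀ (2 * Real.pi)) (pb₁ : Function.Periodic b₁ (2 * Real.pi))
    (ha₀ : ∀ θ, HasDerivAt a₀ (-om * a₁ θ - s * b₀ θ) θ)
    (ha₁ : ∀ θ, HasDerivAt a₁ (om * a₀ θ - s * b₁ θ) θ)
    (hb₀ : ∀ θ, HasDerivAt b₀ (-om * b₁ θ + s * a₀ θ) θ)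
    (hb₁ : ∀ θ, HasDerivAt b₁ (om * b₀ θ + s * a₁ θ) θ) (θ : ℝ) :
    a₀ θ = 0 ∧ a₁ θ = 0 ∧ b₀ θ = 0 ∧ b₁ θ = 0 := by
  have key : ∀ f : ℝ, (f = 1 ∨ f = -1) → ((a₀ θ : ℂ) + Complex.I * b₀ θ) + f * Complex.I *
      (a₁ θ + Complex.I * b₁ θ) = 0 := by
    intro f hf
    refine periodic_eq_zero_of_hasDerivAt (z := fun θ => ((a₀ θ : ℂ) + Complex.I * b₀ θ) +
      f * Complex.I * (a₁ θ + Complex.I * b₁ θ)) (μ := Complex.I * ((s + f * om : ℝ) : ℂ))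
      (fun θ => by simp only [pa₀ θ, pa₁ θ, pb₀ θ, pb₁ θ]) (fun θ => ?_)
      (exp_two_pi_mul_I_ne_one (σ := s + f * om) ?_) θ
    · have := hasDerivAt_critical (c := 0) 0 0 0 0 hf (by simp) (by simpa using ha₀ θ)
        (by simpa using ha₁ θ) (by simpa using hb₀ θ) (by simpa using hb₁ θ)
      simpa using this
    · rcases hf with rfl | rfl
      · simpa using hs
      · intro n
        have := hs' n
        rwa [neg_one_mul, ← sub_eq_add_neg]
  have h1 := key 1 (Or.inl rfl)
  have h2 := key (-1) (Or.inr rfl)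
  have h1r := congrArg Complex.re h1
  have h1i := congrArg Complex.im h1
  have h2r := congrArg Complex.re h2
  have h2i := congrArg Complex.im h2
  simp at h1r h1i h2r h2i
  refine ⟨?_, ?_, ?_, ?_⟩ <;> linarith

theorem hasDerivAt_mulVec {k : ℕ} (A : Matrix (Fin k) (Fin k) ℂ) {x : ℝ → Fin k → ℂ}
    {x' : Fin k → ℂ} {θ : ℝ} (h : HasDerivAt x x' θ) :
    HasDerivAt (fun s => A.mulVec (x s)) (A.mulVec x') θ := by
  have := (((A.mulVecLin).restrictScalars ℝ).toContinuousLinearMap).hasFDerivAt.comp_hasDerivAt θ h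
  exact this

/-- Eigenvalues are removed one at a time, which avoids the Jordan form. The function (A − μ)x
solves the same equation and is killed by the shorter product, so it vanishes by induction. Then A x
= μ x, and each component has exponent μ + i s with nonzero real part. -/
theorem periodic_hyperbolic_complex {k : ℕ} {A : Matrix (Fin k) (Fin k) ℂ} (s : ℝ) (l : List ℂ) :
    ∀ {x : ℝ → Fin k → ℂ}, (∀ μ ∈ l, μ.re ≠ 0) → (∀ θ i, x (θ + 2 * Real.pi) i = x θ i) →
    (∀ θ, HasDerivAt x (A.mulVec (x θ) + (Complex.I * s) • x θ) θ) →
    (∀ θ, (Polynomial.aeval A (l.map fun a => Polynomial.X - Polynomial.C a).prod).mulVec (x θ) = 0)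
    → ∀ θ, x θ = 0 := by
  induction l with
  | nil =>
    intro x _ _ _ h θ
    simpa using h θ
  | cons μ l ih =>
    intro x hre hp hx h
    let B : Matrix (Fin k) (Fin k) ℂ := A - μ • 1
    have hB : ∀ v, B.mulVec v = A.mulVec v - μ • v := fun v => by
      simp [B, Matrix.sub_mulVec, Matrix.smul_mulVec]
    have hy : ∀ θ, B.mulVec (x θ) = 0 := by
      refine ih (x := fun θ => B.mulVec (x θ)) (fun ν hν => hre ν (List.mem_cons_of_mem _ hν))
        (fun θ i => by rw [show x (θ + 2 * Real.pi) = x θ from funext (hp θ)]) (fun θ => ?_)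
        (fun θ => ?_)
      · refine (hasDerivAt_mulVec B (hx θ)).congr_deriv ?_
        simp only [hB, Matrix.mulVec_add, Matrix.mulVec_sub, Matrix.mulVec_smul]
        module
      · have h1 := h θ
        rw [List.map_cons, List.prod_cons, mul_comm, map_mul, ← Matrix.mulVec_mulVec] at h1
        have h2 : Polynomial.aeval A (Polynomial.X - Polynomial.C μ) = B := by
          simp [B, Algebra.algebraMap_eq_smul_one]
        rwa [h2] at h1
    intro θ
    funext i
    have hre' : (μ + Complex.I * s).re ≠ 0 := by
      simpa using hre μ List.mem_cons_self
    refine periodic_eq_zero_of_hasDerivAt (z := fun θ => x θ i) (μ := μ + Complex.I * s)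
      (fun θ => hp θ i) (fun θ => ?_) (exp_two_pi_mul_ne_one_of_re_ne_zero hre') θ
    refine (hasDerivAt_pi.1 (hx θ) i).congr_deriv ?_
    have h1 := hy θ
    rw [hB, sub_eq_zero] at h1
    rw [h1]
    simp only [Pi.add_apply, Pi.smul_apply, smul_eq_mul]
    ring

theorem toEuclideanCLM_apply {k : ℕ} (A : Matrix (Fin k) (Fin k) ℝ) (x : EuclideanSpace ℝ (Fin k))
    (i : Fin k) : Matrix.toEuclideanCLM (𝕜 := ℝ) A x i = ∑ j, A i j * x j := by
  rw [Matrix.ofLp_toEuclideanCLM]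
  rfl

/-- Applied to x = a + i b, with the product of linear factors being the characteristic polynomial,
which annihilates the matrix by Cayley–Hamilton. -/
theorem periodic_hyperbolic_eq_zero {k : ℕ} {A : Matrix (Fin k) (Fin k) ℝ}
    (hA : ∀ μ ∈ spectrum ℂ (A.map (algebraMap ℝ ℂ)), μ.re ≠ 0) {s : ℝ}
    {a b : ℝ → EuclideanSpace ℝ (Fin k)}
    (pa : ∀ θ, a (θ + 2 * Real.pi) = a θ) (pb : ∀ θ, b (θ + 2 * Real.pi) = b θ)
    (ha : ∀ θ i, HasDerivAt (fun θ => a θ i) (∑ j, A i j * a θ j - s * b θ i) θ)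
    (hb : ∀ θ i, HasDerivAt (fun θ => b θ i) (∑ j, A i j * b θ j + s * a θ i) θ) (θ : ℝ) :
    a θ = 0 ∧ b θ = 0 := by
  let B := A.map (algebraMap ℝ ℂ)
  let x : ℝ → Fin k → ℂ := fun θ i => (a θ i : ℂ) + Complex.I * b θ i
  have hsplit : B.charpoly = ((B.charpoly.roots.toList).map
      fun a => Polynomial.X - Polynomial.C a).prod := by
    conv_lhs => rw [(IsAlgClosed.splits B.charpoly).eq_prod_roots_of_monic B.charpoly_monic]
    conv_lhs => rw [← Multiset.coe_toList B.charpoly.roots]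
    rw [Multiset.map_coe, Multiset.prod_coe]
  have h := periodic_hyperbolic_complex (A := B) s B.charpoly.roots.toList (x := x)
    (fun μ hμ => by
      have h1 := (Polynomial.mem_roots'.1 (Multiset.mem_toList.1 hμ)).2
      exact hA μ (Matrix.mem_spectrum_iff_isRoot_charpoly.2 h1))
    (fun θ i => by simp only [x, pa θ, pb θ])
    (fun θ => by
      rw [hasDerivAt_pi]
      intro i
      refine ((ha θ i).ofReal_comp.add ((hb θ i).ofReal_comp.const_mul Complex.I)).congr_deriv ?_
      simp only [x, B, Matrix.mulVec, dotProduct, Pi.add_apply, Pi.smul_apply, smul_eq_mul,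
        Matrix.map_apply, mul_add, Finset.sum_add_distrib]
      push_cast
      simp only [mul_add, Finset.mul_sum, Complex.coe_algebraMap]
      have : ∀ j, Complex.I * ((A i j : ℂ) * b θ j) = A i j * (Complex.I * b θ j) := fun j => by ring
      simp only [this]
      linear_combination (-(s * b θ i : ℂ)) * Complex.I_mul_I)
    (fun θ => by rw [← hsplit, Matrix.aeval_self_charpoly, Matrix.zero_mulVec]) θ
  constructor <;> ext i
  · simpa [x] using congrArg Complex.re (congrFun h i)
  · simpa [x] using congrArg Complex.im (congrFun h i)

/-- Since 0 < jω < 2, the only possible integer is 1. It is excluded by ω < 1/2 for j = 1, 2 and by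
the absence of strong resonance for j = 3, 4. -/
theorem nonresonant {om : ℝ} (h0 : 0 < om) (h1 : om < 1 / 2) (h2 : om ≠ 1 / 3 ∧ om ≠ 1 / 4) (j : ℕ)
    (hj : 1 ≤ j) (hj' : j ≤ 4) (n : ℤ) : (j : ℝ) * om ≠ n := by
  intro h
  have hj4 : (j : ℝ) ≤ 4 := by exact_mod_cast hj'
  have hj1 : (1 : ℝ) ≤ j := by exact_mod_cast hj
  have hn0 : (0 : ℝ) < n := by rw [← h]; positivity
  have hn2 : (n : ℝ) < 2 := by rw [← h]; nlinarith
  have hn : n = 1 := by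
    have a : 0 < n := by exact_mod_cast hn0
    have b : n < 2 := by exact_mod_cast hn2
    omega
  rw [hn] at h
  interval_cases j <;> norm_num at h
  · linarith
  · linarith
  · exact h2.1 (by linarith)
  · exact h2.2 (by linarith)

end Nondegeneracy

end NeimarkSacker

namespace NeimarkSacker

/-! ### The linearised torus equations, mode by mode -/

section LinearisedTorus

variable {k : ℕ}

theorem conf_apply (a b : ℝ) (x : EuclideanSpace ℝ (Fin 2)) :
    conf a b x = !₂[a * x 0 - b * x 1, b * x 0 + a * x 1] := by
  ext i
  fin_cases i <;>
    simp [conf, Matrix.ofLp_toEuclideanCLM, Matrix.mulVec, dotProduct, Fin.sum_univ_two]; ring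

/-- The parameters `(λ, ω, η)`. -/
abbrev Param := ℝ × ℝ × ℝ

/-- The Fourier coefficients of `aStar`. -/
noncomputable def crit (k : ℕ) : Fin 7 → Floq k :=
  ![0, (!₂[1, 0], 0, 0), (!₂[0, 1], 0, 0), 0, 0, 0, 0]

/-- The Fourier coefficients of the constant `eLast`. -/
noncomputable def lastMode (k : ℕ) : Fin 7 → Floq k := ![eLast k, 0, 0, 0, 0, 0, 0]

theorem ev_lastMode (φ : ℝ) : ev φ (lastMode k) = eLast k := by
  rw [ev_eq]
  simp [lastMode]

theorem ev_crit (φ : ℝ) : ev φ (crit k) = aStar k φ := by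
  rw [ev_eq]
  refine Prod.ext ?_ (by simp [crit, aStar])
  ext i
  fin_cases i <;> simp [crit, aStar, aHat]

/-- The matrix `E` at the critical parameter. -/
noncomputable def blockE (om : ℝ) (A : Matrix (Fin k) (Fin k) ℝ) : Floq k →L[ℝ] Floq k :=
  (conf 0 om).prodMap ((Matrix.toEuclideanCLM (𝕜 := ℝ) A).prodMap (0 : ℝ →L[ℝ] ℝ))

/-- The linearised torus equations in the function `z`. -/
noncomputable def linA (om : ℝ) (A : Matrix (Fin k) (Fin k) ℝ) :
    (Fin 7 → Floq k) →L[ℝ] (Fin 7 → Floq k) :=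
  mapCoef (blockE om A) - om • rot

/-- The linearised torus equations in the parameters. -/
noncomputable def linC (k : ℕ) (p q : ℝ) : Param →L[ℝ] (Fin 7 → Floq k) :=
  (p • ContinuousLinearMap.fst ℝ ℝ (ℝ × ℝ)).smulRight (crit k) +
  (q • ContinuousLinearMap.fst ℝ ℝ (ℝ × ℝ) - (ContinuousLinearMap.fst ℝ ℝ ℝ).comp
    (ContinuousLinearMap.snd ℝ ℝ (ℝ × ℝ))).smulRight (rot (crit k)) -
  ((ContinuousLinearMap.snd ℝ ℝ ℝ).comp (ContinuousLinearMap.snd ℝ ℝ (ℝ × ℝ))).smulRight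
    (lastMode k)

theorem linC_apply (p q : ℝ) (ν : Param) : linC k p q ν = (p * ν.1) • crit k +
    (q * ν.1 - ν.2.1) • rot (crit k) - ν.2.2 • lastMode k := by
  simp [linC]

/-- A component of a Fourier coefficient in the critical directions. -/
noncomputable def hatC (j : Fin 7) (i : Fin 2) : (Fin 7 → Floq k) →L[ℝ] ℝ :=
  (EuclideanSpace.proj i).comp ((ContinuousLinearMap.fst ℝ _ _).comp (ContinuousLinearMap.proj j))

/-- A component of a Fourier coefficient in the hyperbolic directions. -/
noncomputable def tildeC (j : Fin 7) (i : Fin k) : (Fin 7 → Floq k) →L[ℝ] ℝ :=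
  (EuclideanSpace.proj i).comp ((ContinuousLinearMap.fst ℝ _ _).comp
    ((ContinuousLinearMap.snd ℝ _ _).comp (ContinuousLinearMap.proj j)))

/-- The component of a Fourier coefficient in the last direction. -/
noncomputable def ringC (j : Fin 7) : (Fin 7 → Floq k) →L[ℝ] ℝ :=
  (ContinuousLinearMap.snd ℝ _ _).comp
    ((ContinuousLinearMap.snd ℝ _ _).comp (ContinuousLinearMap.proj j))

@[simp] theorem hatC_apply (j : Fin 7) (i : Fin 2) (c : Fin 7 → Floq k) :
    hatC j i c = (c j).1 i := rfl

@[simp] theorem tildeC_apply (j : Fin 7) (i : Fin k) (c : Fin 7 → Floq k) :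
    tildeC j i c = (c j).2.1 i := rfl

@[simp] theorem ringC_apply (j : Fin 7) (c : Fin 7 → Floq k) : ringC j c = (c j).2.2 := rfl

/-- The amplitude and phase conditions. -/
noncomputable def phaseL (k : ℕ) : (Fin 7 → Floq k) →L[ℝ] Param :=
  (hatC 1 0 + hatC 2 1).prod ((hatC 1 1 - hatC 2 0).prod (ringC 0))

theorem phaseL_apply (c : Fin 7 → Floq k) : phaseL k c =
    ((c 1).1 0 + (c 2).1 1, (c 1).1 1 - (c 2).1 0, (c 0).2.2) := rfl

/-- The solvability condition at frequency zero: constant forcing must vanish and only a constant is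
left. It is used exactly on the resonant parts of the linearisation. -/
theorem periodic_const_deriv {E : Type} [NormedAddCommGroup E] [NormedSpace ℝ E] {z : ℝ → E} {c : E}
    (hp : Function.Periodic z (2 * Real.pi)) (hz : ∀ θ, HasDerivAt z c θ) :
    c = 0 ∧ ∀ θ, z θ = z 0 := by
  have h0 : ∀ θ, z θ - θ • c = z 0 := by
    intro θ
    have hd : ∀ s, HasDerivAt (fun s => z s - s • c) 0 s := fun s => by
      have := (hz s).sub ((hasDerivAt_id s).smul_const c)
      rw [one_smul, sub_self] at this
      exact this
    have := is_const_of_deriv_eq_zero (fun s => (hd s).differentiableAt) (fun s => (hd s).deriv) θ 0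
    simpa using this
  have hc : c = 0 := by
    have h1 := h0 (2 * Real.pi)
    have h2 := hp 0
    rw [zero_add] at h2
    rw [h2, sub_eq_self, smul_eq_zero] at h1
    exact h1.resolve_left Real.two_pi_pos.ne'
  exact ⟨hc, fun θ => by simpa [hc] using h0 θ⟩

set_option maxHeartbeats 2000000 in
-- The linearisation splits by Fourier mode and by block. The critical blocks of modes 0, 2, 3 have
-- frequencies ±ω, then 3ω and ω, then 4ω and 2ω, all nonresonant. Mode 1 has 2ω and the resonant 0;
-- its resonant part is met by `ν.1`, `ν.2.1` and two integral conditions. Mode 0 of the last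
-- component is met by `ν.2.2` and the third.
theorem nondegenerate_lin {om p q : ℝ} {A : Matrix (Fin k) (Fin k) ℝ}
    (h0 : 0 < om) (h1 : om < 1 / 2) (h2 : om ≠ 1 / 3 ∧ om ≠ 1 / 4) (hp : p ≠ 0)
    (hA : ∀ μ ∈ spectrum ℂ (A.map (algebraMap ℝ ℂ)), μ.re ≠ 0) :
    Nondegenerate (linA om A) (linC k p q) (phaseL k) := by
  intro y ν hper hy hl
  have hyc : Continuous y := continuous_iff_continuousAt.2 fun θ => (hy θ).continuousAt
  have H : ∀ (L : (Fin 7 → Floq k) →L[ℝ] ℝ) (θ : ℝ), HasDerivAt (fun s => L (y s))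
      (L (mapCoef (blockE om A) (y θ)) - om * L (rot (y θ)) + ((p * ν.1) * L (crit k) +
        (q * ν.1 - ν.2.1) * L (rot (crit k)) - ν.2.2 * L (lastMode k))) θ := by
    intro L θ
    refine (L.hasFDerivAt.comp_hasDerivAt θ (hy θ)).congr_deriv ?_
    simp [linA, linC_apply]
  have P : ∀ L : (Fin 7 → Floq k) →L[ℝ] ℝ, Function.Periodic (fun s => L (y s)) (2 * Real.pi) :=
    fun L θ => by simp only [hper θ]
  have hres : ∀ (j : ℕ) (_ : 1 ≤ j) (_ : j ≤ 4) (n : ℤ), (j : ℝ) * om ≠ n :=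
    nonresonant h0 h1 h2
  have hneg : ∀ (j : ℕ) (_ : 1 ≤ j) (_ : j ≤ 4) (n : ℤ), -((j : ℝ) * om) ≠ n := by
    intro j hj hj' n h
    exact hres j hj hj' (-n) (by push_cast; linarith)
  have r1 := hres 1 le_rfl (by norm_num)
  have r2 := hres 2 (by norm_num) (by norm_num)
  have r3 := hres 3 (by norm_num) (by norm_num)
  have r4 := hres 4 (by norm_num) le_rfl
  have n1 := hneg 1 le_rfl (by norm_num)
  push_cast at r1 r2 r3 r4 n1
  rw [one_mul] at r1 n1
  -- the critical components
  have hat0 : ∀ θ, (y θ 0).1 = 0 := by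
    intro θ
    have := periodic_critical_eq_zero (a₀ := fun s => hatC 0 0 (y s)) (a₁ := fun s => hatC 0 1 (y s))
      (b₀ := fun _ => 0) (b₁ := fun _ => 0) (om := om) (s := 0) (by simpa using r1)
      (by simpa using n1) (P _) (P _) (fun _ => rfl) (fun _ => rfl)
      (fun θ => (H (hatC 0 0) θ).congr_deriv (by
        simp [blockE, conf_apply, rot_apply, crit, lastMode, eLast]))
      (fun θ => (H (hatC 0 1) θ).congr_deriv (by
        simp [blockE, conf_apply, rot_apply, crit, lastMode, eLast]))
      (fun θ => by simpa using hasDerivAt_const θ (0 : ℝ))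
      (fun θ => by simpa using hasDerivAt_const θ (0 : ℝ)) θ
    ext i
    fin_cases i
    · exact this.1
    · exact this.2.1
  have hat2 : ∀ θ, (y θ 3).1 = 0 ∧ (y θ 4).1 = 0 := by
    intro θ
    have := periodic_critical_eq_zero (a₀ := fun s => hatC 3 0 (y s)) (a₁ := fun s => hatC 3 1 (y s))
      (b₀ := fun s => hatC 4 0 (y s)) (b₁ := fun s => hatC 4 1 (y s)) (om := om) (s := 2 * om)
      (fun n h => r3 n (by linarith)) (fun n h => r1 n (by linarith)) (P _) (P _) (P _) (P _)
      (fun θ => (H (hatC 3 0) θ).congr_deriv (by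
        simp [blockE, conf_apply, rot_apply, crit, lastMode, eLast]; ring))
      (fun θ => (H (hatC 3 1) θ).congr_deriv (by
        simp [blockE, conf_apply, rot_apply, crit, lastMode, eLast]; ring))
      (fun θ => (H (hatC 4 0) θ).congr_deriv (by
        simp [blockE, conf_apply, rot_apply, crit, lastMode, eLast]; ring))
      (fun θ => (H (hatC 4 1) θ).congr_deriv (by
        simp [blockE, conf_apply, rot_apply, crit, lastMode, eLast]; ring)) θ
    constructor <;> ext i <;> fin_cases i
    · exact this.1
    · exact this.2.1
    · exact this.2.2.1
    · exact this.2.2.2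
  have hat3 : ∀ θ, (y θ 5).1 = 0 ∧ (y θ 6).1 = 0 := by
    intro θ
    have := periodic_critical_eq_zero (a₀ := fun s => hatC 5 0 (y s)) (a₁ := fun s => hatC 5 1 (y s))
      (b₀ := fun s => hatC 6 0 (y s)) (b₁ := fun s => hatC 6 1 (y s)) (om := om) (s := 3 * om)
      (fun n h => r4 n (by linarith)) (fun n h => r2 n (by linarith)) (P _) (P _) (P _) (P _)
      (fun θ => (H (hatC 5 0) θ).congr_deriv (by
        simp [blockE, conf_apply, rot_apply, crit, lastMode, eLast]; ring))
      (fun θ => (H (hatC 5 1) θ).congr_deriv (by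
        simp [blockE, conf_apply, rot_apply, crit, lastMode, eLast]; ring))
      (fun θ => (H (hatC 6 0) θ).congr_deriv (by
        simp [blockE, conf_apply, rot_apply, crit, lastMode, eLast]; ring))
      (fun θ => (H (hatC 6 1) θ).congr_deriv (by
        simp [blockE, conf_apply, rot_apply, crit, lastMode, eLast]; ring)) θ
    constructor <;> ext i <;> fin_cases i
    · exact this.1
    · exact this.2.1
    · exact this.2.2.1
    · exact this.2.2.2
  -- the last component
  have ring0 : ν.2.2 = 0 ∧ ∀ θ, (y θ 0).2.2 = (y 0 0).2.2 := by
    have := periodic_const_deriv (c := -ν.2.2) (P (ringC 0)) (fun θ => (H (ringC 0) θ).congr_deriv (by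
      simp [blockE, rot_apply, crit, lastMode, eLast]))
    exact ⟨neg_eq_zero.1 this.1, this.2⟩
  have ring1 : ∀ θ, (y θ 1).2.2 = 0 ∧ (y θ 2).2.2 = 0 :=
    periodic_rotation_eq_zero (s := om) r1 (P (ringC 1)) (P (ringC 2))
      (fun θ => (H (ringC 1) θ).congr_deriv (by simp [blockE, rot_apply, crit, lastMode, eLast]))
      (fun θ => (H (ringC 2) θ).congr_deriv (by simp [blockE, rot_apply, crit, lastMode, eLast]))
  have ring2 : ∀ θ, (y θ 3).2.2 = 0 ∧ (y θ 4).2.2 = 0 :=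
    periodic_rotation_eq_zero (s := 2 * om) r2 (P (ringC 3)) (P (ringC 4))
      (fun θ => (H (ringC 3) θ).congr_deriv (by simp [blockE, rot_apply, crit, lastMode, eLast]; ring))
      (fun θ => (H (ringC 4) θ).congr_deriv (by simp [blockE, rot_apply, crit, lastMode, eLast]; ring))
  have ring3 : ∀ θ, (y θ 5).2.2 = 0 ∧ (y θ 6).2.2 = 0 :=
    periodic_rotation_eq_zero (s := 3 * om) r3 (P (ringC 5)) (P (ringC 6))
      (fun θ => (H (ringC 5) θ).congr_deriv (by simp [blockE, rot_apply, crit, lastMode, eLast]; ring))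
      (fun θ => (H (ringC 6) θ).congr_deriv (by simp [blockE, rot_apply, crit, lastMode, eLast]; ring))
  -- the hyperbolic components
  have per : ∀ (j : Fin 7) (θ : ℝ), (y (θ + 2 * Real.pi) j).2.1 = (y θ j).2.1 := fun j θ => by
    rw [hper θ]
  have tilde0 : ∀ θ, (y θ 0).2.1 = 0 := fun θ =>
    (periodic_hyperbolic_eq_zero hA (s := 0) (b := fun _ => 0) (per 0) (fun _ => rfl)
      (fun θ i => (H (tildeC 0 i) θ).congr_deriv (by
        simp [blockE, toEuclideanCLM_apply, rot_apply, crit, lastMode, eLast]))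
      (fun θ i => by simpa using hasDerivAt_const θ (0 : ℝ)) θ).1
  have tilde1 : ∀ θ, (y θ 1).2.1 = 0 ∧ (y θ 2).2.1 = 0 :=
    periodic_hyperbolic_eq_zero hA (s := om) (per 1) (per 2)
      (fun θ i => (H (tildeC 1 i) θ).congr_deriv (by
        simp [blockE, toEuclideanCLM_apply, rot_apply, crit, lastMode, eLast]))
      (fun θ i => (H (tildeC 2 i) θ).congr_deriv (by
        simp [blockE, toEuclideanCLM_apply, rot_apply, crit, lastMode, eLast]))
  have tilde2 : ∀ θ, (y θ 3).2.1 = 0 ∧ (y θ 4).2.1 = 0 :=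
    periodic_hyperbolic_eq_zero hA (s := 2 * om) (per 3) (per 4)
      (fun θ i => (H (tildeC 3 i) θ).congr_deriv (by
        simp [blockE, toEuclideanCLM_apply, rot_apply, crit, lastMode, eLast]; ring))
      (fun θ i => (H (tildeC 4 i) θ).congr_deriv (by
        simp [blockE, toEuclideanCLM_apply, rot_apply, crit, lastMode, eLast]; ring))
  have tilde3 : ∀ θ, (y θ 5).2.1 = 0 ∧ (y θ 6).2.1 = 0 :=
    periodic_hyperbolic_eq_zero hA (s := 3 * om) (per 5) (per 6)
      (fun θ i => (H (tildeC 5 i) θ).congr_deriv (by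
        simp [blockE, toEuclideanCLM_apply, rot_apply, crit, lastMode, eLast]; ring))
      (fun θ i => (H (tildeC 6 i) θ).congr_deriv (by
        simp [blockE, toEuclideanCLM_apply, rot_apply, crit, lastMode, eLast]; ring))
  -- the critical components of the first mode
  have ha₀ : ∀ θ, HasDerivAt (fun s => hatC 1 0 (y s)) (-om * hatC 1 1 (y θ) -
      om * hatC 2 0 (y θ) + p * ν.1) θ := fun θ => (H (hatC 1 0) θ).congr_deriv (by
    simp [blockE, conf_apply, rot_apply, crit, lastMode, eLast])
  have ha₁ : ∀ θ, HasDerivAt (fun s => hatC 1 1 (y s)) (om * hatC 1 0 (y θ) -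
      om * hatC 2 1 (y θ) + (q * ν.1 - ν.2.1)) θ := fun θ => (H (hatC 1 1) θ).congr_deriv (by
    simp [blockE, conf_apply, rot_apply, crit, lastMode, eLast])
  have hb₀ : ∀ θ, HasDerivAt (fun s => hatC 2 0 (y s)) (-om * hatC 2 1 (y θ) +
      om * hatC 1 0 (y θ) + -(q * ν.1 - ν.2.1)) θ := fun θ => (H (hatC 2 0) θ).congr_deriv (by
    simp [blockE, conf_apply, rot_apply, crit, lastMode, eLast])
  have hb₁ : ∀ θ, HasDerivAt (fun s => hatC 2 1 (y s)) (om * hatC 2 0 (y θ) +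
      om * hatC 1 1 (y θ) + p * ν.1) θ := fun θ => (H (hatC 2 1) θ).congr_deriv (by
    simp [blockE, conf_apply, rot_apply, crit, lastMode, eLast])
  -- This combination has frequency 2ω, and the parameter forcing, along a and a', cancels in it.
  have hplus : ∀ θ, ((hatC 1 0 (y θ) : ℂ) + Complex.I * hatC 2 0 (y θ)) + (1 : ℝ) * Complex.I *
      (hatC 1 1 (y θ) + Complex.I * hatC 2 1 (y θ)) = 0 := by
    refine periodic_eq_zero_of_hasDerivAt (z := fun θ => ((hatC 1 0 (y θ) : ℂ) +
      Complex.I * hatC 2 0 (y θ)) + (1 : ℝ) * Complex.I * (hatC 1 1 (y θ) +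
      Complex.I * hatC 2 1 (y θ))) (μ := Complex.I * ((om + 1 * om : ℝ) : ℂ))
      (fun θ => by simp only [hper θ]) (fun θ => ?_)
      (exp_two_pi_mul_I_ne_one (σ := om + 1 * om) fun n h => r2 n (by linarith))
    have := hasDerivAt_critical (a₀ := fun s => hatC 1 0 (y s))
        (a₁ := fun s => hatC 1 1 (y s)) (b₀ := fun s => hatC 2 0 (y s))
        (b₁ := fun s => hatC 2 1 (y s)) (om := om) (s := om) (c := 0) (p * ν.1) (q * ν.1 - ν.2.1) (-(q * ν.1 - ν.2.1)) (p * ν.1)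
      (f := 1) (Or.inl rfl) (by push_cast; linear_combination (-(p * ν.1 : ℂ)) * Complex.I_mul_I)
      (ha₀ θ) (ha₁ θ) (hb₀ θ) (hb₁ θ)
    rwa [add_zero] at this
  -- The resonant combination. Periodicity makes its constant forcing vanish: the real part gives `p
  -- * ν.1 = 0`, hence `ν.1 = 0` by transversality, and then the imaginary part gives `ν.2.1 = 0`.
  have hminus := periodic_const_deriv (z := fun θ => ((hatC 1 0 (y θ) : ℂ) +
      Complex.I * hatC 2 0 (y θ)) + ((-1 : ℝ) : ℂ) * Complex.I * (hatC 1 1 (y θ) +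
      Complex.I * hatC 2 1 (y θ))) (c := 2 * ((p * ν.1 : ℝ) - (q * ν.1 - ν.2.1 : ℝ) * Complex.I))
      (fun θ => by simp only [hper θ]) (fun θ => by
      have := hasDerivAt_critical (a₀ := fun s => hatC 1 0 (y s))
        (a₁ := fun s => hatC 1 1 (y s)) (b₀ := fun s => hatC 2 0 (y s))
        (b₁ := fun s => hatC 2 1 (y s)) (om := om) (s := om) (c := 2 * ((p * ν.1 : ℝ) - (q * ν.1 - ν.2.1 : ℝ) * Complex.I))
        (p * ν.1) (q * ν.1 - ν.2.1) (-(q * ν.1 - ν.2.1)) (p * ν.1)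
        (f := -1) (Or.inr rfl)
        (by push_cast; linear_combination ((p * ν.1 : ℂ)) * Complex.I_mul_I)
        (ha₀ θ) (ha₁ θ) (hb₀ θ) (hb₁ θ)
      refine this.congr_deriv ?_
      push_cast
      ring)
  have hν1 : ν.1 = 0 := by
    have := congrArg Complex.re hminus.1
    simpa [hp] using this
  have hν2 : ν.2.1 = 0 := by
    have := congrArg Complex.im hminus.1
    simpa [hν1] using this
  -- the amplitude and phase conditions
  have hint : ∀ (L : (Fin 7 → Floq k) →L[ℝ] ℝ), (∀ θ, L (y θ) = L (y 0)) →
      L (∫ s in (0 : ℝ)..2 * Real.pi, y s) = 0 → ∀ θ, L (y θ) = 0 := by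
    intro L hL hz θ
    rw [← L.intervalIntegral_comp_comm (hyc.intervalIntegrable _ _)] at hz
    simp_rw [hL] at hz
    rw [hL]
    simpa [Real.pi_ne_zero] using hz
  -- The real part of the resonant combination is exactly the quantity in the amplitude condition,
  -- and its imaginary part is minus the one in the phase condition. Being constant with zero
  -- integral, both vanish.
  have hc1 : ∀ θ, (y θ 1).1 0 + (y θ 2).1 1 = 0 := by
    refine hint (hatC 1 0 + hatC 2 1) (fun θ => ?_) (congrArg Prod.fst hl)
    have := congrArg Complex.re (hminus.2 θ)
    simpa using this
  have hc2 : ∀ θ, (y θ 1).1 1 - (y θ 2).1 0 = 0 := by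
    refine hint (hatC 1 1 - hatC 2 0) (fun θ => ?_) (congrArg (fun w => w.2.1) hl)
    have := congrArg Complex.im (hminus.2 θ)
    simp at this
    simp
    linarith
  have hc3 : ∀ θ, (y θ 0).2.2 = 0 :=
    hint (ringC 0) ring0.2 (congrArg (fun w => w.2.2) hl)
  have hat1 : ∀ θ, (y θ 1).1 = 0 ∧ (y θ 2).1 = 0 := by
    intro θ
    have e1 := congrArg Complex.re (hplus θ)
    have e2 := congrArg Complex.im (hplus θ)
    have e3 := hc1 θ
    have e4 := hc2 θ
    simp at e1 e2
    constructor <;> ext i <;> fin_cases i <;> simp <;> linarith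
  refine ⟨fun θ => ?_, Prod.ext hν1 (Prod.ext hν2 ring0.1)⟩
  funext j
  fin_cases j
  · exact Prod.ext (hat0 θ) (Prod.ext (tilde0 θ) (hc3 θ))
  · exact Prod.ext (hat1 θ).1 (Prod.ext (tilde1 θ).1 (ring1 θ).1)
  · exact Prod.ext (hat1 θ).2 (Prod.ext (tilde1 θ).2 (ring1 θ).2)
  · exact Prod.ext (hat2 θ).1 (Prod.ext (tilde2 θ).1 (ring2 θ).1)
  · exact Prod.ext (hat2 θ).2 (Prod.ext (tilde2 θ).2 (ring2 θ).2)
  · exact Prod.ext (hat3 θ).1 (Prod.ext (tilde3 θ).1 (ring3 θ).1)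
  · exact Prod.ext (hat3 θ).2 (Prod.ext (tilde3 θ).2 (ring3 θ).2)

end LinearisedTorus

end NeimarkSacker

namespace NeimarkSacker

/-! ### Global expansion of the Crandall–Rabinowitz map -/

section Expansion

variable {K : Type} [NormedAddCommGroup K] [NormedSpace ℝ K]

/-- The coefficients of the expansion
`E z + ε B(z, z) + ε² C(ε z)(z, z, z) - ε η Q z` of the Crandall–Rabinowitz map. -/
structure Expansion (K : Type) [NormedAddCommGroup K] [NormedSpace ℝ K] where
  E : ℝ → K →L[ℝ] K
  Q : ℝ → ℝ → K →L[ℝ] K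
  B : ℝ → ℝ → K →L[ℝ] K →L[ℝ] K
  C : ℝ → ℝ → K → K →L[ℝ] K →L[ℝ] K →L[ℝ] K
  smooth_E : ContDiff ℝ ∞ E
  smooth_Q : ContDiff ℝ ∞ (fun p : ℝ × ℝ => Q p.1 p.2)
  smooth_B : ContDiff ℝ ∞ (fun p : ℝ × ℝ => B p.1 p.2)
  smooth_C : ContDiff ℝ ∞ (fun p : (ℝ × ℝ) × K => C p.1.1 p.1.2 p.2)
  periodic_Q : ∀ θ lam, Q (θ + 2 * Real.pi) lam = Q θ lam
  periodic_B : ∀ θ lam, B (θ + 2 * Real.pi) lam = B θ lam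
  periodic_C : ∀ θ lam x, C (θ + 2 * Real.pi) lam x = C θ lam x

/-- The expanded Crandall–Rabinowitz map. -/
noncomputable def Expansion.G (m : Expansion K) (z : K) (lam η θ ε : ℝ) : K :=
  m.E lam z + ε • m.B θ lam z z + ε ^ 2 • m.C θ lam (ε • z) z z z - (ε * η) • m.Q θ lam z

/-- Three successive Hadamard quotients in `x`. The first at 0 is the derivative `E`, the second at
0 is the quadratic coefficient, and the third is kept at `x`, which makes the formula exact rather
than asymptotic. -/
theorem exists_expansion_of_contDiff [CompleteSpace K] {H : ℝ × ℝ → K → K} {E : ℝ → K →L[ℝ] K}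
    {Q : ℝ → ℝ → K →L[ℝ] K} (hH : ContDiff ℝ ∞ (fun q : (ℝ × ℝ) × K => H q.1 q.2))
    (hE : ContDiff ℝ ∞ E) (hQ : ContDiff ℝ ∞ (fun p : ℝ × ℝ => Q p.1 p.2))
    (hQp : ∀ θ lam, Q (θ + 2 * Real.pi) lam = Q θ lam)
    (hper : ∀ θ lam, H (θ + 2 * Real.pi, lam) = H (θ, lam)) (hH0 : ∀ p, H p 0 = 0)
    (hDH : ∀ p, fderiv ℝ (H p) 0 = E p.2) :
    ∃ m : Expansion K, m.E = E ∧ m.Q = Q ∧ ∀ θ lam x,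
      H (θ, lam) x = m.E lam x + m.B θ lam x x + m.C θ lam x x x x := by
  have hsl : ∀ {W : Type} [NormedAddCommGroup W] [NormedSpace ℝ W] {f : ℝ × ℝ → K → W},
      ContDiff ℝ ∞ (fun q : (ℝ × ℝ) × K => f q.1 q.2) → ∀ p, ContDiff ℝ 1 (f p) :=
    fun hf p => (hf.comp (contDiff_const.prodMk contDiff_id)).of_le (by simp)
  have hH1 := contDiff_infty_hquot hH
  have hH2 := contDiff_infty_hquot hH1
  have hH3 := contDiff_infty_hquot hH2
  have hqper : ∀ {W : Type} [NormedAddCommGroup W] [NormedSpace ℝ W] {f : ℝ × ℝ → K → W},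
      (∀ θ lam, f (θ + 2 * Real.pi, lam) = f (θ, lam)) →
      ∀ θ lam, hquot f (θ + 2 * Real.pi, lam) = hquot f (θ, lam) := by
    intro W _ _ f hf θ lam
    funext x
    simp only [hquot, hf]
  refine ⟨{ E := E
            Q := Q
            B := fun θ lam => hquot (hquot H) (θ, lam) 0
            C := fun θ lam x => hquot (hquot (hquot H)) (θ, lam) x
            smooth_E := hE
            smooth_Q := hQ
            smooth_B := hH2.comp (contDiff_id.prodMk contDiff_const)
            smooth_C := hH3
            periodic_Q := hQp
            periodic_B := fun θ lam => congrFun (hqper (hqper hper) θ lam) 0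
            periodic_C := fun θ lam x => congrFun (hqper (hqper (hqper hper)) θ lam) x },
    rfl, rfl, fun θ lam x => ?_⟩
  rw [eq_add_hquot (hsl hH _) x, hH0, zero_add, eq_add_hquot (hsl hH1 _) x, hquot_zero, hDH,
    eq_add_hquot (hsl hH2 _) x]
  simp only [add_apply]
  rw [add_assoc]

end Expansion

/-! ### Smoothness of the data and expansion of G near λ* -/

section CrandallRabinowitz

variable {k : ℕ}

theorem contDiff_conf : ContDiff ℝ ∞ (fun p : ℝ × ℝ => conf p.1 p.2) := by
  have : ∀ a b : ℝ, conf a b = a • conf 1 0 + b • conf 0 1 := fun a b => by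
    ext x i
    fin_cases i <;> simp [conf_apply] <;> ring
  rw [show (fun p : ℝ × ℝ => conf p.1 p.2) = fun p => p.1 • conf 1 0 + p.2 • conf 0 1 from
    funext fun p => this p.1 p.2]
  exact (contDiff_fst.smul contDiff_const).add (contDiff_snd.smul contDiff_const)

theorem contDiff_toEuclideanCLM {X : Type} [NormedAddCommGroup X] [NormedSpace ℝ X]
    {A : X → Matrix (Fin k) (Fin k) ℝ} (hA : ∀ i j, ContDiff ℝ ∞ (fun x => A x i j)) :
    ContDiff ℝ ∞ (fun x => Matrix.toEuclideanCLM (𝕜 := ℝ) (A x)) := by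
  have : ∀ x, Matrix.toEuclideanCLM (𝕜 := ℝ) (A x) = ∑ i, ∑ j, A x i j •
      Matrix.toEuclideanCLM (𝕜 := ℝ) (Matrix.single i j (1 : ℝ)) := fun x => by
    have h : A x = ∑ i, ∑ j, A x i j • Matrix.single i j (1 : ℝ) := by
      refine (Matrix.matrix_eq_sum_single (A x)).trans ?_
      refine Finset.sum_congr rfl fun i _ => Finset.sum_congr rfl fun j _ => ?_
      rw [Matrix.smul_single, smul_eq_mul, mul_one]
    refine (congrArg _ h).trans ?_
    rw [map_sum]
    refine Finset.sum_congr rfl fun i _ => ?_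
    rw [map_sum]
    exact Finset.sum_congr rfl fun j _ => map_smul _ _ _
  rw [funext this]
  exact ContDiff.sum fun i _ => ContDiff.sum fun j _ => (hA i j).smul contDiff_const

theorem contDiff_inverse {X E F : Type} [NormedAddCommGroup X] [NormedSpace ℝ X]
    [NormedAddCommGroup E] [NormedSpace ℝ E] [CompleteSpace E] [NormedAddCommGroup F]
    [NormedSpace ℝ F] {A : X → E →L[ℝ] F} (hA : ContDiff ℝ ∞ A) (h : ∀ x, (A x).IsInvertible) :
    ContDiff ℝ ∞ (fun x => (A x).inverse) := by
  rw [contDiff_iff_contDiffAt]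
  intro x
  obtain ⟨e, he⟩ := h x
  have := contDiffAt_map_inverse (𝕜 := ℝ) (n := ∞) e
  rw [he] at this
  exact this.comp x hA.contDiffAt

set_option maxHeartbeats 1000000 in
/-- The Crandall–Rabinowitz map has a globally smooth expansion near the critical parameter. -/
theorem Family.IsNSPoint.exists_expansion {S : Family k} {Λ : Set ℝ} {lamS omS : ℝ}
    (hS : S.IsNSPoint Λ lamS omS) : ∃ (m : Expansion (Floq k)) (δ : ℝ), 0 < δ ∧
      (∀ lam, |lam - lamS| < δ → lam ∈ Λ ∧ m.E lam = S.E lam) ∧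
      ∀ z lam η θ ε, |lam - lamS| < δ → ε ≠ 0 → S.G z lam η θ ε = m.G z lam η θ ε := by
  obtain ⟨r, hr, hrΛ⟩ := Metric.isOpen_iff.1 hS.isOpen lamS hS.mem
  obtain ⟨χ, hχ, hχr, δ, hδ, hχδ⟩ := exists_cutoff hr
  -- A smooth reparametrisation with values in Λ, equal to the identity near λ*; it makes all data
  -- defined and smooth for every real parameter.
  let l : ℝ → ℝ := fun lam => lamS + χ (lam - lamS)
  have hl : ContDiff ℝ ∞ l := contDiff_const.add (hχ.comp (contDiff_id.sub contDiff_const))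
  have hlΛ : ∀ lam, l lam ∈ Λ := fun lam => hrΛ (by
    simpa [l, Real.dist_eq] using hχr (lam - lamS))
  have hlδ : ∀ lam, |lam - lamS| < δ → l lam = lam := fun lam h => by simp [l, hχδ _ h]
  have hl2 : ContDiff ℝ ∞ (fun p : ℝ × ℝ => (p.1, l p.2)) :=
    contDiff_fst.prodMk (hl.comp contDiff_snd)
  have hmem2 : ∀ p : ℝ × ℝ, (p.1, l p.2) ∈ (univ ×ˢ Λ : Set (ℝ × ℝ)) := fun p =>
    ⟨mem_univ _, hlΛ _⟩
  have hv : ContDiff ℝ ∞ (fun p : ℝ × ℝ => S.v p.1 (l p.2)) :=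
    hS.smooth_v.comp_contDiff hl2 hmem2
  have hP : ContDiff ℝ ∞ (fun p : ℝ × ℝ => S.P p.1 (l p.2)) :=
    hS.smooth_P.comp_contDiff hl2 hmem2
  have hPinv : ContDiff ℝ ∞ (fun p : ℝ × ℝ => (S.P p.1 (l p.2)).inverse) :=
    contDiff_inverse hP fun p => hS.invertible_P _ (hlΛ _) _
  have hT : ContDiff ℝ ∞ (fun p : ℝ × ℝ => S.T (l p.2)) :=
    (hS.smooth_T.comp_contDiff hl hlΛ).comp contDiff_snd
  have hE : ContDiff ℝ ∞ (fun lam => S.E (l lam)) := by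
    have h1 : ∀ lam, S.E (l lam) = (ContinuousLinearMap.inl ℝ _ _).comp
        ((conf (S.αR (l lam)) (S.αI (l lam))).comp (ContinuousLinearMap.fst ℝ _ _)) +
        (ContinuousLinearMap.inr ℝ _ _).comp ((ContinuousLinearMap.inl ℝ _ _).comp
          ((Matrix.toEuclideanCLM (𝕜 := ℝ) (S.Et (l lam))).comp
          ((ContinuousLinearMap.fst ℝ _ _).comp (ContinuousLinearMap.snd ℝ _ _)))) := fun lam => by
      apply ContinuousLinearMap.ext
      intro z
      simp [Family.E, Prod.map]
    simp_rw [h1]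
    have hc := contDiff_conf.comp
      ((hS.smooth_αR.comp_contDiff hl hlΛ).prodMk (hS.smooth_αI.comp_contDiff hl hlΛ))
    have ht := contDiff_toEuclideanCLM fun i j => (hS.smooth_Et i j).comp_contDiff hl hlΛ
    exact (contDiff_const.clm_comp (hc.clm_comp contDiff_const)).add
      (contDiff_const.clm_comp (contDiff_const.clm_comp (ht.clm_comp contDiff_const)))
  have hF : ∀ {X : Type} [NormedAddCommGroup X] [NormedSpace ℝ X] {a : X → State k} {b : X → ℝ},
      ContDiff ℝ ∞ a → ContDiff ℝ ∞ b → ContDiff ℝ ∞ (fun x => S.F (a x) (b x)) :=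
    fun ha hb => hS.smooth_F.comp (ha.prodMk hb)
  have hDF : ContDiff ℝ ∞ (fun p : ℝ × ℝ =>
      fderiv ℝ (fun x => S.F x (l p.2)) (S.v p.1 (l p.2))) := by
    have h : ContDiff ℝ ∞ (Function.uncurry (fun (p : ℝ × ℝ) (x : State k) => S.F x (l p.2))) :=
      hF contDiff_snd (hl.comp (contDiff_snd.comp contDiff_fst))
    exact ContDiff.fderiv h hv (by simp)
  -- The right-hand side of the Floquet equation stands in for ∂P/∂θ and is visibly smooth in both
  -- variables. Subtracting it makes the derivative of `H` at 0 equal to P⁻¹(T J P − ∂P/∂θ) = E.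
  let dP : ℝ × ℝ → Floq k →L[ℝ] State k := fun p =>
    S.T (l p.2) • (fderiv ℝ (fun x => S.F x (l p.2)) (S.v p.1 (l p.2))).comp (S.P p.1 (l p.2)) -
      (S.P p.1 (l p.2)).comp (S.E (l p.2))
  have hdP : ContDiff ℝ ∞ dP :=
    (hT.smul (hDF.clm_comp hP)).sub (hP.clm_comp (hE.comp contDiff_snd))
  let H : ℝ × ℝ → Floq k → Floq k := fun p x => (S.P p.1 (l p.2)).inverse
    (S.T (l p.2) • S.F (S.v p.1 (l p.2) + S.P p.1 (l p.2) x) (l p.2)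
      - S.T (l p.2) • S.F (S.v p.1 (l p.2)) (l p.2) - dP p x)
  have hH : ContDiff ℝ ∞ (fun q : (ℝ × ℝ) × Floq k => H q.1 q.2) := by
    have h1 : ContDiff ℝ ∞ (fun q : (ℝ × ℝ) × Floq k => q.1) := contDiff_fst
    have hlq : ContDiff ℝ ∞ (fun q : (ℝ × ℝ) × Floq k => l q.1.2) :=
      hl.comp (contDiff_snd.comp h1)
    refine (hPinv.comp h1).clm_apply ((((hT.comp h1).smul (hF ((hv.comp h1).add
      ((hP.comp h1).clm_apply contDiff_snd)) hlq)).sub ((hT.comp h1).smul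
      (hF (hv.comp h1) hlq))).sub ((hdP.comp h1).clm_apply contDiff_snd))
  have hper : ∀ θ lam, H (θ + 2 * Real.pi, lam) = H (θ, lam) := fun θ lam => by
    simp only [H, dP, hS.periodic_v _ (hlΛ lam), hS.periodic_P _ (hlΛ lam)]
  have hinv : ∀ (p : ℝ × ℝ) (L : Floq k →L[ℝ] Floq k),
      (S.P p.1 (l p.2)).inverse.comp ((S.P p.1 (l p.2)).comp L) = L := by
    intro p L
    rw [← ContinuousLinearMap.comp_assoc,
      (hS.invertible_P _ (hlΛ p.2) p.1).inverse_comp_self, ContinuousLinearMap.id_comp]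
  have hH0 : ∀ p, H p 0 = 0 := fun p => by simp [H]
  have hDH : ∀ p, fderiv ℝ (H p) 0 = S.E (l p.2) := by
    intro p
    have hFx : HasFDerivAt (fun x => S.F x (l p.2))
        (fderiv ℝ (fun x => S.F x (l p.2)) (S.v p.1 (l p.2)))
        (S.v p.1 (l p.2) + S.P p.1 (l p.2) 0) := by
      rw [map_zero, add_zero]
      have : ContDiff ℝ ∞ (fun x => S.F x (l p.2)) := hF contDiff_id contDiff_const
      exact (this.differentiable (by simp) _).hasFDerivAt
    have h1 := hFx.comp (0 : Floq k) ((S.P p.1 (l p.2)).hasFDerivAt.const_add (S.v p.1 (l p.2)))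
    have h2 := (S.P p.1 (l p.2)).inverse.hasFDerivAt.comp (0 : Floq k)
      (((h1.const_smul (S.T (l p.2))).sub_const
        (S.T (l p.2) • S.F (S.v p.1 (l p.2)) (l p.2))).sub (dP p).hasFDerivAt)
    have h3 : HasFDerivAt (H p) _ 0 := h2
    rw [h3.fderiv]
    simp only [dP, sub_sub_cancel]
    exact hinv p _
  obtain ⟨m, hmE, hmQ, hx⟩ := exists_expansion_of_contDiff
    (Q := fun θ lam => (S.P θ (l lam)).inverse.comp (dP (θ, lam))) hH hE (hPinv.clm_comp hdP)
    (fun θ lam => by simp only [dP, hS.periodic_v _ (hlΛ lam), hS.periodic_P _ (hlΛ lam)])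
    hper hH0 hDH
  refine ⟨m, δ, hδ, fun lam h => ⟨?_, ?_⟩, fun z lam η θ ε hlam hε => ?_⟩
  · rw [← hlδ lam h]; exact hlΛ lam
  · simp only [hmE, hlδ lam h]
  · have hΛ : lam ∈ Λ := by rw [← hlδ lam hlam]; exact hlΛ lam
    have hd : deriv (fun s => S.P s lam) θ = dP (θ, lam) := by
      rw [(hS.floquet lam hΛ θ).deriv]
      simp only [dP, hlδ lam hlam]
    -- The factor 1 + εη splits: its constant part belongs to `H` and its εη part gives Q = P⁻¹
    -- ∂P/∂θ. Dividing by ε then lowers every power of ε by one.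
    have h1 : S.G z lam η θ ε = ε⁻¹ • (H (θ, lam) (ε • z) - (ε ^ 2 * η) • m.Q θ lam z) := by
      simp only [Family.G, hd, H, hmQ, hlδ lam hlam, ContinuousLinearMap.comp_apply]
      simp only [map_sub, map_smul, smul_sub]
      module
    rw [h1, hx, Expansion.G]
    simp only [map_smul, smul_apply]
    rw [smul_sub, smul_add, smul_add]
    simp only [smul_smul]
    rw [inv_mul_cancel₀ hε, one_smul, show ε⁻¹ * (ε * ε) = ε by field_simp,
      show ε⁻¹ * (ε * (ε * ε)) = ε ^ 2 by field_simp, show ε⁻¹ * (ε ^ 2 * η) = ε * η by field_simp]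

end CrandallRabinowitz

end NeimarkSacker

namespace NeimarkSacker

/-! ### The torus equations as an ordinary differential equation for Fourier coefficients -/

section Modes

variable {k : ℕ}

/-- The Fourier coefficients of `z(θ, ·)`. -/
abbrev Modes (k : ℕ) := Fin 7 → Floq k

theorem Expansion.contDiff_G {K X : Type} [NormedAddCommGroup K] [NormedSpace ℝ K]
    [NormedAddCommGroup X] [NormedSpace ℝ X] (m : Expansion K) {n : WithTop ℕ∞} (hn : n ≤ ∞)
    {z : X → K} {lam η θ ε : X → ℝ} (hz : ContDiff ℝ n z) (hlam : ContDiff ℝ n lam)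
    (hη : ContDiff ℝ n η) (hθ : ContDiff ℝ n θ) (hε : ContDiff ℝ n ε) :
    ContDiff ℝ n (fun x => m.G (z x) (lam x) (η x) (θ x) (ε x)) := by
  have hE := (m.smooth_E.of_le hn).comp hlam
  have hB := (m.smooth_B.of_le hn).comp (hθ.prodMk hlam)
  have hQ := (m.smooth_Q.of_le hn).comp (hθ.prodMk hlam)
  have hC := (m.smooth_C.of_le hn).comp ((hθ.prodMk hlam).prodMk (hε.smul hz))
  exact (((hE.clm_apply hz).add (hε.smul ((hB.clm_apply hz).clm_apply hz))).add
    ((hε.pow 2).smul (((hC.clm_apply hz).clm_apply hz).clm_apply hz))).sub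
    ((hε.mul hη).smul (hQ.clm_apply hz))

theorem contDiff_infty_coef {X : Type} [NormedAddCommGroup X] [NormedSpace ℝ X]
    {f : X → ℝ → Floq k} (hf : ContDiff ℝ ∞ (fun p : X × ℝ => f p.1 p.2)) :
    ContDiff ℝ ∞ (fun x => coef (f x)) :=
  contDiff_pi.2 fun j => contDiff_const.smul (f := fun _ => trigW j) (contDiff_infty_intervalIntegral
    (f := fun x φ => trigB j φ • f x φ) _ _ (((contDiff_trigB j).comp contDiff_snd).smul hf))

theorem contDiff_one_coef {X : Type} [NormedAddCommGroup X] [NormedSpace ℝ X]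
    {f : X → ℝ → Floq k} (hf : ContDiff ℝ 1 (fun p : X × ℝ => f p.1 p.2)) :
    ContDiff ℝ 1 (fun x => coef (f x)) :=
  contDiff_pi.2 fun j => contDiff_const.smul (f := fun _ => trigW j) (contDiff_intervalIntegral 1
    (f := fun x φ => trigB j φ • f x φ) _ _
    ((((contDiff_trigB j).of_le (by simp)).comp contDiff_snd).smul hf))

/-- The right-hand side of the ordinary differential equation for the Fourier coefficients, before
division by `1 + ε η`. -/
noncomputable def Expansion.field (m : Expansion (Floq k)) (θ : ℝ) (c : Modes k) (ν : Param)
    (ε : ℝ) : Modes k :=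
  coef (fun φ => m.G (ev φ c) ν.1 ν.2.2 θ ε) - ν.2.2 • lastMode k - ν.2.1 • rot c

theorem Expansion.contDiff_field {X : Type} [NormedAddCommGroup X] [NormedSpace ℝ X]
    (m : Expansion (Floq k)) {θ ε : X → ℝ} {c : X → Modes k} {ν : X → Param}
    (hθ : ContDiff ℝ ∞ θ) (hc : ContDiff ℝ ∞ c) (hν : ContDiff ℝ ∞ ν) (hε : ContDiff ℝ ∞ ε) :
    ContDiff ℝ ∞ (fun x => m.field (θ x) (c x) (ν x) (ε x)) := by
  have h1 : ContDiff ℝ ∞ (fun p : X × ℝ => p.1) := contDiff_fst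
  have h2 : ContDiff ℝ ∞ (fun p : X × ℝ => p.2) := contDiff_snd
  have hη : ContDiff ℝ ∞ (fun x => (ν x).2.2) := hν.snd.snd
  exact ((contDiff_infty_coef
    (f := fun x φ => m.G (ev φ (c x)) (ν x).1 (ν x).2.2 (θ x) (ε x)) (m.contDiff_G le_rfl (((contDiff_ev (W := Floq k)).comp h2).clm_apply
    (hc.comp h1)) (hν.fst.comp h1) (hη.comp h1) (hθ.comp h1) (hε.comp h1))).sub
    (hη.smul contDiff_const)).sub (hν.snd.fst.smul ((rot (W := Floq k)).contDiff.comp hc))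

theorem Expansion.field_zero (m : Expansion (Floq k)) (θ : ℝ) (c : Modes k) (ν : Param) :
    m.field θ c ν 0 = mapCoef (m.E ν.1) c - ν.2.2 • lastMode k - ν.2.1 • rot c := by
  have : ∀ φ, m.G (ev φ c) ν.1 ν.2.2 θ 0 = ev φ (mapCoef (m.E ν.1) c) := fun φ => by
    simp [Expansion.G, ev_mapCoef]
  simp only [Expansion.field, this, coef_ev]

theorem Expansion.field_periodic (m : Expansion (Floq k)) (θ : ℝ) (c : Modes k) (ν : Param)
    (ε : ℝ) : m.field (θ + 2 * Real.pi) c ν ε = m.field θ c ν ε := by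
  simp only [Expansion.field, Expansion.G, m.periodic_B, m.periodic_C, m.periodic_Q]

/-- The ordinary differential equation for the Fourier coefficients. -/
noncomputable def Expansion.torusFam (m : Expansion (Floq k)) {χ : ℝ → ℝ} (hχ : ContDiff ℝ ∞ χ)
    (hχ1 : ∀ x, |χ x| < 1) : PerFam (Modes k × Param × ℝ) (Modes k) where
  -- The cutoff keeps the denominator positive for all arguments; it equals 1 + εη as long as εη is
  -- small.
  toFun θ q := (1 + χ (q.2.2 * q.2.1.2.2))⁻¹ • m.field θ q.1 q.2.1 q.2.2
  smooth := by
    have hq : ContDiff ℝ ∞ (fun p : ℝ × (Modes k × Param × ℝ) => p.2) := contDiff_snd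
    refine ContDiff.smul (ContDiff.inv (contDiff_const.add (hχ.comp
      (hq.snd.snd.mul hq.snd.fst.snd.snd))) fun p => ?_)
      (m.contDiff_field contDiff_fst hq.fst hq.snd.fst hq.snd.snd)
    have := abs_lt.1 (hχ1 (p.2.2.2 * p.2.2.1.2.2))
    simp only [Function.comp_apply]
    linarith
  periodic θ q := by simp only [m.field_periodic]

/-- The critical block is α_R times the identity plus α_I times the quarter turn, and the quarter
turn takes a(φ) to a'(φ). Differentiating in λ thus produces the two speeds of the exponents as
coefficients of a and a'. -/
theorem Family.E_crit (S : Family k) (lam : ℝ) (j : Fin 7) :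
    S.E lam (crit k j) = S.αR lam • crit k j + S.αI lam • rot (crit k) j := by
  rw [rot_apply]
  fin_cases j <;> refine Prod.ext ?_ (Prod.ext (by simp [Family.E, crit]) (by simp [Family.E, crit])) <;> ext i <;> fin_cases i <;>
    simp [Family.E, crit, conf_apply]

theorem Family.IsNSPoint.E_eq {S : Family k} {Λ : Set ℝ} {lamS omS : ℝ}
    (hS : S.IsNSPoint Λ lamS omS) : S.E lamS = blockE omS (S.Et lamS) := by
  simp only [Family.E, blockE, hS.αR_crit, hS.αI_crit]

theorem Family.IsNSPoint.deriv_E_crit {S : Family k} {Λ : Set ℝ} {lamS omS : ℝ}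
    (hS : S.IsNSPoint Λ lamS omS) {m : Expansion (Floq k)}
    (hE : ∀ᶠ lam in 𝓝 lamS, m.E lam = S.E lam) (j : Fin 7) :
    deriv m.E lamS (crit k j) = deriv S.αR lamS • crit k j + deriv S.αI lamS • rot (crit k) j := by
  have hΛ := hS.isOpen.mem_nhds hS.mem
  have hR := ((hS.smooth_αR.contDiffAt hΛ).differentiableAt (by simp)).hasDerivAt
  have hI := ((hS.smooth_αI.contDiffAt hΛ).differentiableAt (by simp)).hasDerivAt
  have h1 : HasDerivAt (fun lam => m.E lam (crit k j)) (deriv m.E lamS (crit k j)) lamS := by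
    have := ((m.smooth_E.differentiable (by simp) lamS).hasDerivAt).clm_apply
      (hasDerivAt_const lamS (crit k j))
    simpa using this
  have h2 := (hR.smul_const (crit k j)).add (hI.smul_const (rot (crit k) j))
  refine h1.unique (h2.congr_of_eventuallyEq ?_)
  filter_upwards [hE] with lam h
  rw [h, S.E_crit]
  rfl

theorem Family.IsNSPoint.mapCoef_crit {S : Family k} {Λ : Set ℝ} {lamS omS : ℝ}
    (hS : S.IsNSPoint Λ lamS omS) : mapCoef (S.E lamS) (crit k) = omS • rot (crit k) := by
  funext j
  rw [mapCoef_apply, S.E_crit, hS.αR_crit, hS.αI_crit, zero_smul, zero_add]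
  rfl

/-- The derivative is taken along a line with ε = 0, on which the field has the explicit form of
`field_zero` and the denominator is 1. The ε direction is not needed, since `bvpMap` treats ε
separately. -/
theorem Family.IsNSPoint.torusFam_fderiv {S : Family k} {Λ : Set ℝ} {lamS omS : ℝ}
    (hS : S.IsNSPoint Λ lamS omS) {m : Expansion (Floq k)}
    (hE : ∀ᶠ lam in 𝓝 lamS, m.E lam = S.E lam) {χ : ℝ → ℝ} (hχ : ContDiff ℝ ∞ χ)
    (hχ1 : ∀ x, |χ x| < 1) (hχ0 : χ 0 = 0) (θ : ℝ) (h : Modes k) (ν : Param) :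
    fderiv ℝ ((m.torusFam hχ hχ1).toFun θ) (crit k, (lamS, omS, 0), 0) (h, ν, 0) =
      linA omS (S.Et lamS) h + linC k (deriv S.αR lamS) (deriv S.αI lamS) ν := by
  set f := (m.torusFam hχ hχ1).toFun θ
  have hf : ContDiff ℝ ∞ f :=
    (m.torusFam hχ hχ1).smooth.comp (contDiff_const.prodMk contDiff_id)
  let γ : ℝ → Modes k × Param × ℝ := fun t =>
    (crit k, (lamS, omS, 0), 0) + t • (h, ν, 0)
  have hγ : HasDerivAt γ (h, ν, 0) 0 := by
    have := ((hasDerivAt_id (0 : ℝ)).smul_const ((h, ν, 0) : Modes k × Param × ℝ)).const_add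
      ((crit k, (lamS, omS, 0), 0) : Modes k × Param × ℝ)
    rw [one_smul] at this
    exact this
  have hγ0 : γ 0 = (crit k, (lamS, omS, 0), 0) := by simp [γ]
  have h1 : HasDerivAt (f ∘ γ) (fderiv ℝ f (crit k, (lamS, omS, 0), 0) (h, ν, 0)) 0 := by
    refine HasFDerivAt.comp_hasDerivAt 0 ?_ hγ
    rw [hγ0]
    exact (hf.differentiable (by simp) _).hasFDerivAt
  have hc : HasDerivAt (fun t : ℝ => crit k + t • h) h 0 := by
    simpa using ((hasDerivAt_id (0 : ℝ)).smul_const h).const_add (crit k)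
  have hs : ∀ a b : ℝ, HasDerivAt (fun t : ℝ => a + t * b) b 0 := fun a b => by
    simpa using ((hasDerivAt_id (0 : ℝ)).mul_const b).const_add a
  have hEd : HasDerivAt (fun t => m.E (lamS + t * ν.1)) (ν.1 • deriv m.E lamS) 0 := by
    have hd := (m.smooth_E.differentiable (by simp) lamS).hasDerivAt
    refine HasDerivAt.scomp 0 ?_ (hs lamS ν.1)
    simpa using hd
  have h2 : HasDerivAt (f ∘ γ) (mapCoef (S.E lamS) h + ν.1 • mapCoef (deriv m.E lamS) (crit k) -
      ν.2.2 • lastMode k - (omS • rot h + ν.2.1 • rot (crit k))) 0 := by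
    have hfg : f ∘ γ = fun t => mapCoef (m.E (lamS + t * ν.1)) (crit k + t • h) -
        (0 + t * ν.2.2) • lastMode k - (omS + t * ν.2.1) • rot (crit k + t • h) := by
      funext t
      simp only [f, Expansion.torusFam, Function.comp_apply, γ, Prod.fst_add, Prod.snd_add,
        Prod.smul_fst, Prod.smul_snd, mul_zero, add_zero, zero_mul, hχ0, inv_one, one_smul,
        m.field_zero, smul_eq_mul]
    rw [hfg]
    have ha : HasDerivAt (fun t => mapCoef (m.E (lamS + t * ν.1)) (crit k + t • h))
        (mapCoef (S.E lamS) h + ν.1 • mapCoef (deriv m.E lamS) (crit k)) 0 := by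
      refine hasDerivAt_pi.2 fun j => ?_
      have := hEd.clm_apply (hasDerivAt_pi.1 hc j)
      simp only [zero_mul, add_zero, zero_smul, hE.self_of_nhds] at this
      refine this.congr_deriv ?_
      simp [add_comm]
    have hb : HasDerivAt (fun t : ℝ => (omS + t * ν.2.1) • rot (crit k + t • h))
        (omS • rot h + ν.2.1 • rot (crit k)) 0 := by
      have := (hs omS ν.2.1).smul ((rot (W := Floq k)).hasFDerivAt.comp_hasDerivAt 0 hc)
      refine this.congr_deriv ?_
      simp
    exact (ha.sub ((hs 0 ν.2.2).smul_const _)).sub hb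
  rw [h1.unique h2, linC_apply, linA, ← hS.E_eq]
  have h3 : mapCoef (deriv m.E lamS) (crit k) =
      deriv S.αR lamS • crit k + deriv S.αI lamS • rot (crit k) := by
    funext j
    exact hS.deriv_E_crit hE j
  rw [h3]
  simp only [sub_apply, smul_apply]
  module

/-- A smooth branch of solutions `Y ε` with parameters `μ ε` and derivatives `W ε`. -/
structure Branch (m : Expansion (Floq k)) (lamS omS : ℝ) (n : ℕ) (Y W : ℝ → C(Circ, Modes k))
    (μ : ℝ → Param) : Prop where
  smooth_Y : ContDiff ℝ n Y
  smooth_W : ContDiff ℝ n W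
  smooth_μ : ContDiff ℝ n μ
  Y_zero : Y 0 = circConst (crit k)
  μ_zero : μ 0 = (lamS, omS, 0)
  hasDerivAt : ∀ᶠ ε in 𝓝 0, ∀ θ : ℝ, HasDerivAt (fun s : ℝ => Y ε s) (W ε θ) θ
  equation : ∀ᶠ ε in 𝓝 0, ∀ θ : ℝ,
    (1 + ε * (μ ε).2.2) • W ε θ = m.field θ (Y ε θ) (μ ε) ε
  phase : ∀ᶠ ε in 𝓝 0, phaseL k (∫ s in (0 : ℝ)..2 * Real.pi, Y ε s) =
    phaseL k ((2 * Real.pi) • crit k)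
  unique : ∃ r > 0, ∀ᶠ ε in 𝓝 0, ∀ (y : ℝ → Modes k) (ν : Param),
    Function.Periodic y (2 * Real.pi) →
    (∀ θ : ℝ, HasDerivAt y ((1 + ε * ν.2.2)⁻¹ • m.field θ (y θ) ν ε) θ) →
    phaseL k (∫ s in (0 : ℝ)..2 * Real.pi, y s) = phaseL k ((2 * Real.pi) • crit k) →
    (∀ θ, ‖y θ - crit k‖ < r) → ‖ν - (lamS, omS, 0)‖ < r → (∀ θ : ℝ, y θ = Y ε θ) ∧ ν = μ ε

theorem Family.IsNSPoint.exists_torus_branch {S : Family k} {Λ : Set ℝ} {lamS omS : ℝ}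
    (hS : S.IsNSPoint Λ lamS omS) {m : Expansion (Floq k)}
    (hE : ∀ᶠ lam in 𝓝 lamS, m.E lam = S.E lam) (n : ℕ) :
    ∃ Y W μ, Branch m lamS omS n Y W μ := by
  obtain ⟨χ, hχ, hχ1, δ, hδ, hχδ⟩ := exists_cutoff one_pos
  have hχ0 : χ 0 = 0 := hχδ 0 (by simpa using hδ)
  have hU := nondegenerate_lin (q := deriv S.αI lamS) hS.om_pos hS.om_lt hS.no_strong_resonance
    hS.transversal hS.hyperbolic
  obtain ⟨Y, μ, hY, hμ, hY0, hμ0, hsol, r, hr, huniq⟩ := exists_branch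
    (f := m.torusFam hχ hχ1) (y₀ := crit k) (μ₀ := (lamS, omS, 0)) hU
    (fun θ => by
      simp only [Expansion.torusFam, m.field_zero, hE.self_of_nhds, hS.mapCoef_crit]
      simp)
    (fun θ h ν => hS.torusFam_fderiv hE hχ hχ1 hχ0 θ h ν) n
  have hη : ContDiff ℝ n (fun ε => (μ ε).2.2) := hμ.snd.snd
  have hsmall : ∀ᶠ ε in 𝓝 (0 : ℝ), |ε * (μ ε).2.2| < min δ 1 := by
    have hc : Continuous (fun ε => |ε * (μ ε).2.2|) := (continuous_id.mul hη.continuous).abs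
    exact hc.continuousAt.eventually_lt continuousAt_const (by simpa using hδ)
  have heq : ∀ θ (q : Modes k × Param × ℝ), |q.2.2 * q.2.1.2.2| < δ →
      (m.torusFam hχ hχ1).toFun θ q = (1 + q.2.2 * q.2.1.2.2)⁻¹ • m.field θ q.1 q.2.1 q.2.2 := by
    intro θ q hq
    simp only [Expansion.torusFam, hχδ _ hq]
  -- The θ-derivative is taken to be the right-hand side along the branch. It is therefore as smooth
  -- in ε as `Y` in the supremum norm, and estimates for derivatives cost nothing extra.
  refine ⟨Y, fun ε => (m.torusFam hχ hχ1).superpose (pairConst (Y ε, μ ε, ε)), μ, hY, ?_, hμ, hY0,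
    hμ0, ?_, ?_, hsol.mono fun ε h => h.2, min r (min δ 1), by positivity, ?_⟩
  · exact (PerFam.contDiff_superpose_nat n _).comp
      ((pairConst (V := Modes k) (W := Param × ℝ)).contDiff.comp (hY.prodMk (hμ.prodMk contDiff_id)))
  · filter_upwards [hsol] with ε h θ
    simpa using h.1 θ
  · filter_upwards [hsmall] with ε h θ
    have h1 : 1 + ε * (μ ε).2.2 ≠ 0 := by
      have := (abs_lt.1 (h.trans_le (min_le_right _ _))).1
      linarith
    rw [PerFam.superpose_apply, PerFam.lift_coe, pairConst_apply,
      heq _ _ (h.trans_le (min_le_left _ _)), smul_inv_smul₀ h1]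
  · have h1 : ∀ᶠ ε in 𝓝 (0 : ℝ), |ε| < 1 := by
      simpa using eventually_abs_sub_lt (0 : ℝ) one_pos
    filter_upwards [huniq, h1] with ε hu h1 y ν hp hy hl hyr hνr
    refine hu y ν hp (fun θ => ?_) hl (fun θ => (hyr θ).trans_le (min_le_left _ _))
      (hνr.trans_le (min_le_left _ _))
    rw [heq]
    · exact hy θ
    · have h2 : |ν.2.2| ≤ ‖ν - (lamS, omS, 0)‖ := by
        have := (norm_snd_le (ν - (lamS, omS, 0)).2).trans (norm_snd_le (ν - (lamS, omS, 0)))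
        simpa using this
      have h3 := h2.trans_lt (hνr.trans_le ((min_le_right _ _).trans (min_le_left _ _)))
      rw [abs_mul]
      nlinarith [abs_nonneg ν.2.2, abs_nonneg ε]

end Modes

end NeimarkSacker

namespace NeimarkSacker

/-! ### Passing between torus functions and their Fourier coefficients -/

section Translation

variable {k : ℕ}

/-- The unknowns of the torus equations with given Fourier coefficients and parameters. -/
noncomputable def toTorus (c : ℝ → Modes k) (ν : Param) : Torus k :=
  ⟨fun θ φ => ev φ (c θ), ν.1, ν.2.1, ν.2.2⟩

theorem integral_trig_mul_clm (L : Floq k →L[ℝ] ℝ) (C : Modes k) :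
    ∫ φ in (0 : ℝ)..2 * Real.pi, Real.cos φ * L (ev φ C) = Real.pi * L (C 1) ∧
    ∫ φ in (0 : ℝ)..2 * Real.pi, Real.sin φ * L (ev φ C) = Real.pi * L (C 2) ∧
    ∫ φ in (0 : ℝ)..2 * Real.pi, L (ev φ C) = 2 * Real.pi * L (C 0) := by
  have hπ := Real.pi_ne_zero
  have he : Continuous (fun φ => ev φ C) := contDiff_ev.continuous.clm_apply continuous_const
  have hint : ∀ {g : ℝ → ℝ}, Continuous g →
      ∫ φ in (0 : ℝ)..2 * Real.pi, g φ * L (ev φ C) =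
        L (∫ φ in (0 : ℝ)..2 * Real.pi, g φ • ev φ C) := by
    intro g hg
    refine Eq.trans ?_ (ContinuousLinearMap.intervalIntegral_comp_comm L
      (Continuous.intervalIntegrable (u := fun φ => g φ • ev φ C) (hg.smul he) _ _))
    simp
  have h1 := (cosCoeff_eq (fun φ => ev φ C)).2.1
  have h2 := (sinCoeff_eq (fun φ => ev φ C)).1
  have h0 := (cosCoeff_eq (fun φ => ev φ C)).1
  rw [coef_ev] at h0 h1 h2
  simp only [cosCoeff, sinCoeff, one_ne_zero, if_false, if_true, Nat.cast_one, one_mul,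
    Nat.cast_zero, zero_mul, Real.cos_zero, one_smul] at h0 h1 h2
  refine ⟨?_, ?_, ?_⟩
  · rw [hint Real.continuous_cos, ← h1, map_smul, smul_eq_mul, mul_inv_cancel_left₀ hπ]
  · rw [hint Real.continuous_sin, ← h2, map_smul, smul_eq_mul, mul_inv_cancel_left₀ hπ]
  · have := hint (g := fun _ => 1) continuous_const
    simp only [one_mul, one_smul] at this
    rw [this, ← h0, map_smul, smul_eq_mul, mul_inv_cancel_left₀ (by positivity)]

/-- The coordinates in the critical directions. -/
noncomputable def hatP (i : Fin 2) : Floq k →L[ℝ] ℝ :=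
  (EuclideanSpace.proj i).comp (ContinuousLinearMap.fst ℝ _ _)

@[simp] theorem hatP_apply (i : Fin 2) (z : Floq k) : hatP i z = z.1 i := rfl

theorem integral_clm_ev {c : ℝ → Modes k} (hc : Continuous c) (L : Floq k →L[ℝ] ℝ) (φ : ℝ) :
    ∫ θ in (0 : ℝ)..2 * Real.pi, L (ev φ (c θ)) =
      L (ev φ (∫ θ in (0 : ℝ)..2 * Real.pi, c θ)) :=
  ContinuousLinearMap.intervalIntegral_comp_comm (L.comp (ev φ)) (hc.intervalIntegrable _ _)

theorem mean₂_amplitude {c : ℝ → Modes k} (hc : Continuous c) :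
    mean₂ (fun θ φ => inner ℝ (ev φ (c θ)).1 (aHat φ)) =
      (4 * Real.pi)⁻¹ * (phaseL k (∫ θ in (0 : ℝ)..2 * Real.pi, c θ)).1 := by
  have hπ := Real.pi_ne_zero
  have h : ∀ φ (z : Floq k), inner ℝ z.1 (aHat φ) =
      (Real.cos φ • hatP 0 + Real.sin φ • hatP 1 : Floq k →L[ℝ] ℝ) z := fun φ z => by
    simp [PiLp.inner_apply, Fin.sum_univ_two, aHat]
  have he : ∀ C : Modes k, Continuous (fun φ => ev φ C) := fun C =>
    contDiff_ev.continuous.clm_apply continuous_const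
  simp only [mean₂, h, integral_clm_ev hc]
  simp only [add_apply, smul_apply, smul_eq_mul]
  rw [intervalIntegral.integral_add, (integral_trig_mul_clm _ _).1, (integral_trig_mul_clm _ _).2.1,
    phaseL_apply]
  · simp only [hatP_apply]
    field_simp
    ring
  · exact (Real.continuous_cos.mul ((hatP 0).continuous.comp (he _))).intervalIntegrable _ _
  · exact (Real.continuous_sin.mul ((hatP 1).continuous.comp (he _))).intervalIntegrable _ _

theorem mean₂_phase {c : ℝ → Modes k} (hc : Continuous c) :
    mean₂ (fun θ φ => inner ℝ (ev φ (c θ)).1 (aHatDot φ)) =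
      (4 * Real.pi)⁻¹ * (phaseL k (∫ θ in (0 : ℝ)..2 * Real.pi, c θ)).2.1 := by
  have hπ := Real.pi_ne_zero
  have h : ∀ φ (z : Floq k), inner ℝ z.1 (aHatDot φ) =
      (Real.cos φ • hatP 1 - Real.sin φ • hatP 0 : Floq k →L[ℝ] ℝ) z := fun φ z => by
    simp [PiLp.inner_apply, Fin.sum_univ_two, aHatDot]
    ring
  have he : ∀ C : Modes k, Continuous (fun φ => ev φ C) := fun C =>
    contDiff_ev.continuous.clm_apply continuous_const
  simp only [mean₂, h, integral_clm_ev hc]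
  simp only [sub_apply, smul_apply, smul_eq_mul]
  rw [intervalIntegral.integral_sub, (integral_trig_mul_clm _ _).1, (integral_trig_mul_clm _ _).2.1,
    phaseL_apply]
  · simp only [hatP_apply]
    field_simp
    ring
  · exact (Real.continuous_cos.mul ((hatP 1).continuous.comp (he _))).intervalIntegrable _ _
  · exact (Real.continuous_sin.mul ((hatP 0).continuous.comp (he _))).intervalIntegrable _ _

theorem mean₂_last {c : ℝ → Modes k} (hc : Continuous c) :
    mean₂ (fun θ φ => (ev φ (c θ)).2.2) =
      (2 * Real.pi)⁻¹ * (phaseL k (∫ θ in (0 : ℝ)..2 * Real.pi, c θ)).2.2 := by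
  have hπ := Real.pi_ne_zero
  have h : ∀ (z : Floq k), z.2.2 = ((ContinuousLinearMap.snd ℝ _ _).comp
      (ContinuousLinearMap.snd ℝ _ _) : Floq k →L[ℝ] ℝ) z := fun z => rfl
  simp only [mean₂, phaseL_apply]
  simp only [h, integral_clm_ev hc]
  rw [(integral_trig_mul_clm _ _).2.2]
  field_simp

theorem phaseL_crit : phaseL k ((2 * Real.pi) • crit k) = (4 * Real.pi, 0, 0) := by
  rw [phaseL_apply]
  simp [crit]
  ring

/-- The reference value is that of a(φ) itself, for which `phaseL` is (4π, 0, 0). This cancels the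
factor 1/(4π) = π/(2π)² in the amplitude mean. -/
theorem phase_iff {c : ℝ → Modes k} (hc : Continuous c) :
    phaseL k (∫ s in (0 : ℝ)..2 * Real.pi, c s) = phaseL k ((2 * Real.pi) • crit k) ↔
      mean₂ (fun θ φ => inner ℝ (ev φ (c θ)).1 (aHat φ)) = 1 ∧
      mean₂ (fun θ φ => inner ℝ (ev φ (c θ)).1 (aHatDot φ)) = 0 ∧
      mean₂ (fun θ φ => (ev φ (c θ)).2.2) = 0 := by
  have hπ := Real.pi_pos
  rw [mean₂_amplitude hc, mean₂_phase hc, mean₂_last hc, phaseL_crit,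
    inv_mul_eq_one₀ (by positivity), mul_eq_zero, mul_eq_zero, Prod.ext_iff, Prod.ext_iff,
    or_iff_right (by positivity), or_iff_right (by positivity)]
  simp only [eq_comm]

theorem isFourierSol_toTorus {S : Family k} {m : Expansion (Floq k)} {c c' : ℝ → Modes k}
    {ν : Param} {ε : ℝ} (hG : ∀ z θ, S.G z ν.1 ν.2.2 θ ε = m.G z ν.1 ν.2.2 θ ε)
    (hp : Function.Periodic c (2 * Real.pi)) (hd : ∀ θ, HasDerivAt c (c' θ) θ)
    (hc' : Continuous c') (heq : ∀ θ, (1 + ε * ν.2.2) • c' θ = m.field θ (c θ) ν ε)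
    (hl : phaseL k (∫ s in (0 : ℝ)..2 * Real.pi, c s) = phaseL k ((2 * Real.pi) • crit k)) :
    S.IsFourierSol ε (toTorus c ν) := by
  have hc : ContDiff ℝ 1 c := by
    rw [contDiff_one_iff_deriv]
    refine ⟨fun θ => (hd θ).differentiableAt, ?_⟩
    rwa [show deriv c = c' from funext fun θ => (hd θ).deriv]
  have hph := (phase_iff hc.continuous).1 hl
  refine ⟨?_, fun θ φ => ?_, fun θ φ => ?_, fun θ φ => ?_, hph.1, hph.2.1, hph.2.2⟩
  · exact ((contDiff_ev.of_le (by simp)).comp contDiff_snd).clm_apply (hc.comp contDiff_fst)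
  · simp only [toTorus, hp θ]
  · rw [trunc_eq_ev]
    simp only [toTorus, coef_ev]
  · have h1 : deriv (fun s => (toTorus c ν).z s φ) θ = ev φ (c' θ) :=
      ((ev (W := Floq k) φ).hasFDerivAt.comp_hasDerivAt θ (hd θ)).deriv
    have h2 : deriv (fun s => (toTorus c ν).z θ s) φ = ev φ (rot (c θ)) :=
      (hasDerivAt_ev (c θ) φ).deriv
    rw [h1, h2, trunc_eq_ev]
    simp only [toTorus, hG]
    have h3 := congrArg (ev φ) (heq θ)
    simp only [Expansion.field, map_sub, map_smul, ev_lastMode] at h3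
    rw [h3]
    abel

theorem Family.IsFourierSol.modes_eq {S : Family k} {u : Torus k} {ε : ℝ}
    (hu : S.IsFourierSol ε u) (θ φ : ℝ) : u.z θ φ = ev φ (coef (u.z θ)) := by
  rw [← trunc_eq_ev, hu.modes]

theorem Family.IsFourierSol.eq_toTorus {S : Family k} {u : Torus k} {ε : ℝ}
    (hu : S.IsFourierSol ε u) :
    u = toTorus (fun θ => coef (u.z θ)) (u.lam, u.om, u.eta) := by
  ext1
  · funext θ φ
    exact hu.modes_eq θ φ
  · rfl
  · rfl
  · rfl

theorem Family.IsFourierSol.modes_ode {S : Family k} {m : Expansion (Floq k)} {u : Torus k}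
    {ε : ℝ} (hG : ∀ z θ, S.G z u.lam u.eta θ ε = m.G z u.lam u.eta θ ε)
    (hu : S.IsFourierSol ε u) (hη : 1 + ε * u.eta ≠ 0) :
    Function.Periodic (fun θ => coef (u.z θ)) (2 * Real.pi) ∧
    (∀ θ, HasDerivAt (fun θ => coef (u.z θ))
      ((1 + ε * u.eta)⁻¹ • m.field θ (coef (u.z θ)) (u.lam, u.om, u.eta) ε) θ) ∧
    phaseL k (∫ s in (0 : ℝ)..2 * Real.pi, coef (u.z s)) = phaseL k ((2 * Real.pi) • crit k) := by
  have hc : ContDiff ℝ 1 (fun θ => coef (u.z θ)) := contDiff_one_coef hu.contDiff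
  refine ⟨fun θ => ?_, fun θ => ?_, ?_⟩
  · simp only [funext (hu.periodic θ)]
  · have hd := (hc.differentiable one_ne_zero θ).hasDerivAt
    refine hd.congr_deriv ?_
    rw [eq_inv_smul_iff₀ hη]
    refine ev_injective fun φ => ?_
    have h1 : deriv (fun s => u.z s φ) θ = ev φ (deriv (fun θ => coef (u.z θ)) θ) := by
      rw [show (fun s => u.z s φ) = fun s => ev φ (coef (u.z s)) from
        funext fun s => hu.modes_eq s φ]
      exact ((ev φ).hasFDerivAt.comp_hasDerivAt θ hd).deriv
    have h2 : deriv (fun s => u.z θ s) φ = ev φ (rot (coef (u.z θ))) := by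
      rw [show (fun s => u.z θ s) = fun s => ev s (coef (u.z θ)) from
        funext fun s => hu.modes_eq θ s]
      exact (hasDerivAt_ev _ φ).deriv
    have h3 := hu.equation θ φ
    rw [h1, h2, trunc_eq_ev] at h3
    simp only [hG] at h3
    simp only [Expansion.field, map_sub, map_smul, ev_lastMode, ← hu.modes_eq]
    rw [← sub_eq_zero, ← neg_eq_zero, ← h3]
    abel
  · rw [phase_iff hc.continuous]
    simp only [← hu.modes_eq]
    exact ⟨hu.amplitude, hu.phase, hu.phase_last⟩

theorem coef_sub_crit {f : ℝ → Floq k} {r : ℝ} (hr : 0 ≤ r) (hf : Continuous f)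
    (h : ∀ φ, ‖f φ - aStar k φ‖ ≤ r) : ‖coef f - crit k‖ ≤ 2 * r := by
  have h1 : Continuous fun φ => (-1 : ℝ) • ev φ (crit k) :=
    continuous_const.smul (f := fun _ => (-1 : ℝ)) ((contDiff_ev (W := Floq k)).continuous.clm_apply continuous_const)
  have h2 : coef f - crit k = coef (fun φ => f φ + (-1 : ℝ) • ev φ (crit k)) := by
    rw [coef_add hf h1, coef_smul, coef_ev]
    module
  rw [h2]
  refine norm_coef_le hr fun φ => ?_
  rw [ev_crit, neg_one_smul, ← sub_eq_add_neg]
  exact h φ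

/-- Seven basis functions bounded by 1 account for the factor 7. -/
theorem near_toTorus {c : ℝ → Modes k} {ν : Param} {lamS omS r : ℝ}
    (hc : ∀ θ, ‖c θ - crit k‖ < r / 7) (hν : ‖ν - (lamS, omS, 0)‖ < r) :
    (toTorus c ν).Near lamS omS r := by
  have h1 := norm_fst_le (ν - (lamS, omS, 0))
  have h2 := norm_snd_le (ν - (lamS, omS, 0))
  have h3 := norm_fst_le (ν - (lamS, omS, 0)).2
  have h4 := norm_snd_le (ν - (lamS, omS, 0)).2
  simp only [Prod.fst_sub, Prod.snd_sub, Real.norm_eq_abs, sub_zero] at h1 h2 h3 h4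
  refine ⟨fun θ φ => ?_, h1.trans_lt hν, (h3.trans h2).trans_lt hν, (h4.trans h2).trans_lt hν⟩
  simp only [toTorus]
  rw [← ev_crit, ← map_sub]
  have := norm_ev_le φ (c θ - crit k)
  linarith [hc θ]

theorem Branch.isFourierSol {S : Family k} {m : Expansion (Floq k)} {lamS omS δ : ℝ} {n : ℕ}
    {Y W : ℝ → C(Circ, Modes k)} {μ : ℝ → Param} (hB : Branch m lamS omS n Y W μ) (hδ : 0 < δ)
    (hG : ∀ z lam η θ ε, |lam - lamS| < δ → ε ≠ 0 → S.G z lam η θ ε = m.G z lam η θ ε) :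
    ∀ᶠ ε in 𝓝[≠] (0 : ℝ), S.IsFourierSol ε (toTorus (fun θ => Y ε θ) (μ ε)) := by
  have h1 : ∀ᶠ ε in 𝓝 (0 : ℝ), |(μ ε).1 - lamS| < δ := by
    have hc : Continuous (fun ε => |(μ ε).1 - lamS|) :=
      (hB.smooth_μ.continuous.fst.sub continuous_const).abs
    refine hc.continuousAt.eventually_lt continuousAt_const ?_
    simpa [hB.μ_zero] using hδ
  filter_upwards [h1.filter_mono nhdsWithin_le_nhds, hB.hasDerivAt.filter_mono nhdsWithin_le_nhds,
    hB.equation.filter_mono nhdsWithin_le_nhds, hB.phase.filter_mono nhdsWithin_le_nhds,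
    self_mem_nhdsWithin] with ε h1 h2 h3 h4 h5
  exact isFourierSol_toTorus (fun z θ => hG _ _ _ _ _ h1 h5)
    (fun θ => by simp only [coe_add_two_pi]) h2 (continuous_coe_circ _) h3 h4

theorem Branch.near {m : Expansion (Floq k)} {lamS omS : ℝ} {n : ℕ}
    {Y W : ℝ → C(Circ, Modes k)} {μ : ℝ → Param} (hB : Branch m lamS omS n Y W μ) {r : ℝ}
    (hr : 0 < r) : ∀ᶠ ε in 𝓝 (0 : ℝ), (toTorus (fun θ => Y ε θ) (μ ε)).Near lamS omS r := by
  have h1 : ∀ᶠ ε in 𝓝 (0 : ℝ), ‖Y ε - Y 0‖ < r / 7 := by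
    have hc : Continuous (fun ε => ‖Y ε - Y 0‖) := (hB.smooth_Y.continuous.sub continuous_const).norm
    refine hc.continuousAt.eventually_lt continuousAt_const ?_
    simpa using hr
  have h2 : ∀ᶠ ε in 𝓝 (0 : ℝ), ‖μ ε - μ 0‖ < r := by
    have hc : Continuous (fun ε => ‖μ ε - μ 0‖) := (hB.smooth_μ.continuous.sub continuous_const).norm
    refine hc.continuousAt.eventually_lt continuousAt_const ?_
    simpa using hr
  filter_upwards [h1, h2] with ε h1 h2
  rw [hB.μ_zero] at h2
  refine near_toTorus (fun θ => lt_of_le_of_lt ?_ h1) h2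
  rw [hB.Y_zero]
  exact ContinuousMap.norm_coe_le_norm (Y ε - circConst (crit k)) θ

theorem Branch.exists_unique {S : Family k} {m : Expansion (Floq k)} {lamS omS δ : ℝ} {n : ℕ}
    {Y W : ℝ → C(Circ, Modes k)} {μ : ℝ → Param} (hB : Branch m lamS omS n Y W μ) (hδ : 0 < δ)
    (hG : ∀ z lam η θ ε, |lam - lamS| < δ → ε ≠ 0 → S.G z lam η θ ε = m.G z lam η θ ε) :
    ∃ r > 0, ∀ᶠ ε in 𝓝[≠] (0 : ℝ), ∀ u : Torus k, S.IsFourierSol ε u → u.Near lamS omS r →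
      u = toTorus (fun θ => Y ε θ) (μ ε) := by
  obtain ⟨r, hr, hu⟩ := hB.unique
  -- Taking coefficients at most doubles a uniform distance, and 2r/3 < r. The bound δ keeps λ where
  -- G equals its expansion, and the bound 1 keeps 1 + εη away from zero when |ε| < 1.
  refine ⟨min (r / 3) (min δ 1), by positivity, ?_⟩
  have h1 : ∀ᶠ ε in 𝓝 (0 : ℝ), |ε| < 1 := by
    simpa using eventually_abs_sub_lt (0 : ℝ) one_pos
  filter_upwards [hu.filter_mono nhdsWithin_le_nhds, h1.filter_mono nhdsWithin_le_nhds,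
    self_mem_nhdsWithin] with ε hu h1 hε u hsol hnear
  obtain ⟨hz, hl, ho, he⟩ := hnear
  have hr3 : min (r / 3) (min δ 1) ≤ r / 3 := min_le_left _ _
  have hη : 1 + ε * u.eta ≠ 0 := by
    have h2 : |u.eta| < 1 := he.trans_le ((min_le_right _ _).trans (min_le_right _ _))
    have h3 : |ε * u.eta| < 1 := by
      rw [abs_mul]
      nlinarith [abs_nonneg ε, abs_nonneg u.eta]
    have := (abs_lt.1 h3).1
    linarith
  obtain ⟨hp, hd, hph⟩ := hsol.modes_ode (m := m) (fun z θ => hG _ _ _ _ _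
    (hl.trans_le ((min_le_right _ _).trans (min_le_left _ _))) hε) hη
  have := hu (fun θ => coef (u.z θ)) (u.lam, u.om, u.eta) hp hd hph (fun θ => ?_) ?_
  · rw [hsol.eq_toTorus, funext this.1, this.2]
  · have hc : Continuous (u.z θ) :=
      hsol.contDiff.continuous.comp (continuous_const.prodMk continuous_id)
    have := coef_sub_crit (r := r / 3) (by positivity) hc fun φ => ((hz θ φ).le.trans hr3)
    linarith
  · have hlt : min (r / 3) (min δ 1) < r := by linarith
    rw [Prod.norm_def, Prod.norm_def]
    simp only [Prod.fst_sub, Prod.snd_sub, Real.norm_eq_abs, sub_zero]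
    exact max_lt (hl.trans hlt) (max_lt (ho.trans hlt) (he.trans hlt))

end Translation

end NeimarkSacker

namespace NeimarkSacker

/-! ### Taylor expansions of even and odd functions of ε -/

section EvenOdd

variable {W : Type} [NormedAddCommGroup W] [NormedSpace ℝ W]

theorem isBigO_pow_smul {g : ℝ → W} (hg : Continuous g) (n : ℕ) :
    (fun ε => ε ^ n • g ε) =O[𝓝[≠] 0] fun ε : ℝ => ε ^ n := by
  have h := (hg.continuousAt (x := 0).isBigO_one ℝ).mono (nhdsWithin_le_nhds (s := {0}ᶜ))
  simpa using (isBigO_refl (fun ε : ℝ => ε ^ n) (𝓝[≠] 0)).smul h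

/-- Averaging the Taylor formulas at ε and −ε removes the odd terms, the cubic one included. This is
why the error is O(ε⁴) and why four derivatives are assumed. -/
theorem even_expansion [CompleteSpace W] {f : ℝ → W} (hf : ContDiff ℝ 4 f)
    (he : ∀ᶠ ε in 𝓝 0, f (-ε) = f ε) : ∃ p₂, Jet f (f 0) 0 p₂ ∧
      (fun ε => f ε - f 0 - ε ^ 2 • p₂) =O[𝓝[≠] 0] fun ε : ℝ => ε ^ 4 := by
  obtain ⟨q₁, q₂, r, -, -, hr, h⟩ := exists_taylor_three (Y := ℝ) (n := 1)
    (f := fun _ ε => f ε) (hf.comp contDiff_snd)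
  obtain ⟨s, hs, h'⟩ := exists_taylor_one (n := 0) hr
  have hc : Continuous (s 0) := hs.continuous.comp (continuous_const.prodMk continuous_id)
  have hO : (fun ε => f ε - f 0 - ε ^ 2 • q₂ 0) =O[𝓝[≠] 0] fun ε : ℝ => ε ^ 4 := by
    refine (isBigO_pow_smul (g := fun ε => (2⁻¹ : ℝ) • (s 0 ε + s 0 (-ε)))
      (by fun_prop) 4).congr' ?_ EventuallyEq.rfl
    filter_upwards [he.filter_mono nhdsWithin_le_nhds] with ε hε
    have h1 : f ε = (2⁻¹ : ℝ) • (f ε + f (-ε)) := by rw [hε]; module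
    rw [h1, h 0 ε, h 0 (-ε), h' 0 ε, h' 0 (-ε)]
    module
  refine ⟨q₂ 0, ?_, hO⟩
  exact (hO.trans (isBigO_pow_pow (by norm_num))).congr_left fun ε => by module

theorem odd_expansion [CompleteSpace W] {f : ℝ → W} (hf : ContDiff ℝ 4 f)
    (he : ∀ᶠ ε in 𝓝 0, f (-ε) = -f ε) : ∃ p₁, Jet f 0 p₁ 0 ∧
      (fun ε => f ε - ε • p₁) =O[𝓝[≠] 0] fun ε : ℝ => ε ^ 3 := by
  obtain ⟨q₁, q₂, r, -, -, hr, h⟩ := exists_taylor_three (Y := ℝ) (n := 0)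
    (f := fun _ ε => f ε) ((hf.of_le (by norm_num)).comp contDiff_snd)
  have hc : Continuous (r 0) := hr.continuous.comp (continuous_const.prodMk continuous_id)
  have hO : (fun ε => f ε - ε • q₁ 0) =O[𝓝[≠] 0] fun ε : ℝ => ε ^ 3 := by
    refine (isBigO_pow_smul (g := fun ε => (2⁻¹ : ℝ) • (r 0 ε + r 0 (-ε)))
      (by fun_prop) 3).congr' ?_ EventuallyEq.rfl
    filter_upwards [he.filter_mono nhdsWithin_le_nhds] with ε hε
    have h1 : f ε = (2⁻¹ : ℝ) • (f ε - f (-ε)) := by rw [hε]; module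
    rw [h1, h 0 ε, h 0 (-ε)]
    module
  exact ⟨q₁ 0, hO.congr_left fun ε => by module, hO⟩

end EvenOdd

/-! ### The second-order jet of G along a curve -/

section JetG

variable {K : Type} [NormedAddCommGroup K] [NormedSpace ℝ K]

/-- The coefficient of `ε` in the expansion of `G` along `a + ε z₁ + …`. -/
noncomputable def Expansion.ord₁ (m : Expansion K) (θ lam : ℝ) (a z₁ : K) : K :=
  m.E lam z₁ + m.B θ lam a a

/-- The coefficient of `ε²` in the expansion of `G` along `a + ε z₁ + ε² z₂ + …`, for parameters
`lam + ε² l₂ + …` and `ε κ + …`. -/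
noncomputable def Expansion.ord₂ (m : Expansion K) (θ lam l₂ κ : ℝ) (a z₁ z₂ : K) : K :=
  m.E lam z₂ + l₂ • deriv m.E lam a + (m.B θ lam a z₁ + m.B θ lam z₁ a) + m.C θ lam 0 a a a -
    κ • m.Q θ lam a

/-- As λ has no ε term and η no constant term, the variation of λ is seen only through E, the
correction εη Q z starts at ε², and the cubic coefficient is needed only at its limit (λ₀, 0). -/
theorem Expansion.jet_G [CompleteSpace K] (m : Expansion K) {z : ℝ → K} {lam η : ℝ → ℝ}
    {a z₁ z₂ : K} {lam₀ l₂ κ κ₂ : ℝ} (θ : ℝ) (hz : Jet z a z₁ z₂) (hl : Jet lam lam₀ 0 l₂)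
    (hη : Jet η 0 κ κ₂) :
    Jet (fun ε => m.G (z ε) (lam ε) (η ε) θ ε) (m.E lam₀ a) (m.ord₁ θ lam₀ a z₁)
      (m.ord₂ θ lam₀ l₂ κ a z₁ z₂) := by
  have hE := (Jet.comp_contDiff m.smooth_E hl).clm_apply hz
  have hB := (((Jet.comp_contDiff (f := fun lam => m.B θ lam)
    (m.smooth_B.comp (contDiff_const.prodMk contDiff_id)) hl).clm_apply hz).clm_apply hz).id_smul
  have hQ := (hη.smul ((Jet.comp_contDiff (f := fun lam => m.Q θ lam)
    (m.smooth_Q.comp (contDiff_const.prodMk contDiff_id)) hl).clm_apply hz)).id_smul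
  have hC : Jet (fun ε => ε ^ 2 • m.C θ (lam ε) (ε • z ε) (z ε) (z ε) (z ε)) 0 0
      (m.C θ lam₀ 0 a a a) := by
    refine Jet.sq_smul ?_
    let F : ℝ × K → K →L[ℝ] K →L[ℝ] K →L[ℝ] K := fun p => m.C θ p.1 p.2
    have hF : ContDiff ℝ ∞ F :=
      m.smooth_C.comp ((contDiff_const.prodMk contDiff_fst).prodMk contDiff_snd)
    have hFd := (hF.differentiable (by simp) (lam₀, 0)).hasFDerivAt
    have hp : (fun ε => (lam ε, ε • z ε) - (lam₀, (0 : K))) =O[𝓝[≠] 0] fun ε : ℝ => ε := by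
      have h2 : (fun ε => ε • z ε) =O[𝓝[≠] 0] fun ε : ℝ => ε := by
        simpa using hz.id_smul.sub_isBigO
      exact (hl.sub_isBigO.prod_left h2).congr_left fun ε => by simp
    have ht : Tendsto (fun ε => (lam ε, ε • z ε)) (𝓝[≠] 0) (𝓝 (lam₀, 0)) := by
      rw [tendsto_iff_norm_sub_tendsto_zero]
      exact (hp.trans_tendsto (tendsto_id.mono_left nhdsWithin_le_nhds)).norm.trans (by simp)
    have hu := (hFd.isBigO_sub.comp_tendsto ht).trans hp
    have h1 := hz.isBigO_one
    have h2 : (fun ε => (F (lam ε, ε • z ε) - F (lam₀, 0)) (z ε) (z ε) (z ε)) =O[𝓝[≠] 0]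
        fun ε : ℝ => ε := by
      have h3 := ((hu.norm_left.mul h1.norm_left).mul h1.norm_left).mul h1.norm_left
      simp only [mul_one] at h3
      refine IsBigO.trans (IsBigO.of_bound 1 (Eventually.of_forall fun ε => ?_)) h3
      rw [one_mul, Real.norm_of_nonneg (by positivity)]
      exact (ContinuousLinearMap.le_opNorm₂ _ _ _).trans
        (by gcongr; exact ContinuousLinearMap.le_opNorm _ _)
    have h3 := ((((Jet.const (F (lam₀, 0))).clm_apply hz).clm_apply hz).clm_apply hz).sub_isBigO
    refine (h2.add h3).congr_left fun ε => ?_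
    simp only [sub_apply, F]
    abel
  have := ((hE.add hB).add hC).sub hQ
  simp only [add_zero, zero_apply, sub_zero, zero_smul, zero_add, smul_apply] at this
  simp only [Expansion.G, mul_smul]
  refine Eq.mp ?_ this
  congr 1

end JetG

/-! ### The symmetry φ ↦ φ + π, ε ↦ −ε -/

section Parity

variable {k : ℕ}

/-- The signs of the basis functions under `φ ↦ φ + π`. -/
def turnSign : Fin 7 → ℝ := ![1, -1, -1, 1, 1, -1, -1]

theorem abs_turnSign (j : Fin 7) : |turnSign j| = 1 := by
  fin_cases j <;> simp [turnSign]

theorem trigB_add_pi (j : Fin 7) (φ : ℝ) : trigB j (φ + Real.pi) = turnSign j * trigB j φ := by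
  have h3 : Real.cos (3 * (φ + Real.pi)) = -Real.cos (3 * φ) ∧
      Real.sin (3 * (φ + Real.pi)) = -Real.sin (3 * φ) := by
    rw [show 3 * (φ + Real.pi) = (3 * φ + Real.pi) + 2 * Real.pi by ring, Real.cos_add_two_pi,
      Real.sin_add_two_pi, Real.cos_add_pi, Real.sin_add_pi]
    exact ⟨rfl, rfl⟩
  have h2 : Real.cos (2 * (φ + Real.pi)) = Real.cos (2 * φ) ∧
      Real.sin (2 * (φ + Real.pi)) = Real.sin (2 * φ) := by
    rw [show 2 * (φ + Real.pi) = 2 * φ + 2 * Real.pi by ring, Real.cos_add_two_pi,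
      Real.sin_add_two_pi]
    exact ⟨rfl, rfl⟩
  fin_cases j <;> simp [trigB, turnSign, Real.cos_add_pi, Real.sin_add_pi, h2, h3]

/-- The action of `φ ↦ φ + π` on coefficients. -/
noncomputable def halfTurn : Modes k →L[ℝ] Modes k :=
  ContinuousLinearMap.pi fun j =>
    turnSign j • ContinuousLinearMap.proj (R := ℝ) (φ := fun _ : Fin 7 => Floq k) j

@[simp] theorem halfTurn_apply (c : Modes k) (j : Fin 7) : halfTurn c j = turnSign j • c j := rfl

theorem ev_add_pi (φ : ℝ) (c : Modes k) : ev (φ + Real.pi) c = ev φ (halfTurn c) := by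
  simp only [ev_apply, trigB_add_pi, halfTurn_apply, smul_smul, mul_comm]

theorem norm_halfTurn_le (c : Modes k) : ‖halfTurn c‖ ≤ ‖c‖ := by
  refine (pi_norm_le_iff_of_nonneg (norm_nonneg _)).2 fun j => ?_
  rw [halfTurn_apply, norm_smul, Real.norm_eq_abs, abs_turnSign, one_mul]
  exact norm_le_pi_norm c j

theorem trigB_add_two_pi (j : Fin 7) (φ : ℝ) : trigB j (φ + 2 * Real.pi) = trigB j φ := by
  rw [show φ + 2 * Real.pi = φ + Real.pi + Real.pi by ring, trigB_add_pi, trigB_add_pi, ← mul_assoc,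
    ← abs_mul_abs_self (turnSign j), abs_turnSign, one_mul, one_mul]

theorem ev_add_two_pi (φ : ℝ) (c : Modes k) : ev (φ + 2 * Real.pi) c = ev φ c := by
  simp only [ev_apply, trigB_add_two_pi]

theorem coef_comp_add_pi {f : ℝ → Floq k} (hf : Function.Periodic f (2 * Real.pi)) :
    coef (fun φ => f (φ + Real.pi)) = halfTurn (coef f) := by
  funext j
  have h1 : ∀ φ, trigB j φ • f (φ + Real.pi) =
      turnSign j • (trigB j (φ + Real.pi) • f (φ + Real.pi)) := fun φ => by
    rw [trigB_add_pi, smul_smul, ← mul_assoc, ← abs_mul_abs_self (turnSign j), abs_turnSign,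
      one_mul, one_mul]
  have hp : Function.Periodic (fun φ => trigB j φ • f φ) (2 * Real.pi) := fun φ => by
    simp only [trigB_add_two_pi, hf φ]
  have h2 := hp.intervalIntegral_add_eq Real.pi 0
  rw [zero_add] at h2
  simp only [coef, h1, halfTurn_apply]
  rw [intervalIntegral.integral_smul, intervalIntegral.integral_comp_add_right
    (fun φ => trigB j φ • f φ), zero_add, add_comm (2 * Real.pi), h2, smul_comm]

theorem coef_neg (f : ℝ → Floq k) : coef (fun φ => -f φ) = -coef f := by
  have := coef_smul (-1) f
  simpa using this

/-- The products εz and εη are unchanged when z, η and ε all change sign, while each term of the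
expansion is one of them applied to z or to powers of z with matching powers of ε. -/
theorem Expansion.G_neg {K : Type} [NormedAddCommGroup K] [NormedSpace ℝ K] (m : Expansion K)
    (z : K) (lam η θ ε : ℝ) : m.G (-z) lam (-η) θ (-ε) = -m.G z lam η θ ε := by
  simp only [Expansion.G, map_neg, smul_neg, neg_smul, neg_neg, neg_apply, neg_mul_neg, even_two,
    Even.neg_pow]
  abel

theorem rot_halfTurn (c : Modes k) : rot (halfTurn c) = halfTurn (rot c) := by
  funext j
  rw [rot_apply, halfTurn_apply, rot_apply]
  fin_cases j <;> simp [turnSign]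

/-- Combines the sign symmetry of G with the shift φ ↦ φ + π. The shift restores a(φ), as −a(φ + π)
= a(φ), so the symmetry fixes the point from which the branch starts. -/
theorem Expansion.field_neg (m : Expansion (Floq k)) (θ : ℝ) (c : Modes k) (ν : Param) (ε : ℝ) :
    m.field θ (-halfTurn c) (ν.1, ν.2.1, -ν.2.2) (-ε) = -halfTurn (m.field θ c ν ε) := by
  have h1 : ∀ φ, m.G (ev φ (-halfTurn c)) ν.1 (-ν.2.2) θ (-ε) =
      -m.G (ev (φ + Real.pi) c) ν.1 ν.2.2 θ ε := fun φ => by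
    rw [map_neg, ← ev_add_pi, m.G_neg]
  have h2 : Function.Periodic (fun φ => m.G (ev φ c) ν.1 ν.2.2 θ ε) (2 * Real.pi) := fun φ => by
    simp only [ev_add_two_pi]
  have h3 : halfTurn (lastMode k) = lastMode k := by
    funext j
    fin_cases j <;> simp [turnSign, lastMode]
  simp only [Expansion.field, h1]
  rw [coef_neg, coef_comp_add_pi h2, map_sub, map_sub, map_smul, map_smul, h3, map_neg,
    rot_halfTurn]
  module

/-- The reflected branch point solves the problem at −ε and is just as close to the starting point,
so local uniqueness identifies it with the branch at −ε. The statement for `W` follows by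
differentiating in θ. -/
theorem Branch.parity {m : Expansion (Floq k)} {lamS omS : ℝ} {n : ℕ}
    {Y W : ℝ → C(Circ, Modes k)} {μ : ℝ → Param} (hB : Branch m lamS omS n Y W μ) :
    ∀ᶠ ε in 𝓝 (0 : ℝ), (∀ θ : ℝ, Y (-ε) θ = -halfTurn (Y ε θ)) ∧
      (∀ θ : ℝ, W (-ε) θ = -halfTurn (W ε θ)) ∧
      μ (-ε) = ((μ ε).1, (μ ε).2.1, -(μ ε).2.2) := by
  obtain ⟨r, hr, hu⟩ := hB.unique
  have hneg : Tendsto (fun ε : ℝ => -ε) (𝓝 0) (𝓝 0) := by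
    simpa using (continuous_neg (G := ℝ)).tendsto 0
  have h1 : ∀ᶠ ε in 𝓝 (0 : ℝ), ‖Y ε - Y 0‖ < r := by
    have hc : Continuous (fun ε => ‖Y ε - Y 0‖) := (hB.smooth_Y.continuous.sub continuous_const).norm
    refine hc.continuousAt.eventually_lt continuousAt_const ?_
    simpa using hr
  have h2 : ∀ᶠ ε in 𝓝 (0 : ℝ), ‖μ ε - μ 0‖ < r := by
    have hc : Continuous (fun ε => ‖μ ε - μ 0‖) := (hB.smooth_μ.continuous.sub continuous_const).norm
    refine hc.continuousAt.eventually_lt continuousAt_const ?_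
    simpa using hr
  have h3 : ∀ᶠ ε in 𝓝 (0 : ℝ), 1 + ε * (μ ε).2.2 ≠ 0 := by
    have hc : Continuous (fun ε => 1 + ε * (μ ε).2.2) :=
      continuous_const.add (continuous_id.mul hB.smooth_μ.continuous.snd.snd)
    exact hc.continuousAt.eventually_ne (by simp)
  filter_upwards [h1, h2, h3, hneg.eventually hu, hB.hasDerivAt, hneg.eventually hB.hasDerivAt,
    hB.equation, hB.phase] with ε h1 h2 h3 hu hd hd' heq hph
  have hdn : ∀ θ : ℝ, HasDerivAt (fun s : ℝ => -halfTurn (Y ε s)) (-halfTurn (W ε θ)) θ := fun θ =>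
    ((halfTurn (k := k)).hasFDerivAt.comp_hasDerivAt θ (hd θ)).neg
  have hcrit : -halfTurn (crit k) = crit k := by
    funext j
    fin_cases j <;> simp [turnSign, crit]
  have hμ : (μ 0).2.2 = 0 := by rw [hB.μ_zero]
  obtain ⟨hY, hμ'⟩ := hu (fun θ => -halfTurn (Y ε θ)) ((μ ε).1, (μ ε).2.1, -(μ ε).2.2)
    (fun θ => by simp only [coe_add_two_pi])
    (fun θ => by
      refine (hdn θ).congr_deriv ?_
      rw [m.field_neg, neg_mul_neg, eq_inv_smul_iff₀ h3, ← heq θ, map_smul, smul_neg])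
    (by
      have hi : ∫ s in (0 : ℝ)..2 * Real.pi, -halfTurn (Y ε s) =
          -halfTurn (∫ s in (0 : ℝ)..2 * Real.pi, Y ε s) := by
        rw [intervalIntegral.integral_neg, ContinuousLinearMap.intervalIntegral_comp_comm _
          ((continuous_coe_circ _).intervalIntegrable _ _)]
      rw [hi]
      rw [phaseL_crit, phaseL_apply] at hph ⊢
      rw [Prod.ext_iff, Prod.ext_iff] at hph ⊢
      simpa [turnSign] using hph)
    (fun θ => by
      rw [← hcrit, ← neg_sub', norm_neg, ← map_sub]
      refine (norm_halfTurn_le _).trans_lt (lt_of_le_of_lt ?_ h1)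
      rw [hB.Y_zero]
      exact ContinuousMap.norm_coe_le_norm (Y ε - circConst (crit k)) θ)
    (by
      rw [hB.μ_zero] at h2
      rw [Prod.norm_def, Prod.norm_def] at h2 ⊢
      simpa using h2)
  refine ⟨fun θ => (hY θ).symm, fun θ => ?_, hμ'.symm⟩
  refine (hd' θ).unique ((hdn θ).congr_of_eventuallyEq (Eventually.of_forall fun s => ?_))
  exact (hY s).symm

end Parity

end NeimarkSacker

namespace NeimarkSacker

/-! ### Taylor coefficients of the branch in ε -/

section BranchJets

/-- For an involution H with f(−ε) = −H f(ε), the sum f + H f is odd and the difference f − H f is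
even. Their expansions show that p₁ lies in the +1 and p₂ in the −1 eigenspace. -/
theorem parity_expansion {B : Type} [NormedAddCommGroup B] [NormedSpace ℝ B] [CompleteSpace B]
    {H : B →L[ℝ] B} (hH : ∀ x, H (H x) = x) {f : ℝ → B} (hf : ContDiff ℝ 4 f)
    (hp : ∀ᶠ ε in 𝓝 0, f (-ε) = -H (f ε)) :
    ∃ p₁ p₂, H p₁ = p₁ ∧ H p₂ = -p₂ ∧ Jet f (f 0) p₁ p₂ ∧
      (fun ε => f ε + H (f ε) - ε • (2 : ℝ) • p₁) =O[𝓝[≠] 0] (fun ε : ℝ => ε ^ 3) ∧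
      (fun ε => f ε - H (f ε) - (2 : ℝ) • f 0 - ε ^ 2 • (2 : ℝ) • p₂) =O[𝓝[≠] 0]
        (fun ε : ℝ => ε ^ 4) := by
  have h0 : f 0 = -H (f 0) := by simpa using hp.self_of_nhds
  obtain ⟨p₁, hj₁, hO₁⟩ := odd_expansion (f := fun ε => f ε + H (f ε))
    (hf.add (H.contDiff.comp hf)) (hp.mono fun ε h => by rw [h, map_neg, hH]; abel)
  obtain ⟨p₂, hj₂, hO₂⟩ := even_expansion (f := fun ε => f ε - H (f ε))
    (hf.sub (H.contDiff.comp hf)) (hp.mono fun ε h => by rw [h, map_neg, hH]; abel)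
  have h2 : f 0 - H (f 0) = (2 : ℝ) • f 0 := by
    rw [two_smul]
    nth_rewrite 3 [h0]
    abel
  have hp₁ : H p₁ = p₁ := by
    have := hj₁.clm H
    simp only [map_add, hH] at this
    have h3 := (this.congr (Eventually.of_forall fun ε => add_comm _ _)).unique hj₁
    exact h3.2.1
  have hp₂ : H p₂ = -p₂ := by
    have h3 := (hj₂.clm H).add hj₂
    have h4 : (fun ε => H (f ε - H (f ε)) + (f ε - H (f ε))) = fun _ => 0 := by
      funext ε
      rw [map_sub, hH]
      abel
    rw [h4] at h3
    exact eq_neg_of_add_eq_zero_left h3.eq_zero.2.2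
  refine ⟨(2⁻¹ : ℝ) • p₁, (2⁻¹ : ℝ) • p₂, by rw [map_smul, hp₁], by rw [map_smul, hp₂, smul_neg],
    ?_, ?_, ?_⟩
  · have h3 := (hj₁.add hj₂).clm ((2⁻¹ : ℝ) • ContinuousLinearMap.id ℝ B)
    have h4 : (fun ε => ((2⁻¹ : ℝ) • ContinuousLinearMap.id ℝ B)
        (f ε + H (f ε) + (f ε - H (f ε)))) = f := by
      funext ε
      simp only [smul_apply, ContinuousLinearMap.id_apply]
      module
    rw [h4, h2] at h3
    simpa using h3
  · refine hO₁.congr_left fun ε => ?_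
    module
  · refine hO₂.congr_left fun ε => ?_
    rw [h2]
    module

theorem eq_zero_of_neg_eq_self {V : Type} [AddCommGroup V] [Module ℝ V] {x : V} (h : -x = x) :
    x = 0 := by
  have h2 : (2 : ℝ) • x = 0 := by
    rw [two_smul]
    nth_rewrite 1 [← h]
    exact neg_add_cancel x
  exact (smul_eq_zero.1 h2).resolve_left two_ne_zero

theorem aStar_eq (k : ℕ) (φ : ℝ) :
    aStar k φ = Real.cos φ • crit k 1 + Real.sin φ • crit k 2 := by
  rw [← ev_crit, ev_eq]
  simp [crit]

theorem IsTrig.clm_apply_aStar {k n : ℕ} {V : Type} [NormedAddCommGroup V] [NormedSpace ℝ V]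
    {f : ℝ → Floq k →L[ℝ] V} (hf : IsTrig n f) : IsTrig (n + 1) (fun φ => f φ (aStar k φ)) := by
  have h : ∀ x : Floq k, IsTrig n (fun φ => f φ x) := fun x =>
    hf.clm (ContinuousLinearMap.apply ℝ V x)
  refine ((h (crit k 1)).cos_smul.add (h (crit k 2)).sin_smul).congr fun φ => ?_
  rw [aStar_eq, map_add, map_smul, map_smul]

theorem isTrig_aStar (k : ℕ) : IsTrig 1 (fun φ => aStar k φ) := by
  refine ((isTrig_cos (m := 1) (n := 1) le_rfl (crit k 1)).add
    (isTrig_sin (m := 1) le_rfl (crit k 2))).congr fun φ => ?_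
  rw [aStar_eq]
  simp

variable {k : ℕ}

theorem Expansion.isTrig_ord₁ (m : Expansion (Floq k)) (θ lam : ℝ) (c : Modes k) :
    IsTrig 3 (fun φ => m.ord₁ θ lam (aStar k φ) (ev φ c)) :=
  ((isTrig_ev c).clm (m.E lam)).add
    (((isTrig_aStar k).clm (m.B θ lam)).clm_apply_aStar.mono (by norm_num))

/-- The product of a(φ) with the first-order correction has degree 3 only because that correction
lacks mode 3; this is what the two vanishing coefficients ensure. With a nonzero mode 3, truncation
could change the second-order equation. -/
theorem Expansion.isTrig_ord₂ (m : Expansion (Floq k)) (θ lam l₂ κ : ℝ) {c : Modes k}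
    (h5 : c 5 = 0) (h6 : c 6 = 0) (d : Modes k) :
    IsTrig 3 (fun φ => m.ord₂ θ lam l₂ κ (aStar k φ) (ev φ c) (ev φ d)) := by
  have hz := isTrig_two_ev h5 h6
  have hB₁ := (hz.clm (m.B θ lam).flip).clm_apply_aStar
  have hB₂ := (hz.clm (m.B θ lam)).clm_apply_aStar
  have hC := (((isTrig_aStar k).clm (m.C θ lam 0)).clm_apply_aStar).clm_apply_aStar
  have ha := (isTrig_aStar k).mono (show 1 ≤ 3 by norm_num)
  refine ((((isTrig_ev d).clm (m.E lam)).add (ha.clm (l₂ • deriv m.E lam))).add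
    ((hB₁.add hB₂).add (hC.add (ha.clm (-κ • m.Q θ lam))))).congr fun φ => ?_
  simp only [Expansion.ord₂, smul_apply, ContinuousLinearMap.flip_apply]
  module

/-- Jets at each fixed φ carry no uniformity and cannot be integrated as they stand. Joint
smoothness provides an expansion with a remainder continuous in (φ, ε), and uniqueness of jets
identifies its coefficients with the given ones. -/
theorem jet_coef {f : ℝ → ℝ → Floq k} (hf : ContDiff ℝ 4 (fun p : ℝ × ℝ => f p.1 p.2))
    {J₀ J₁ J₂ : ℝ → Floq k} (hJ : ∀ φ, Jet (f φ) (J₀ φ) (J₁ φ) (J₂ φ)) :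
    Jet (fun ε => coef (fun φ => f φ ε)) (coef J₀) (coef J₁) (coef J₂) := by
  obtain ⟨q₁, q₂, r, h₁, h₂, hr, h⟩ := exists_taylor_three (n := 1) hf
  have hs : ∀ φ, Jet (f φ) (f φ 0) (q₁ φ) (q₂ φ) := fun φ => by
    refine (isBigO_pow_smul (g := r φ)
      (hr.continuous.comp (continuous_const.prodMk continuous_id)) 3).congr_left fun ε => ?_
    rw [h φ ε]
    module
  have e : ∀ φ, J₀ φ = f φ 0 ∧ J₁ φ = q₁ φ ∧ J₂ φ = q₂ φ := fun φ => (hJ φ).unique (hs φ)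
  have hrc : Continuous (fun ε => coef (fun φ => r φ ε)) :=
    (contDiff_one_coef (f := fun ε φ => r φ ε)
      (hr.comp (contDiff_snd.prodMk contDiff_fst))).continuous
  have h0c : Continuous (fun φ => f φ 0) :=
    hf.continuous.comp (continuous_id.prodMk continuous_const)
  have hrφ : ∀ ε, Continuous (fun φ => r φ ε) := fun ε =>
    hr.continuous.comp (continuous_id.prodMk continuous_const)
  have hc : ∀ {g : ℝ → Floq k} (a : ℝ), Continuous g → Continuous (fun φ => a • g φ) :=
    fun a hg => hg.const_smul a
  refine (isBigO_pow_smul hrc 3).congr_left fun ε => ?_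
  rw [funext fun φ => (e φ).1, funext fun φ => (e φ).2.1, funext fun φ => (e φ).2.2]
  have : coef (fun φ => f φ ε) = coef (fun φ => f φ 0) + ε • coef q₁ + ε ^ 2 • coef q₂ +
      ε ^ 3 • coef (fun φ => r φ ε) := by
    rw [← coef_smul, ← coef_smul, ← coef_smul, funext fun φ => h φ ε]
    have h1 := coef_add h0c (hc ε h₁.continuous)
    have h2 := coef_add (f := fun φ => f φ 0 + ε • q₁ φ) (h0c.add (hc ε h₁.continuous))
      (hc (ε ^ 2) h₂.continuous)
    have h3 := coef_add (f := fun φ => f φ 0 + ε • q₁ φ + ε ^ 2 • q₂ φ)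
      ((h0c.add (hc ε h₁.continuous)).add (hc (ε ^ 2) h₂.continuous)) (hc (ε ^ 3) (hrφ ε))
    rw [h3, h2, h1]
  simp only [this]
  module

/-- `halfTurn` on functions of `θ`. -/
noncomputable def circTurn : C(Circ, Modes k) →L[ℝ] C(Circ, Modes k) :=
  (halfTurn (k := k)).compLeftContinuous ℝ Circ

@[simp] theorem circTurn_apply (y : C(Circ, Modes k)) (t : Circ) :
    circTurn y t = halfTurn (y t) := rfl

/-- The first two Taylor coefficients of a branch of solutions. -/
structure BranchJets (m : Expansion (Floq k)) (lamS omS : ℝ) (Y W : ℝ → C(Circ, Modes k))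
    (μ : ℝ → Param) (Y₁ Y₂ W₁ W₂ : C(Circ, Modes k)) (κ l₂ o₂ : ℝ) : Prop where
  deriv₁ : ∀ θ : ℝ, HasDerivAt (fun s : ℝ => Y₁ s) (W₁ θ) θ
  deriv₂ : ∀ θ : ℝ, HasDerivAt (fun s : ℝ => Y₂ s) (W₂ θ) θ
  parity₁ : ∀ t, halfTurn (Y₁ t) = Y₁ t
  parity₂ : ∀ t, halfTurn (Y₂ t) = -Y₂ t
  phase₁ : phaseL k (∫ s in (0 : ℝ)..2 * Real.pi, Y₁ s) = 0
  phase₂ : phaseL k (∫ s in (0 : ℝ)..2 * Real.pi, Y₂ s) = 0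
  equation₁ : ∀ θ φ : ℝ, ev φ (W₁ θ) = m.ord₁ θ lamS (aStar k φ) (ev φ (Y₁ θ)) -
    κ • eLast k - omS • ev φ (rot (Y₁ θ))
  equation₂ : ∀ θ φ : ℝ, ev φ (W₂ θ) =
    m.ord₂ θ lamS l₂ κ (aStar k φ) (ev φ (Y₁ θ)) (ev φ (Y₂ θ)) -
    omS • ev φ (rot (Y₂ θ)) - o₂ • ev φ (rot (crit k))
  odd_Y : (fun ε => Y ε + circTurn (Y ε) - ε • (2 : ℝ) • Y₁) =O[𝓝[≠] 0] (fun ε : ℝ => ε ^ 3)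
  odd_W : (fun ε => W ε + circTurn (W ε) - ε • (2 : ℝ) • W₁) =O[𝓝[≠] 0] (fun ε : ℝ => ε ^ 3)
  even_Y : (fun ε => Y ε - circTurn (Y ε) - (2 : ℝ) • circConst (crit k) - ε ^ 2 • (2 : ℝ) • Y₂)
    =O[𝓝[≠] 0] (fun ε : ℝ => ε ^ 4)
  even_W : (fun ε => W ε - circTurn (W ε) - ε ^ 2 • (2 : ℝ) • W₂)
    =O[𝓝[≠] 0] (fun ε : ℝ => ε ^ 4)
  lam : (fun ε => (μ ε).1 - lamS - ε ^ 2 * l₂) =O[𝓝[≠] 0] (fun ε : ℝ => ε ^ 4)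
  om : (fun ε => (μ ε).2.1 - omS - ε ^ 2 * o₂) =O[𝓝[≠] 0] (fun ε : ℝ => ε ^ 4)
  eta : (fun ε => (μ ε).2.2 - ε * κ) =O[𝓝[≠] 0] (fun ε : ℝ => ε ^ 3)

theorem Branch.W_zero {m : Expansion (Floq k)} {lamS omS : ℝ} {n : ℕ}
    {Y W : ℝ → C(Circ, Modes k)} {μ : ℝ → Param} (hB : Branch m lamS omS n Y W μ) : W 0 = 0 := by
  ext1 t
  induction t using circ_forall with | _ θ
  have h := hB.hasDerivAt.self_of_nhds θ
  simp only [hB.Y_zero, circConst_apply] at h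
  exact h.unique (hasDerivAt_const θ _)

theorem Branch.contDiff_G {m : Expansion (Floq k)} {lamS omS : ℝ}
    {Y W : ℝ → C(Circ, Modes k)} {μ : ℝ → Param} (hB : Branch m lamS omS 4 Y W μ) (θ : ℝ) :
    ContDiff ℝ 4 (fun p : ℝ × ℝ => m.G (ev p.1 (Y p.2 θ)) (μ p.2).1 (μ p.2).2.2 θ p.2) := by
  have h4 : (4 : WithTop ℕ∞) ≤ ∞ :=
    show (((4 : ℕ∞) : WithTop ℕ∞)) ≤ ∞ from WithTop.coe_le_coe.2 le_top
  have hYθ : ContDiff ℝ 4 (fun ε => Y ε θ) :=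
    (ContinuousMap.evalCLM ℝ (θ : Circ) : C(Circ, Modes k) →L[ℝ] Modes k).contDiff.comp hB.smooth_Y
  have hμ : ContDiff ℝ 4 (fun p : ℝ × ℝ => μ p.2) := ContDiff.comp hB.smooth_μ contDiff_snd
  exact m.contDiff_G h4 (((contDiff_ev.of_le h4).comp contDiff_fst).clm_apply
    (hYθ.comp contDiff_snd)) hμ.fst hμ.snd.snd contDiff_const contDiff_snd

set_option maxHeartbeats 1600000 in
-- Parity gives the form of the expansions. Comparing the coefficients of ε and ε² in the equation,
-- where truncation acts trivially by degree, gives the two linear equations.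
theorem Branch.exists_jets {m : Expansion (Floq k)} {lamS omS : ℝ}
    {Y W : ℝ → C(Circ, Modes k)} {μ : ℝ → Param} (hB : Branch m lamS omS 4 Y W μ) :
    ∃ Y₁ Y₂ W₁ W₂ κ l₂ o₂, BranchJets m lamS omS Y W μ Y₁ Y₂ W₁ W₂ κ l₂ o₂ := by
  have hinv : ∀ y : C(Circ, Modes k), circTurn (circTurn y) = y := fun y => by
    ext1 t
    funext j
    simp only [circTurn_apply, halfTurn_apply]
    rw [smul_smul, ← abs_mul_abs_self, abs_turnSign, one_mul, one_smul]
  -- The signs are chosen so that μ(−ε) = −T μ(ε), which puts the parameters into the same framework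
  -- as `halfTurn` does the functions.
  let T : Param →L[ℝ] Param := (-ContinuousLinearMap.fst ℝ ℝ (ℝ × ℝ)).prod
    (((-ContinuousLinearMap.fst ℝ ℝ ℝ).prod (ContinuousLinearMap.snd ℝ ℝ ℝ)).comp
      (ContinuousLinearMap.snd ℝ ℝ (ℝ × ℝ)))
  have hT : ∀ ν, T ν = (-ν.1, -ν.2.1, ν.2.2) := fun ν => rfl
  have hpar := hB.parity
  obtain ⟨Y₁, Y₂, hY₁, hY₂, hYj, hYo, hYe⟩ := parity_expansion hinv hB.smooth_Y
    (hpar.mono fun ε h => by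
      ext1 t
      induction t using circ_forall with | _ θ
      exact h.1 θ)
  obtain ⟨W₁, W₂, hW₁, hW₂, hWj, hWo, hWe⟩ := parity_expansion hinv hB.smooth_W
    (hpar.mono fun ε h => by
      ext1 t
      induction t using circ_forall with | _ θ
      exact h.2.1 θ)
  obtain ⟨μ₁, μ₂, hμ₁, hμ₂, hμj, hμo, hμe⟩ := parity_expansion (H := T) (fun ν => by simp [hT])
    hB.smooth_μ (hpar.mono fun ε h => by rw [h.2.2, hT]; simp)
  rw [hB.Y_zero] at hYj hYe
  rw [hB.W_zero] at hWj hWe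
  rw [hB.μ_zero] at hμj hμe
  rw [hT, Prod.ext_iff, Prod.ext_iff] at hμ₁ hμ₂
  have hμ11 : μ₁.1 = 0 := by have := hμ₁.1; simp only at this; linarith
  have hμ12 : μ₁.2.1 = 0 := by have := hμ₁.2.1; simp only at this; linarith
  have hμ23 : μ₂.2.2 = 0 := by
    have := hμ₂.2.2; simp only [Prod.snd_neg] at this; linarith
  have hlam := hμj.clm (ContinuousLinearMap.fst ℝ ℝ (ℝ × ℝ))
  have hom := hμj.clm ((ContinuousLinearMap.fst ℝ ℝ ℝ).comp (ContinuousLinearMap.snd ℝ ℝ (ℝ × ℝ)))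
  have heta := hμj.clm ((ContinuousLinearMap.snd ℝ ℝ ℝ).comp (ContinuousLinearMap.snd ℝ ℝ (ℝ × ℝ)))
  simp only [ContinuousLinearMap.comp_apply, ContinuousLinearMap.coe_fst',
    ContinuousLinearMap.coe_snd', hμ11, hμ12, hμ23] at hlam hom heta
  -- the derivative in `θ`
  have hder : ∀ {y w : C(Circ, Modes k)}, y - circConst (y ((0 : ℝ) : Circ)) - circPrim w = 0 ↔
      ∀ θ : ℝ, HasDerivAt (fun s : ℝ => y s) (w θ) θ := by
    intro y w
    rw [← hasDerivAt_iff_circPrim, sub_sub, sub_eq_zero]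
    rfl
  -- The relation between a function and its derivative is the kernel of a bounded linear operator
  -- on continuous functions, so it passes to every Taylor coefficient.
  have hd := (((hYj.sub (hYj.clm (circConst.comp
      (ContinuousMap.evalCLM ℝ ((0 : ℝ) : Circ))))).sub (hWj.clm circPrim)).congr
      (g := fun _ => 0) (by
        filter_upwards [hB.hasDerivAt.filter_mono nhdsWithin_le_nhds] with ε h
        exact hder.2 h)).eq_zero.2
  -- the phase conditions
  have hph : phaseL k (circInt Y₁) = 0 ∧ phaseL k (circInt Y₂) = 0 := by
    have h1 := (hYj.clm ((phaseL k).comp circInt)).congr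
      (g := fun _ => phaseL k ((2 * Real.pi) • crit k)) (by
        filter_upwards [hB.phase.filter_mono nhdsWithin_le_nhds] with ε h
        exact h)
    exact (h1.unique (Jet.const _)).2
  -- the equation at fixed `θ`
  have heq : ∀ θ φ : ℝ, ev φ (W₁ θ) = m.ord₁ θ lamS (aStar k φ) (ev φ (Y₁ θ)) -
      μ₁.2.2 • eLast k - omS • ev φ (rot (Y₁ θ)) ∧
      ev φ (W₂ θ) = m.ord₂ θ lamS μ₂.1 μ₁.2.2 (aStar k φ) (ev φ (Y₁ θ)) (ev φ (Y₂ θ)) -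
      omS • ev φ (rot (Y₂ θ)) - μ₂.2.1 • ev φ (rot (crit k)) := fun θ φ => by
    have hY := hYj.clm (ContinuousMap.evalCLM ℝ (θ : Circ))
    have hW := hWj.clm (ContinuousMap.evalCLM ℝ (θ : Circ))
    have hJ := jet_coef (f := fun φ ε => m.G (ev φ (Y ε θ)) (μ ε).1 (μ ε).2.2 θ ε)
      (hB.contDiff_G θ)
      (fun φ => m.jet_G θ (hY.clm (ev φ)) hlam heta)
    have h1 := (((Jet.const (1 : ℝ)).add heta.id_smul).smul hW).congr
      (g := fun ε => m.field θ (Y ε θ) (μ ε) ε) (by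
        filter_upwards [hB.equation.filter_mono nhdsWithin_le_nhds] with ε h
        exact h θ)
    have h2 := (hJ.sub (heta.smul (Jet.const (lastMode k)))).sub (hom.smul (hY.clm rot))
    have h3 := h1.unique h2
    -- Parity restricts the first-order coefficient to even modes; the absence of mode 3 is what
    -- `isTrig_ord₂` asks for.
    have h5 : Y₁ (θ : Circ) 5 = 0 ∧ Y₁ (θ : Circ) 6 = 0 := by
      have h := DFunLike.congr_fun hY₁ (θ : Circ)
      have h5 := congrFun h 5
      have h6 := congrFun h 6
      simp only [circTurn_apply, halfTurn_apply, turnSign] at h5 h6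
      simp only [Matrix.cons_val, neg_smul, one_smul] at h5 h6
      exact ⟨eq_zero_of_neg_eq_self h5, eq_zero_of_neg_eq_self h6⟩
    have e1 := congrArg (ev φ) h3.2.1
    have e2 := congrArg (ev φ) h3.2.2
    simp only [ContinuousMap.evalCLM_apply, circConst_apply, ev_crit, map_sub, map_add,
      map_smul] at e1 e2
    rw [(m.isTrig_ord₁ θ lamS (Y₁ θ)).ev_coef φ] at e1
    rw [(m.isTrig_ord₂ θ lamS μ₂.1 μ₁.2.2 h5.1 h5.2 (Y₂ θ)).ev_coef φ] at e2
    constructor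
    · simpa [ev_lastMode] using e1
    · simpa [ev_lastMode, sub_sub] using e2
  refine ⟨Y₁, Y₂, W₁, W₂, μ₁.2.2, μ₂.1, μ₂.2.1, hder.1 hd.1, hder.1 hd.2,
    fun t => DFunLike.congr_fun hY₁ t, fun t => DFunLike.congr_fun hY₂ t, hph.1, hph.2,
    fun θ φ => (heq θ φ).1, fun θ φ => (heq θ φ).2, hYo, hWo, hYe, ?_, ?_, ?_, ?_⟩
  · simpa using hWe
  · refine ((((2⁻¹ : ℝ) • ContinuousLinearMap.fst ℝ ℝ (ℝ × ℝ)).isBigO_comp _ _).trans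
      hμe).congr_left fun ε => ?_
    simp [hT]
    ring
  · refine ((((2⁻¹ : ℝ) • (ContinuousLinearMap.fst ℝ ℝ ℝ).comp
      (ContinuousLinearMap.snd ℝ ℝ (ℝ × ℝ))).isBigO_comp _ _).trans hμe).congr_left fun ε => ?_
    simp [hT]
    ring
  · refine ((((2⁻¹ : ℝ) • (ContinuousLinearMap.snd ℝ ℝ ℝ).comp
      (ContinuousLinearMap.snd ℝ ℝ (ℝ × ℝ))).isBigO_comp _ _).trans hμo).congr_left fun ε => ?_
    simp [hT]
    ring

end BranchJets

end NeimarkSacker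

namespace NeimarkSacker

/-! ### The near-identity map on the unit circle -/

section Gdag

variable {k : ℕ}

/-- The Fourier coefficients of the quadratic part of the near-identity map on the unit circle. -/
def NormalForm.modes₁ (N : NormalForm k) (θ : ℝ) : Modes k :=
  ![(N.ah0 θ, N.at0 θ, N.ar0 θ), 0, 0, (N.ah2 θ, N.at2 θ, N.ar2 θ), (N.bh2 θ, N.bt2 θ, N.br2 θ),
    0, 0]

/-- The Fourier coefficients of the cubic part of the near-identity map on the unit circle. -/
def NormalForm.modes₂ (N : NormalForm k) (θ : ℝ) : Modes k :=
  ![0, (N.ah1 θ, 0, 0), (N.bh1 θ, 0, 0), 0, 0, (N.ah3 θ, 0, 0), (N.bh3 θ, 0, 0)]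

/-- The three components of the near-identity map. -/
noncomputable def NormalForm.h (N : NormalForm k) (θ : ℝ) (y : EuclideanSpace ℝ (Fin 2)) : Floq k :=
  (N.hHat θ y, N.hTilde θ y, N.hRing θ y)

theorem NormalForm.contDiff_h (N : NormalForm k) (θ : ℝ) : ContDiff ℝ ∞ (N.h θ) := by
  have h0 : ContDiff ℝ ∞ (fun y : EuclideanSpace ℝ (Fin 2) => y 0) :=
    (EuclideanSpace.proj 0 : EuclideanSpace ℝ (Fin 2) →L[ℝ] ℝ).contDiff
  have h1 : ContDiff ℝ ∞ (fun y : EuclideanSpace ℝ (Fin 2) => y 1) :=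
    (EuclideanSpace.proj 1 : EuclideanSpace ℝ (Fin 2) →L[ℝ] ℝ).contDiff
  unfold NormalForm.h NormalForm.hHat NormalForm.hTilde NormalForm.hRing
  fun_prop

/-- The chosen bases of quadratic and cubic forms restrict on the circle to 1, cos 2φ, sin 2φ and to
cos φ, sin φ, cos 3φ, sin 3φ, by the double and triple angle formulas. This makes normal form
coefficients comparable with Fourier coefficients. -/
theorem NormalForm.h_circle (N : NormalForm k) (θ φ t : ℝ) :
    N.h θ (t • aHat φ) = t ^ 2 • ev φ (N.modes₁ θ) + t ^ 3 • ev φ (N.modes₂ θ) := by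
  have c2 : Real.cos (2 * φ) = Real.cos φ ^ 2 - Real.sin φ ^ 2 := Real.cos_two_mul' φ
  have s2 : Real.sin (2 * φ) = 2 * Real.sin φ * Real.cos φ := Real.sin_two_mul φ
  have hcs := Real.sin_sq_add_cos_sq φ
  have c3 : Real.cos (3 * φ) = Real.cos φ * (Real.cos φ ^ 2 - 3 * Real.sin φ ^ 2) := by
    rw [Real.cos_three_mul]
    linear_combination (3 * Real.cos φ) * hcs
  have s3 : Real.sin (3 * φ) = Real.sin φ * (3 * Real.cos φ ^ 2 - Real.sin φ ^ 2) := by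
    rw [Real.sin_three_mul]
    linear_combination (-3 * Real.sin φ) * hcs
  have e0 : (t • aHat φ) 0 = t * Real.cos φ := by simp [aHat]
  have e1 : (t • aHat φ) 1 = t * Real.sin φ := by simp [aHat]
  have r : (t * Real.cos φ) ^ 2 + (t * Real.sin φ) ^ 2 = t ^ 2 := by
    linear_combination t ^ 2 * hcs
  rw [ev_eq, ev_eq]
  simp only [NormalForm.h, NormalForm.hHat, NormalForm.hTilde, NormalForm.hRing, e0, e1, r,
    NormalForm.modes₁, NormalForm.modes₂, Matrix.cons_val, c2, s2, c3, s3]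
  refine Prod.ext ?_ (Prod.ext ?_ ?_)
  · simp only [Prod.fst_add, Prod.smul_fst, smul_zero, add_zero, zero_add]
    module
  · simp only [Prod.fst_add, Prod.snd_add, Prod.smul_fst, Prod.smul_snd,
      smul_zero, add_zero, zero_add]
    module
  · simp only [Prod.snd_add, Prod.smul_snd, smul_zero, add_zero, zero_add,
      smul_eq_mul]
    ring

/-- Along every ray h is of order t², and the rays at angles 0 and π/2 span the plane. -/
theorem NormalForm.fderiv_h_zero (N : NormalForm k) (θ : ℝ) : fderiv ℝ (N.h θ) 0 = 0 := by
  have hd := ((N.contDiff_h θ).differentiable (by simp) 0).hasFDerivAt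
  have h1 : ∀ φ, fderiv ℝ (N.h θ) 0 (aHat φ) = 0 := fun φ => by
    have hl : HasDerivAt (fun t : ℝ => t • aHat φ) (aHat φ) 0 := by
      simpa using (hasDerivAt_id (0 : ℝ)).smul_const (aHat φ)
    have h2 : HasDerivAt (fun t : ℝ => N.h θ (t • aHat φ)) (fderiv ℝ (N.h θ) 0 (aHat φ)) 0 := by
      have hd' : HasFDerivAt (N.h θ) (fderiv ℝ (N.h θ) 0) ((0 : ℝ) • aHat φ) := by
        rwa [zero_smul]
      exact hd'.comp_hasDerivAt 0 hl
    have h3 : HasDerivAt (fun t : ℝ => N.h θ (t • aHat φ)) 0 0 := by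
      simp only [N.h_circle]
      have := ((hasDerivAt_pow 2 (0 : ℝ)).smul_const (ev φ (N.modes₁ θ) : Floq k)).add
        ((hasDerivAt_pow 3 (0 : ℝ)).smul_const (ev φ (N.modes₂ θ) : Floq k))
      refine this.congr_deriv ?_
      simp
    exact h2.unique h3
  ext1 v
  have hv : v = v 0 • aHat 0 + v 1 • aHat (Real.pi / 2) := by
    ext i
    fin_cases i <;> simp [aHat]
  rw [hv, map_add, map_smul, map_smul, h1, h1]
  simp

theorem NormalForm.Z_circle (N : NormalForm k) (ε θ φ : ℝ) : N.Z ε θ (aStar k φ) =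
    aStar k φ + ε • ev φ (N.modes₁ θ) + ε ^ 2 • ev φ (N.modes₂ θ) := by
  have h : N.Z ε θ (aStar k φ) = aStar k φ + ε⁻¹ • N.h θ (ε • aHat φ) := rfl
  rw [h, N.h_circle, smul_add, smul_smul, smul_smul, add_assoc]
  rcases eq_or_ne ε 0 with rfl | hε
  · simp
  · rw [show ε⁻¹ * ε ^ 2 = ε by field_simp, show ε⁻¹ * ε ^ 3 = ε ^ 2 by field_simp]

/-- The derivative of `h` along the unit circle scaled by `ε`. -/
noncomputable def NormalForm.slope (N : NormalForm k) (θ φ ε : ℝ) :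
    EuclideanSpace ℝ (Fin 2) →L[ℝ] Floq k :=
  fderiv ℝ (N.h θ) (ε • aHat φ)

theorem NormalForm.slope_isBigO (N : NormalForm k) (θ φ : ℝ) :
    (fun ε => N.slope θ φ ε) =O[𝓝[≠] 0] fun ε : ℝ => ε := by
  have hc : ContDiff ℝ 1 (fun ε : ℝ => N.slope θ φ ε) := by
    have h1 : ContDiff ℝ 1 (fderiv ℝ (N.h θ)) :=
      (N.contDiff_h θ).fderiv_right (by norm_cast)
    exact h1.comp (contDiff_id.smul contDiff_const)
  have h2 := (hc.differentiable one_ne_zero 0).hasDerivAt.hasFDerivAt.isBigO_sub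
  have h0 : N.slope θ φ 0 = 0 := by rw [NormalForm.slope, zero_smul, N.fderiv_h_zero]
  simp only [h0, sub_zero] at h2
  exact h2.mono nhdsWithin_le_nhds

theorem NormalForm.hasFDerivAt_Z (N : NormalForm k) {ε : ℝ} (hε : ε ≠ 0) (θ φ : ℝ) :
    HasFDerivAt (fun w => N.Z ε θ w) (ContinuousLinearMap.id ℝ (Floq k) +
      (N.slope θ φ ε).comp (ContinuousLinearMap.fst ℝ _ _)) (aStar k φ) := by
  have h1 := ((N.contDiff_h θ).differentiable (by simp) (ε • aHat φ)).hasFDerivAt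
  have h2 : HasFDerivAt (fun w : Floq k => ε • w.1) (ε • ContinuousLinearMap.fst ℝ _ _)
      (aStar k φ) :=
    (ε • ContinuousLinearMap.fst ℝ (EuclideanSpace ℝ (Fin 2))
      (EuclideanSpace ℝ (Fin k) × ℝ)).hasFDerivAt
  have h3 := (hasFDerivAt_id (𝕜 := ℝ) (aStar k φ)).add
    ((h1.comp (aStar k φ) h2).const_smul ε⁻¹)
  refine h3.congr_fderiv ?_
  rw [ContinuousLinearMap.comp_smul, smul_smul, inv_mul_cancel₀ hε, one_smul]
  rfl

theorem hasDerivAt_aStar (φ : ℝ) : HasDerivAt (aStar k) (ev φ (rot (crit k))) φ := by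
  rw [show aStar k = fun s => ev s (crit k) from funext fun s => (ev_crit s).symm]
  exact hasDerivAt_ev _ φ

/-- Obtained by differentiating `Z_circle` in φ. The leading term of G† is ω a'(φ), tangent to the
circle, so the derivative of the map acts on it as d/dφ acts on Fourier coefficients. -/
theorem NormalForm.slope_tangent (N : NormalForm k) {ε : ℝ} (hε : ε ≠ 0) (θ φ : ℝ) :
    N.slope θ φ ε (ev φ (rot (crit k))).1 =
      ε • ev φ (rot (N.modes₁ θ)) + ε ^ 2 • ev φ (rot (N.modes₂ θ)) := by
  have h1 := (N.hasFDerivAt_Z hε θ φ).comp_hasDerivAt φ (hasDerivAt_aStar φ)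
  have h2 := ((hasDerivAt_aStar (k := k) φ).add
    ((hasDerivAt_ev (N.modes₁ θ) φ).const_smul ε)).add
    ((hasDerivAt_ev (N.modes₂ θ) φ).const_smul (ε ^ 2))
  have h3 := h1.unique (h2.congr_of_eventuallyEq (Eventually.of_forall fun s =>
    N.Z_circle ε θ s))
  simp only [add_apply, ContinuousLinearMap.id_apply, ContinuousLinearMap.comp_apply,
    ContinuousLinearMap.coe_fst', add_assoc] at h3
  exact add_left_cancel h3

theorem NormalForm.deriv_Z (N : NormalForm k) {ε θ φ : ℝ} {d₁ d₂ : Modes k}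
    (h₁ : HasDerivAt N.modes₁ d₁ θ) (h₂ : HasDerivAt N.modes₂ d₂ θ) :
    deriv (fun s => N.Z ε s (aStar k φ)) θ = ε • ev φ d₁ + ε ^ 2 • ev φ d₂ := by
  simp only [N.Z_circle]
  have := ((((ev (W := Floq k) φ).hasFDerivAt.comp_hasDerivAt θ h₁).const_smul ε).const_add
    (aStar k φ)).add (((ev (W := Floq k) φ).hasFDerivAt.comp_hasDerivAt θ h₂).const_smul (ε ^ 2))
  exact this.deriv

theorem Jet.isBigO_sq_iff {V : Type} [NormedAddCommGroup V] [NormedSpace ℝ V] {f : ℝ → V}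
    {p₁ p₂ : V} (h : Jet f 0 p₁ p₂) : f =O[𝓝[≠] 0] (fun ε : ℝ => ε ^ 2) ↔ p₁ = 0 := by
  have h3 : (fun ε => f ε - ε • p₁) =O[𝓝[≠] 0] (fun ε : ℝ => ε ^ 2) := by
    refine ((IsBigO.trans h (isBigO_pow_pow (show 2 ≤ 3 by norm_num))).add
      (isBigO_pow_smul (g := fun _ => p₂) continuous_const 2)).congr_left fun ε => ?_
    module
  constructor
  · intro hf
    have h4 := hf.sub h3
    refine eq_zero_of_isBigO_one_sub ?_
    have h5 := (isBigO_refl (fun ε : ℝ => ε⁻¹) (𝓝[≠] 0)).smul h4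
    refine h5.congr' ?_ ?_
    · filter_upwards [self_mem_nhdsWithin] with ε hε
      rw [sub_sub_cancel, inv_smul_smul₀ hε]
    · filter_upwards [self_mem_nhdsWithin] with ε hε
      have : ε ≠ 0 := hε
      rw [smul_eq_mul]
      field_simp
  · rintro rfl
    simpa using h3

theorem Jet.isBigO_cube_iff {V : Type} [NormedAddCommGroup V] [NormedSpace ℝ V] {f : ℝ → V}
    {p₁ p₂ : V} (h : Jet f 0 p₁ p₂) :
    f =O[𝓝[≠] 0] (fun ε : ℝ => ε ^ 3) ↔ p₁ = 0 ∧ p₂ = 0 := by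
  constructor
  · intro hf
    have h1 : Jet f 0 0 0 := by simpa [Jet] using hf
    exact (h.unique h1).2
  · rintro ⟨rfl, rfl⟩
    simpa [Jet] using h

/-- Orders of the components are unchanged by a near-identity map of triangular form. -/
theorem isBigO_triangular {V₁ V₂ : Type} [NormedAddCommGroup V₁] [NormedSpace ℝ V₁]
    [NormedAddCommGroup V₂] [NormedSpace ℝ V₂] {Φ : ℝ → V₁ →L[ℝ] V₁ × V₂}
    (hΦ : Φ =O[𝓝[≠] 0] fun ε : ℝ => ε) {x R : ℝ → V₁ × V₂}
    (h : ∀ᶠ ε in 𝓝[≠] 0, x ε + Φ ε (x ε).1 = R ε) :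
    ((fun ε => (x ε).1) =O[𝓝[≠] 0] (fun ε : ℝ => ε ^ 3) ∧
      (fun ε => (x ε).2) =O[𝓝[≠] 0] (fun ε : ℝ => ε ^ 2)) ↔
    ((fun ε => (R ε).1) =O[𝓝[≠] 0] (fun ε : ℝ => ε ^ 3) ∧
      (fun ε => (R ε).2) =O[𝓝[≠] 0] (fun ε : ℝ => ε ^ 2)) := by
  have hΦ1 : ∀ {n : ℕ}, (fun ε => (x ε).1) =O[𝓝[≠] 0] (fun ε : ℝ => ε ^ n) →
      (fun ε => Φ ε (x ε).1) =O[𝓝[≠] 0] (fun ε : ℝ => ε ^ (n + 1)) := by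
    intro n hx
    refine ((IsBigO.of_bound 1 (Eventually.of_forall fun ε => ?_)).trans
      (hΦ.norm_left.mul hx.norm_left)).congr_right fun ε => by ring
    rw [one_mul, Real.norm_of_nonneg (by positivity)]
    exact (Φ ε).le_opNorm _
  have hfst : ∀ {u : ℝ → V₁ × V₂} {g : ℝ → ℝ}, u =O[𝓝[≠] 0] g →
      (fun ε => (u ε).1) =O[𝓝[≠] 0] g := fun hu =>
    (IsBigO.of_bound 1 (Eventually.of_forall fun ε => by
      simpa using norm_fst_le _)).trans hu
  have hsnd : ∀ {u : ℝ → V₁ × V₂} {g : ℝ → ℝ}, u =O[𝓝[≠] 0] g →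
      (fun ε => (u ε).2) =O[𝓝[≠] 0] g := fun hu =>
    (IsBigO.of_bound 1 (Eventually.of_forall fun ε => by
      simpa using norm_snd_le _)).trans hu
  constructor
  · rintro ⟨h1, h2⟩
    have h3 := (hΦ1 h1).trans (isBigO_pow_pow (show 3 ≤ 3 + 1 by norm_num))
    constructor
    · refine (h1.add (hfst h3)).congr' ?_ EventuallyEq.rfl
      filter_upwards [h] with ε h
      rw [← h]
      rfl
    · refine (h2.add ((hsnd h3).trans (isBigO_pow_pow (show 2 ≤ 3 by norm_num)))).congr' ?_
        EventuallyEq.rfl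
      filter_upwards [h] with ε h
      rw [← h]
      rfl
  · rintro ⟨h1, h2⟩
    -- Once `Φ` has norm below 1/2, its contribution is absorbed into the left side and the first
    -- component of `x` is bounded by twice that of `R`.
    have hsmall : ∀ᶠ ε in 𝓝[≠] (0 : ℝ), ‖Φ ε‖ < 1 / 2 := by
      have ht : Tendsto Φ (𝓝[≠] 0) (𝓝 0) :=
        hΦ.trans_tendsto (tendsto_id.mono_left nhdsWithin_le_nhds)
      have := ht.norm
      rw [norm_zero] at this
      exact this.eventually_lt_const (by norm_num)
    have hx : (fun ε => (x ε).1) =O[𝓝[≠] 0] (fun ε : ℝ => ε ^ 3) := by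
      refine (IsBigO.of_bound 2 ?_).trans h1
      filter_upwards [h, hsmall] with ε h hs
      have e : (x ε).1 = (R ε).1 - (Φ ε (x ε).1).1 := by rw [← h]; simp
      have h3 : ‖(Φ ε (x ε).1).1‖ ≤ 1 / 2 * ‖(x ε).1‖ :=
        (norm_fst_le _).trans (((Φ ε).le_opNorm _).trans (by gcongr))
      have h4 := norm_sub_le (R ε).1 (Φ ε (x ε).1).1
      rw [← e] at h4
      linarith
    refine ⟨hx, ?_⟩
    have h3 := hsnd ((hΦ1 hx).trans (isBigO_pow_pow (show 2 ≤ 3 + 1 by norm_num)))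
    refine (h2.sub h3).congr' ?_ EventuallyEq.rfl
    filter_upwards [h] with ε h
    rw [← h]
    simp

theorem eventually_isInvertible {V₁ V₂ : Type} [NormedAddCommGroup V₁] [NormedSpace ℝ V₁]
    [NormedAddCommGroup V₂] [NormedSpace ℝ V₂] [CompleteSpace V₁] [CompleteSpace V₂]
    {Φ : ℝ → V₁ →L[ℝ] V₁ × V₂} (hΦ : Φ =O[𝓝[≠] 0] fun ε : ℝ => ε) :
    ∀ᶠ ε in 𝓝[≠] (0 : ℝ), (ContinuousLinearMap.id ℝ (V₁ × V₂) +
      (Φ ε).comp (ContinuousLinearMap.fst ℝ _ _)).IsInvertible := by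
  have ht : Tendsto Φ (𝓝[≠] 0) (𝓝 0) :=
    hΦ.trans_tendsto (tendsto_id.mono_left nhdsWithin_le_nhds)
  have h1 : Tendsto (fun ε => ContinuousLinearMap.id ℝ (V₁ × V₂) +
      (Φ ε).comp (ContinuousLinearMap.fst ℝ _ _)) (𝓝[≠] 0)
      (𝓝 (ContinuousLinearEquiv.refl ℝ (V₁ × V₂) : V₁ × V₂ →L[ℝ] V₁ × V₂)) := by
    have hc : Continuous (fun L : V₁ →L[ℝ] V₁ × V₂ => ContinuousLinearMap.id ℝ (V₁ × V₂) +
        L.comp (ContinuousLinearMap.fst ℝ V₁ V₂)) :=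
      continuous_const.add (continuous_id.clm_comp continuous_const)
    have h2 := (hc.tendsto 0).comp ht
    simpa [Function.comp_def] using h2
  exact h1.eventually (ContinuousLinearEquiv.nhds _)

end Gdag

end NeimarkSacker

namespace NeimarkSacker

/-! ### The normal form conditions as linear equations for Fourier coefficients -/

section NormalFormEquations

variable {k : ℕ}

theorem Family.IsNSPoint.E_aStar {S : Family k} {Λ : Set ℝ} {lamS omS : ℝ}
    (hS : S.IsNSPoint Λ lamS omS) (φ : ℝ) :
    S.E lamS (aStar k φ) = omS • ev φ (rot (crit k)) := by
  rw [← ev_crit, ← ev_mapCoef, hS.mapCoef_crit, map_smul]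

theorem ev_rot_crit (φ : ℝ) : ev φ (rot (crit k)) = (aHatDot φ, 0, 0) := by
  rw [ev_eq, rot_apply]
  refine Prod.ext ?_ (by simp [crit])
  ext i
  fin_cases i <;> simp [crit, aHatDot]

/-- The target of the normal form transformation, in the image of its derivative. -/
noncomputable def NormalForm.defect (m : Expansion (Floq k)) (N : NormalForm k)
    (lamS omS θ φ ε : ℝ) : Floq k :=
  m.G (N.Z ε θ (aStar k φ)) lamS (ε * N.κ) θ ε -
    (1 + ε * (ε * N.κ)) • deriv (fun s => N.Z ε s (aStar k φ)) θ -
    (omS • (ev φ (rot (crit k)) + N.slope θ φ ε (ev φ (rot (crit k))).1) + (ε * N.κ) • eLast k +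
      ε ^ 2 • ((conf N.βR N.βI (aHat φ), 0, 0) + N.slope θ φ ε (conf N.βR N.βI (aHat φ))))

/-- The terms of order zero cancel by E a = ω a'. The slope applied to the β term is O(ε³) in total,
and the factor 1 + ε²κ does not affect the θ-derivative at these orders. -/
theorem NormalForm.jet_defect {m : Expansion (Floq k)} {N : NormalForm k} {lamS omS θ φ : ℝ}
    (hE : m.E lamS (aStar k φ) = omS • ev φ (rot (crit k))) {d₁ d₂ : Modes k}
    (h₁ : HasDerivAt N.modes₁ d₁ θ) (h₂ : HasDerivAt N.modes₂ d₂ θ) :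
    Jet (N.defect m lamS omS θ φ) 0
      (m.ord₁ θ lamS (aStar k φ) (ev φ (N.modes₁ θ)) - ev φ d₁ -
        (omS • ev φ (rot (N.modes₁ θ)) + N.κ • eLast k))
      (m.ord₂ θ lamS 0 N.κ (aStar k φ) (ev φ (N.modes₁ θ)) (ev φ (N.modes₂ θ)) - ev φ d₂ -
        (omS • ev φ (rot (N.modes₂ θ)) + (conf N.βR N.βI (aHat φ), 0, 0))) := by
  have hη : Jet (fun ε : ℝ => ε * N.κ) 0 N.κ 0 := by
    simpa using Jet.id_smul (Jet.const N.κ)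
  have hG := m.jet_G θ (Jet.of_poly (aStar k φ) (ev φ (N.modes₁ θ)) (ev φ (N.modes₂ θ)))
    (Jet.const lamS) hη
  have hd := ((Jet.const (1 : ℝ)).add hη.id_smul).smul (Jet.of_poly 0 (ev φ d₁) (ev φ d₂))
  have hs : (fun ε => ((conf N.βR N.βI (aHat φ), 0, 0) + N.slope θ φ ε (conf N.βR N.βI (aHat φ))) -
      (conf N.βR N.βI (aHat φ), (0 : EuclideanSpace ℝ (Fin k)), (0 : ℝ))) =O[𝓝[≠] 0]
      fun ε : ℝ => ε := by
    simp only [add_sub_cancel_left]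
    refine (IsBigO.of_bound ‖conf N.βR N.βI (aHat φ)‖ (Eventually.of_forall fun ε => ?_)).trans
      (N.slope_isBigO θ φ)
    rw [mul_comm]
    exact ContinuousLinearMap.le_opNorm _ _
  have ht := (((Jet.of_poly (ev φ (rot (crit k))) (ev φ (rot (N.modes₁ θ)))
    (ev φ (rot (N.modes₂ θ)))).clm (omS • ContinuousLinearMap.id ℝ (Floq k))).add
    (hη.smul (Jet.const (eLast k)))).add (Jet.sq_smul hs)
  have := ((hG.sub hd).sub ht).congr (g := N.defect m lamS omS θ φ) (by
    filter_upwards [self_mem_nhdsWithin] with ε hε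
    rw [NormalForm.defect, N.deriv_Z h₁ h₂, N.Z_circle, N.slope_tangent hε]
    simp only [zero_add, smul_apply, ContinuousLinearMap.id_apply, add_assoc, smul_eq_mul])
  refine Eq.mp ?_ this
  simp only [smul_apply, ContinuousLinearMap.id_apply, smul_zero, zero_smul, add_zero, zero_add,
    one_smul, hE, sub_zero, sub_self]

/-- The inverse in the definition of G† is avoided by applying the derivative of the near-identity
map to both sides. Here `x` is what remains of G† after its prescribed part. -/
theorem Family.gdag_eq {S : Family k} {lamS : ℝ} (omS : ℝ)
    {m : Expansion (Floq k)}
    (hG : ∀ z η θ ε, ε ≠ 0 → S.G z lamS η θ ε = m.G z lamS η θ ε)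
    (N : NormalForm k) (θ φ : ℝ) : ∀ᶠ ε in 𝓝[≠] (0 : ℝ), ∃ x : Floq k,
      S.Gdag N (aStar k φ) lamS 0 θ ε = omS • ev φ (rot (crit k)) + (ε * N.κ) • eLast k +
        ε ^ 2 • (conf N.βR N.βI (aHat φ), 0, 0) + x ∧
      x + N.slope θ φ ε x.1 = N.defect m lamS omS θ φ ε := by
  filter_upwards [eventually_isInvertible (N.slope_isBigO θ φ), self_mem_nhdsWithin] with ε hinv hε
  refine ⟨_, (add_sub_cancel _ _).symm, ?_⟩
  set D := ContinuousLinearMap.id ℝ (Floq k) +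
    (N.slope θ φ ε).comp (ContinuousLinearMap.fst ℝ _ _) with hD
  have hDx : ∀ x, x + N.slope θ φ ε x.1 = D x := fun x => rfl
  rw [hDx, map_sub]
  have h1 : D (S.Gdag N (aStar k φ) lamS 0 θ ε) = m.G (N.Z ε θ (aStar k φ)) lamS (ε * N.κ) θ ε -
    (1 + ε * (ε * N.κ)) • deriv (fun s => N.Z ε s (aStar k φ)) θ := by
    simp only [Family.Gdag, (N.hasFDerivAt_Z hε θ φ).fderiv, hG _ _ _ _ hε, zero_add]
    exact hinv.self_apply_inverse _
  rw [h1, NormalForm.defect]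
  congr 1
  simp only [map_add, map_smul]
  congr 2
  simp [hD, eLast]

/-- By `isBigO_triangular` the orders demanded of the remainder are the same as those of the defect.
The ε coefficient must vanish in all components, the ε² coefficient only in the critical ones,
whence one full equation and one projected equation. -/
theorem Family.IsNSPoint.gdag_iff {S : Family k} {Λ : Set ℝ} {lamS omS : ℝ}
    (hS : S.IsNSPoint Λ lamS omS) {m : Expansion (Floq k)} (hE : m.E lamS = S.E lamS)
    (hG : ∀ z η θ ε, ε ≠ 0 → S.G z lamS η θ ε = m.G z lamS η θ ε)
    (N : NormalForm k) (θ φ : ℝ) {d₁ d₂ : Modes k}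
    (h₁ : HasDerivAt N.modes₁ d₁ θ) (h₂ : HasDerivAt N.modes₂ d₂ θ) :
    (((fun ε : ℝ => (S.Gdag N (aStar k φ) lamS 0 θ ε).1 -
        conf (S.αR lamS) (S.αI lamS) (aHat φ) - ε ^ 2 • conf N.βR N.βI (aHat φ))
        =O[𝓝[≠] 0] fun ε : ℝ => ε ^ 3) ∧
      ((fun ε : ℝ => (S.Gdag N (aStar k φ) lamS 0 θ ε).2.1) =O[𝓝[≠] 0] fun ε : ℝ => ε ^ 2) ∧
      ((fun ε : ℝ => (S.Gdag N (aStar k φ) lamS 0 θ ε).2.2 - ε * N.κ) =O[𝓝[≠] 0]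
        fun ε : ℝ => ε ^ 2)) ↔
    ev φ d₁ = m.ord₁ θ lamS (aStar k φ) (ev φ (N.modes₁ θ)) - N.κ • eLast k -
        omS • ev φ (rot (N.modes₁ θ)) ∧
      (ev φ d₂).1 = (m.ord₂ θ lamS 0 N.κ (aStar k φ) (ev φ (N.modes₁ θ))
        (ev φ (N.modes₂ θ)) - omS • ev φ (rot (N.modes₂ θ))).1 - conf N.βR N.βI (aHat φ) := by
  have hEa : m.E lamS (aStar k φ) = omS • ev φ (rot (crit k)) := by rw [hE, hS.E_aStar]
  have hconf : conf (S.αR lamS) (S.αI lamS) (aHat φ) = omS • (ev φ (rot (crit k))).1 := by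
    have := congrArg Prod.fst (hS.E_aStar φ)
    exact this
  have hev := Family.gdag_eq omS hG N θ φ
  let x : ℝ → Floq k := fun ε => S.Gdag N (aStar k φ) lamS 0 θ ε -
    (omS • ev φ (rot (crit k)) + (ε * N.κ) • eLast k + ε ^ 2 • (conf N.βR N.βI (aHat φ), 0, 0))
  have hx : ∀ᶠ ε in 𝓝[≠] (0 : ℝ), x ε + N.slope θ φ ε (x ε).1 = N.defect m lamS omS θ φ ε := by
    filter_upwards [hev] with ε h
    obtain ⟨y, h1, h2⟩ := h
    have : x ε = y := by simp only [x, h1, add_sub_cancel_left]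
    rw [this, h2]
  have hx1 : ∀ ε, (x ε).1 = (S.Gdag N (aStar k φ) lamS 0 θ ε).1 -
      conf (S.αR lamS) (S.αI lamS) (aHat φ) - ε ^ 2 • conf N.βR N.βI (aHat φ) := fun ε => by
    rw [hconf]
    simp [x, eLast, sub_sub]
  have hx21 : ∀ ε, (x ε).2.1 = (S.Gdag N (aStar k φ) lamS 0 θ ε).2.1 := fun ε => by
    simp [x, eLast, ev_rot_crit]
  have hx22 : ∀ ε, (x ε).2.2 = (S.Gdag N (aStar k φ) lamS 0 θ ε).2.2 - ε * N.κ := fun ε => by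
    simp [x, eLast, ev_rot_crit]
  simp only [← hx1, ← hx21, ← hx22]
  have hpair : ((fun ε => (x ε).2.1) =O[𝓝[≠] 0] (fun ε : ℝ => ε ^ 2) ∧
      (fun ε => (x ε).2.2) =O[𝓝[≠] 0] (fun ε : ℝ => ε ^ 2)) ↔
      (fun ε => (x ε).2) =O[𝓝[≠] 0] (fun ε : ℝ => ε ^ 2) :=
    isBigO_prod_left.symm
  rw [hpair, isBigO_triangular (N.slope_isBigO θ φ) hx]
  have hj := NormalForm.jet_defect hEa h₁ h₂
  have hj1 := hj.clm (ContinuousLinearMap.fst ℝ (EuclideanSpace ℝ (Fin 2))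
    (EuclideanSpace ℝ (Fin k) × ℝ))
  have hj2 := hj.clm (ContinuousLinearMap.snd ℝ (EuclideanSpace ℝ (Fin 2))
    (EuclideanSpace ℝ (Fin k) × ℝ))
  rw [map_zero] at hj1 hj2
  have k1 := hj1.isBigO_cube_iff
  have k2 := hj2.isBigO_sq_iff
  simp only [ContinuousLinearMap.coe_fst', ContinuousLinearMap.coe_snd'] at k1 k2
  rw [k1, k2]
  have e1 : ∀ a b c d : Floq k, (a - b - (c + d)).1 = 0 ∧ (a - b - (c + d)).2 = 0 ↔
      b = a - d - c := fun a b c d => by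
    rw [show ((a - b - (c + d)).1 = 0 ∧ (a - b - (c + d)).2 = 0) ↔ a - b - (c + d) = 0 from
      ⟨fun h => Prod.ext h.1 h.2, fun h => by rw [h]; exact ⟨rfl, rfl⟩⟩]
    constructor
    · intro h
      rw [sub_sub, sub_eq_zero] at h
      rw [h]
      abel
    · rintro rfl
      abel
  have e2 : ∀ a b c : Floq k, ∀ d : EuclideanSpace ℝ (Fin 2), (a - b - (c + (d, 0, 0))).1 = 0 ↔
      b.1 = (a - c).1 - d := fun a b c d => by
    simp only [Prod.fst_sub, Prod.fst_add]
    constructor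
    · intro h
      rw [sub_sub, sub_eq_zero] at h
      rw [h]
      abel
    · intro h
      rw [h]
      abel
  rw [and_right_comm, e1, e2]

end NormalFormEquations

end NeimarkSacker

namespace NeimarkSacker

/-! ### Uniqueness of the normal form -/

section NormalFormUniqueness

variable {k : ℕ}

theorem conf_aHat (a b φ : ℝ) : conf a b (aHat φ) = a • aHat φ + b • aHatDot φ := by
  rw [conf_apply]
  ext i
  fin_cases i <;> simp [aHat, aHatDot] <;> ring

theorem phaseL_integral {c : ℝ → Modes k} (hc : Continuous c) :
    phaseL k (∫ s in (0 : ℝ)..2 * Real.pi, c s) = (2 * Real.pi) •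
      (mean (fun θ => (c θ 1).1 0) + mean (fun θ => (c θ 2).1 1),
        mean (fun θ => (c θ 1).1 1) - mean (fun θ => (c θ 2).1 0),
        mean (fun θ => (c θ 0).2.2)) := by
  have h : ∀ L : Modes k →L[ℝ] ℝ, L (∫ s in (0 : ℝ)..2 * Real.pi, c s) =
      (2 * Real.pi) * mean (fun θ => L (c θ)) := fun L => by
    rw [mean, mul_inv_cancel_left₀ Real.two_pi_pos.ne',
      ContinuousLinearMap.intervalIntegral_comp_comm _ (hc.intervalIntegrable _ _)]
  have h1 := h (hatC 1 0)
  have h2 := h (hatC 2 1)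
  have h3 := h (hatC 1 1)
  have h4 := h (hatC 2 0)
  have h5 := h (ringC 0)
  simp only [hatC_apply, ringC_apply] at h1 h2 h3 h4 h5
  rw [phaseL_apply, h1, h2, h3, h4, h5]
  refine Prod.ext ?_ (Prod.ext ?_ ?_) <;>
    simp only [Prod.smul_fst, Prod.smul_snd, smul_eq_mul] <;> ring

theorem Family.IsNormalForm.contDiff_modes {S : Family k} {lam : ℝ} {N : NormalForm k}
    (h : S.IsNormalForm lam N) : ContDiff ℝ ∞ N.modes₁ ∧ ContDiff ℝ ∞ N.modes₂ := by
  have h1 := fun f hf => (h.smooth_hat f hf).1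
  have h2 := fun f hf => (h.smooth_tilde f hf).1
  have h3 := fun f hf => (h.smooth_ring f hf).1
  constructor
  · refine contDiff_pi.2 fun j => ?_
    fin_cases j
    · exact (h1 N.ah0 (by simp)).prodMk ((h2 N.at0 (by simp)).prodMk (h3 N.ar0 (by simp)))
    · exact contDiff_const
    · exact contDiff_const
    · exact (h1 N.ah2 (by simp)).prodMk ((h2 N.at2 (by simp)).prodMk (h3 N.ar2 (by simp)))
    · exact (h1 N.bh2 (by simp)).prodMk ((h2 N.bt2 (by simp)).prodMk (h3 N.br2 (by simp)))
    · exact contDiff_const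
    · exact contDiff_const
  · refine contDiff_pi.2 fun j => ?_
    fin_cases j
    · exact contDiff_const
    · exact (h1 N.ah1 (by simp)).prodMk contDiff_const
    · exact (h1 N.bh1 (by simp)).prodMk contDiff_const
    · exact contDiff_const
    · exact contDiff_const
    · exact (h1 N.ah3 (by simp)).prodMk contDiff_const
    · exact (h1 N.bh3 (by simp)).prodMk contDiff_const

theorem Family.IsNormalForm.periodic_modes {S : Family k} {lam : ℝ} {N : NormalForm k}
    (h : S.IsNormalForm lam N) : Function.Periodic N.modes₁ (2 * Real.pi) ∧
      Function.Periodic N.modes₂ (2 * Real.pi) := by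
  have h1 := fun f hf => (h.smooth_hat f hf).2
  have h2 := fun f hf => (h.smooth_tilde f hf).2
  have h3 := fun f hf => (h.smooth_ring f hf).2
  constructor <;> intro θ
  · simp only [NormalForm.modes₁, h1 N.ah0 (by simp), h1 N.ah2 (by simp), h1 N.bh2 (by simp),
      h2 N.at0 (by simp), h2 N.at2 (by simp), h2 N.bt2 (by simp), h3 N.ar0 (by simp),
      h3 N.ar2 (by simp), h3 N.br2 (by simp)]
  · simp only [NormalForm.modes₂, h1 N.ah1 (by simp), h1 N.ah3 (by simp), h1 N.bh1 (by simp),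
      h1 N.bh3 (by simp)]

theorem Family.IsNormalForm.phase_modes {S : Family k} {lam : ℝ} {N : NormalForm k}
    (h : S.IsNormalForm lam N) :
    phaseL k (∫ s in (0 : ℝ)..2 * Real.pi, N.modes₁ s) = 0 ∧
      phaseL k (∫ s in (0 : ℝ)..2 * Real.pi, N.modes₂ s) = 0 := by
  have hm : mean (fun _ => 0) = 0 := by simp [mean]
  rw [phaseL_integral h.contDiff_modes.1.continuous, phaseL_integral h.contDiff_modes.2.continuous]
  constructor
  · simp [NormalForm.modes₁, hm, h.restrict_ring]
  · simp [NormalForm.modes₂, hm, h.restrict_amp, h.restrict_phase]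

theorem ev_linA (om : ℝ) (A : Matrix (Fin k) (Fin k) ℝ) (c : Modes k) (φ : ℝ) :
    ev φ (linA om A c) = blockE om A (ev φ c) - om • ev φ (rot c) := by
  simp only [linA, sub_apply, smul_apply, map_sub, map_smul, ev_mapCoef]

theorem ev_linC (p q : ℝ) (ν : Param) (φ : ℝ) : ev φ (linC k p q ν) =
    (p * ν.1) • aStar k φ + (q * ν.1 - ν.2.1) • ev φ (rot (crit k)) - ν.2.2 • eLast k := by
  simp only [linC_apply, map_sub, map_add, map_smul, ev_crit, ev_lastMode]

/-- Projection of the coefficients to the critical directions. -/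
noncomputable def hatPart : Modes k →L[ℝ] Modes k :=
  mapCoef ((ContinuousLinearMap.inl ℝ _ _).comp (ContinuousLinearMap.fst ℝ _ _))

theorem ev_hatPart (φ : ℝ) (c : Modes k) : ev φ (hatPart c) = ((ev φ c).1, 0, 0) := by
  rw [hatPart, ev_mapCoef]
  rfl

theorem hatPart_modes₂ (N : NormalForm k) (θ : ℝ) : hatPart (N.modes₂ θ) = N.modes₂ θ := by
  funext j
  fin_cases j <;> rfl

theorem rot_hatPart (c : Modes k) : rot (hatPart c) = hatPart (rot c) := by
  funext j
  rw [rot_apply]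
  simp only [hatPart, mapCoef_apply, rot_apply]
  fin_cases j <;> simp
  rfl

theorem blockE_fst (om : ℝ) (A : Matrix (Fin k) (Fin k) ℝ) (z : Floq k) :
    (blockE om A z).1 = conf 0 om z.1 := rfl

theorem blockE_inl (om : ℝ) (A : Matrix (Fin k) (Fin k) ℝ) (x : EuclideanSpace ℝ (Fin 2)) :
    (blockE om A (x, 0, 0)).2 = 0 := by
  simp [blockE]

/-- Differences of two normal forms solve the homogeneous bordered problem and vanish by
nondegeneracy. The quadratic part with κ comes first: once these agree, the forcing of the cubic
equations agrees as well. -/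
theorem Family.IsNSPoint.normalForm_unique {S : Family k} {Λ : Set ℝ} {lamS omS : ℝ}
    (hS : S.IsNSPoint Λ lamS omS) {m : Expansion (Floq k)} (hE : m.E lamS = S.E lamS)
    (hG : ∀ z η θ ε, ε ≠ 0 → S.G z lamS η θ ε = m.G z lamS η θ ε) {N N' : NormalForm k}
    (hN : S.IsNormalForm lamS N) (hN' : S.IsNormalForm lamS N') : N' = N := by
  have hU := nondegenerate_lin (q := deriv S.αI lamS) hS.om_pos hS.om_lt hS.no_strong_resonance
    hS.transversal hS.hyperbolic
  have hEb : m.E lamS = blockE omS (S.Et lamS) := by rw [hE, hS.E_eq]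
  have hd₁ : ∀ {N}, S.IsNormalForm lamS N → ∀ θ, HasDerivAt N.modes₁ (deriv N.modes₁ θ) θ :=
    fun h θ => (h.contDiff_modes.1.differentiable (by simp) θ).hasDerivAt
  have hd₂ : ∀ {N}, S.IsNormalForm lamS N → ∀ θ, HasDerivAt N.modes₂ (deriv N.modes₂ θ) θ :=
    fun h θ => (h.contDiff_modes.2.differentiable (by simp) θ).hasDerivAt
  have key := fun {N : NormalForm k} (h : S.IsNormalForm lamS N) θ φ =>
    (hS.gdag_iff hE hG N θ φ (hd₁ h θ) (hd₂ h θ)).1 ⟨h.hat θ φ, h.tilde θ φ, h.ring θ φ⟩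
  have hphase : ∀ {f g : ℝ → Modes k}, Continuous f → Continuous g →
      phaseL k (∫ s in (0 : ℝ)..2 * Real.pi, f s) = 0 →
      phaseL k (∫ s in (0 : ℝ)..2 * Real.pi, g s) = 0 →
      phaseL k (∫ s in (0 : ℝ)..2 * Real.pi, (f s - g s)) = 0 := by
    intro f g hf hg h1 h2
    rw [intervalIntegral.integral_sub (hf.intervalIntegrable _ _) (hg.intervalIntegrable _ _),
      map_sub, h1, h2, sub_zero]
  -- the quadratic part
  have h1 := hU (fun θ => N'.modes₁ θ - N.modes₁ θ) (0, 0, N'.κ - N.κ)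
    (fun θ => by simp only [hN.periodic_modes.1 θ, hN'.periodic_modes.1 θ])
    (fun θ => ((hd₁ hN' θ).sub (hd₁ hN θ)).congr_deriv (ev_injective fun φ => by
      rw [map_sub, map_add, ev_linA, ev_linC, (key hN θ φ).1, (key hN' θ φ).1]
      simp only [Expansion.ord₁, map_sub, hEb]
      module))
    (hphase hN'.contDiff_modes.1.continuous hN.contDiff_modes.1.continuous hN'.phase_modes.1
      hN.phase_modes.1)
  have hm₁ : N'.modes₁ = N.modes₁ := funext fun θ => sub_eq_zero.1 (h1.1 θ)
  have hκ : N'.κ = N.κ := by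
    have := congrArg (fun ν : Param => ν.2.2) h1.2
    exact sub_eq_zero.1 this
  -- the cubic part
  have hhat : ∀ {N}, S.IsNormalForm lamS N → ∀ θ,
      hatPart (deriv N.modes₂ θ) = deriv N.modes₂ θ := fun {N} h θ => by
    have h2 := (hatPart (k := k)).hasFDerivAt.comp_hasDerivAt θ (hd₂ h θ)
    refine h2.unique ((hd₂ h θ).congr_of_eventuallyEq (Eventually.of_forall fun s => ?_))
    exact hatPart_modes₂ N s
  set p := deriv S.αR lamS
  set q := deriv S.αI lamS
  have hp : p ≠ 0 := hS.transversal
  -- The parameter vector is chosen so that `linC` produces minus the difference of the β terms: p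
  -- ν₁ is minus the difference of the β_R, and q ν₁ − ν₂ is minus that of the β_I.
  have h2 := hU (fun θ => N'.modes₂ θ - N.modes₂ θ)
    (-(N'.βR - N.βR) / p, q * (-(N'.βR - N.βR) / p) + (N'.βI - N.βI), 0)
    (fun θ => by simp only [hN.periodic_modes.2 θ, hN'.periodic_modes.2 θ])
    (fun θ => ((hd₂ hN' θ).sub (hd₂ hN θ)).congr_deriv (ev_injective fun φ => by
      rw [← hhat hN, ← hhat hN', ← hatPart_modes₂ N, ← hatPart_modes₂ N', ← map_sub, ← map_sub,
        ev_hatPart, map_add, ev_linA, ev_linC, ev_hatPart, rot_hatPart, ev_hatPart, ev_rot_crit]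
      refine Prod.ext ?_ ?_
      · have e1 := (key hN θ φ).2
        have e2 := (key hN' θ φ).2
        rw [hm₁, hκ] at e2
        simp only [Expansion.ord₂, hEb, map_sub, Prod.fst_sub, Prod.fst_add, Prod.smul_fst,
          blockE_fst, conf_aHat, aStar, mul_div_cancel₀ _ hp] at e1 e2 ⊢
        rw [e1, e2]
        module
      · simp only [Prod.snd_sub, Prod.snd_add, Prod.smul_snd, blockE_inl, aStar, eLast]
        simp))
    (hphase hN'.contDiff_modes.2.continuous hN.contDiff_modes.2.continuous hN'.phase_modes.2
      hN.phase_modes.2)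
  have hm₂ : N'.modes₂ = N.modes₂ := funext fun θ => sub_eq_zero.1 (h2.1 θ)
  have hβ := h2.2
  rw [Prod.ext_iff, Prod.ext_iff] at hβ
  obtain ⟨hR, hI, -⟩ := hβ
  simp only [Prod.fst_zero, Prod.snd_zero] at hR hI
  rw [hR, mul_zero, zero_add] at hI
  have hR' : N'.βR = N.βR := by
    have := (div_eq_zero_iff.1 hR).resolve_right hp
    linarith
  have c₁ := fun θ j => congrFun (congrFun hm₁ θ) j
  have c₂ := fun θ j => congrFun (congrFun hm₂ θ) j
  ext1
  · exact funext fun θ => congrArg Prod.fst (c₁ θ 0)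
  · exact funext fun θ => congrArg Prod.fst (c₂ θ 1)
  · exact funext fun θ => congrArg Prod.fst (c₁ θ 3)
  · exact funext fun θ => congrArg Prod.fst (c₂ θ 5)
  · exact funext fun θ => congrArg Prod.fst (c₂ θ 2)
  · exact funext fun θ => congrArg Prod.fst (c₁ θ 4)
  · exact funext fun θ => congrArg Prod.fst (c₂ θ 6)
  · exact funext fun θ => congrArg (fun z : Floq k => z.2.1) (c₁ θ 0)
  · exact funext fun θ => congrArg (fun z : Floq k => z.2.1) (c₁ θ 3)
  · exact funext fun θ => congrArg (fun z : Floq k => z.2.1) (c₁ θ 4)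
  · exact funext fun θ => congrArg (fun z : Floq k => z.2.2) (c₁ θ 0)
  · exact funext fun θ => congrArg (fun z : Floq k => z.2.2) (c₁ θ 3)
  · exact funext fun θ => congrArg (fun z : Floq k => z.2.2) (c₁ θ 4)
  · exact hκ
  · exact hR'
  · exact sub_eq_zero.1 hI

end NormalFormUniqueness

end NeimarkSacker

namespace NeimarkSacker

/-! ### Existence of the normal form from the branch -/

section NormalFormExistence

variable {k : ℕ}

/-- Bootstrapping. The branch is constructed among continuous functions of θ, and the smoothness
that a normal form requires is recovered from its equations. -/
theorem contDiff_infty_of_ode {V : Type} [NormedAddCommGroup V] [NormedSpace ℝ V] {y : ℝ → V}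
    {Ψ : ℝ → V → V} (hΨ : ContDiff ℝ ∞ (fun p : ℝ × V => Ψ p.1 p.2))
    (hy : ∀ θ, HasDerivAt y (Ψ θ (y θ)) θ) : ContDiff ℝ ∞ y := by
  have hd : deriv y = fun θ => Ψ θ (y θ) := funext fun θ => (hy θ).deriv
  rw [contDiff_infty]
  intro n
  induction n with
  | zero => exact contDiff_zero.2 (continuous_iff_continuousAt.2 fun θ => (hy θ).continuousAt)
  | succ n ih =>
    have h1 : ContDiff ℝ n (deriv y) := by
      rw [hd]
      exact (contDiff_infty.1 hΨ n).comp (contDiff_id.prodMk ih)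
    exact contDiff_succ_iff_deriv.2 ⟨fun θ => (hy θ).differentiableAt, by simp, h1⟩

set_option maxHeartbeats 800000 in
theorem BranchJets.contDiff {m : Expansion (Floq k)} {lamS omS : ℝ}
    {Y W : ℝ → C(Circ, Modes k)} {μ : ℝ → Param} {Y₁ Y₂ W₁ W₂ : C(Circ, Modes k)} {κ l₂ o₂ : ℝ}
    (hJ : BranchJets m lamS omS Y W μ Y₁ Y₂ W₁ W₂ κ l₂ o₂) :
    ContDiff ℝ ∞ (fun θ : ℝ => Y₁ θ) ∧ ContDiff ℝ ∞ (fun θ : ℝ => Y₂ θ) := by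
  have ha : ContDiff ℝ ∞ (fun p : (ℝ × Modes k) × ℝ => aStar k p.2) := by
    have : (fun p : (ℝ × Modes k) × ℝ => aStar k p.2) = fun p => ev p.2 (crit k) :=
      funext fun p => (ev_crit p.2).symm
    rw [this]
    exact (contDiff_ev.comp contDiff_snd).clm_apply contDiff_const
  have he : ContDiff ℝ ∞ (fun p : (ℝ × Modes k) × ℝ => (ev p.2 : Modes k →L[ℝ] Floq k)) :=
    contDiff_ev.comp contDiff_snd
  have hc : ContDiff ℝ ∞ (fun p : (ℝ × Modes k) × ℝ => p.1.2) := contDiff_snd.comp contDiff_fst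
  have hθ : ContDiff ℝ ∞ (fun p : (ℝ × Modes k) × ℝ => p.1.1) := contDiff_fst.comp contDiff_fst
  have hr : ContDiff ℝ ∞ (fun p : (ℝ × Modes k) × ℝ => rot p.1.2) :=
    (rot (W := Floq k)).contDiff.comp hc
  have hB : ContDiff ℝ ∞ (fun p : (ℝ × Modes k) × ℝ => m.B p.1.1 lamS) :=
    m.smooth_B.comp (hθ.prodMk contDiff_const)
  have hQ : ContDiff ℝ ∞ (fun p : (ℝ × Modes k) × ℝ => m.Q p.1.1 lamS) :=
    m.smooth_Q.comp (hθ.prodMk contDiff_const)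
  have hC : ContDiff ℝ ∞ (fun p : (ℝ × Modes k) × ℝ => m.C p.1.1 lamS 0) :=
    m.smooth_C.comp ((hθ.prodMk contDiff_const).prodMk contDiff_const)
  have h1 : ContDiff ℝ ∞ (fun θ : ℝ => Y₁ θ) := by
    refine contDiff_infty_of_ode (Ψ := fun θ c => coef fun φ =>
      m.ord₁ θ lamS (aStar k φ) (ev φ c) - κ • eLast k - omS • ev φ (rot c))
      (contDiff_infty_coef (f := fun (p : ℝ × Modes k) φ =>
        m.ord₁ p.1 lamS (aStar k φ) (ev φ p.2) - κ • eLast k - omS • ev φ (rot p.2)) ?_)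
      fun θ => ?_
    · exact ((((m.E lamS).contDiff.comp (he.clm_apply hc)).add
        ((hB.clm_apply ha).clm_apply ha)).sub contDiff_const).sub
        (contDiff_const.smul (f := fun _ => omS) (he.clm_apply hr))
    · refine (hJ.deriv₁ θ).congr_deriv ?_
      simp only [← hJ.equation₁]
      exact (coef_ev _).symm
  refine ⟨h1, ?_⟩
  refine contDiff_infty_of_ode (Ψ := fun θ c => coef fun φ =>
    m.ord₂ θ lamS l₂ κ (aStar k φ) (ev φ (Y₁ θ)) (ev φ c) - omS • ev φ (rot c) -
      o₂ • ev φ (rot (crit k)))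
    (contDiff_infty_coef (f := fun (p : ℝ × Modes k) φ =>
      m.ord₂ p.1 lamS l₂ κ (aStar k φ) (ev φ (Y₁ p.1)) (ev φ p.2) - omS • ev φ (rot p.2) -
        o₂ • ev φ (rot (crit k))) ?_)
    fun θ => ?_
  · have hY : ContDiff ℝ ∞ (fun p : (ℝ × Modes k) × ℝ => ev p.2 (Y₁ p.1.1)) :=
      he.clm_apply (h1.comp hθ)
    have e1 : ContDiff ℝ ∞ (fun p : (ℝ × Modes k) × ℝ => m.E lamS (ev p.2 p.1.2)) :=
      (m.E lamS).contDiff.comp (he.clm_apply hc)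
    have e2 : ContDiff ℝ ∞ (fun p : (ℝ × Modes k) × ℝ => l₂ • deriv m.E lamS (aStar k p.2)) :=
      by
      generalize deriv m.E lamS = D
      exact (l₂ • D).contDiff.comp ha
    have e3 := ((hB.clm_apply ha).clm_apply hY).add ((hB.clm_apply hY).clm_apply ha)
    have e4 := ((hC.clm_apply ha).clm_apply ha).clm_apply ha
    have e5 : ContDiff ℝ ∞ (fun p : (ℝ × Modes k) × ℝ => κ • m.Q p.1.1 lamS (aStar k p.2)) :=
      contDiff_const.smul (f := fun _ => κ) (hQ.clm_apply ha)
    exact (((((e1.add e2).add e3).add e4).sub e5).sub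
      (contDiff_const.smul (f := fun _ => omS) (he.clm_apply hr))).sub
      (contDiff_const.smul (f := fun _ => o₂) (he.clm_apply contDiff_const))
  · refine (hJ.deriv₂ θ).congr_deriv ?_
    simp only [← hJ.equation₂]
    exact (coef_ev _).symm

/-- The normal form with quadratic coefficients `y₁` and cubic coefficients `y₂`. -/
def normalFormOf (y₁ y₂ : ℝ → Modes k) (κ βR βI : ℝ) : NormalForm k where
  ah0 θ := (y₁ θ 0).1
  ah1 θ := (y₂ θ 1).1
  ah2 θ := (y₁ θ 3).1
  ah3 θ := (y₂ θ 5).1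
  bh1 θ := (y₂ θ 2).1
  bh2 θ := (y₁ θ 4).1
  bh3 θ := (y₂ θ 6).1
  at0 θ := (y₁ θ 0).2.1
  at2 θ := (y₁ θ 3).2.1
  bt2 θ := (y₁ θ 4).2.1
  ar0 θ := (y₁ θ 0).2.2
  ar2 θ := (y₁ θ 3).2.2
  br2 θ := (y₁ θ 4).2.2
  κ := κ
  βR := βR
  βI := βI

/-- Only the modes 0 and 2 are kept in the normal form; by parity the others vanish, so nothing is
lost. -/
theorem normalFormOf_modes₁ {y₁ : ℝ → Modes k} (h : ∀ θ, halfTurn (y₁ θ) = y₁ θ)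
    (y₂ : ℝ → Modes k) (κ βR βI : ℝ) : (normalFormOf y₁ y₂ κ βR βI).modes₁ = y₁ := by
  funext θ j
  have hj := congrFun (h θ) j
  rw [halfTurn_apply] at hj
  fin_cases j <;> simp [NormalForm.modes₁, normalFormOf, turnSign] at hj ⊢ <;>
    exact (eq_zero_of_neg_eq_self hj).symm

theorem normalFormOf_modes₂ (y₁ : ℝ → Modes k) {y₂ : ℝ → Modes k}
    (h : ∀ θ, halfTurn (y₂ θ) = -y₂ θ) (κ βR βI : ℝ) :
    (normalFormOf y₁ y₂ κ βR βI).modes₂ = fun θ => hatPart (y₂ θ) := by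
  funext θ j
  have hj := congrFun (h θ) j
  rw [halfTurn_apply, Pi.neg_apply] at hj
  fin_cases j <;> simp [NormalForm.modes₂, normalFormOf, turnSign, hatPart] at hj ⊢ <;>
    simp [eq_zero_of_neg_eq_self hj.symm] <;> rfl

theorem Family.IsNSPoint.deriv_E_aStar {S : Family k} {Λ : Set ℝ} {lamS omS : ℝ}
    (hS : S.IsNSPoint Λ lamS omS) {m : Expansion (Floq k)}
    (hE : ∀ᶠ lam in 𝓝 lamS, m.E lam = S.E lam) (φ : ℝ) :
    deriv m.E lamS (aStar k φ) =
      deriv S.αR lamS • aStar k φ + deriv S.αI lamS • ((aHatDot φ, 0, 0) : Floq k) := by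
  rw [← ev_crit, ← ev_rot_crit, ← ev_mapCoef, ← map_smul, ← map_smul, ← map_add]
  congr 1
  funext j
  exact hS.deriv_E_crit hE j

/-- The parameter terms of the second-order equation are l₂ times the λ-derivative of E on a(φ),
minus o₂ a'(φ). Collected along a and a', they equal −β_R a − β_I a' for exactly the stated values;
the critical part of the equation is then the cubic normal form equation. -/
theorem Family.IsNSPoint.isNormalForm {S : Family k} {Λ : Set ℝ} {lamS omS : ℝ}
    (hS : S.IsNSPoint Λ lamS omS) {m : Expansion (Floq k)}
    (hE : ∀ᶠ lam in 𝓝 lamS, m.E lam = S.E lam)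
    (hG : ∀ z η θ ε, ε ≠ 0 → S.G z lamS η θ ε = m.G z lamS η θ ε)
    {Y W : ℝ → C(Circ, Modes k)} {μ : ℝ → Param} {Y₁ Y₂ W₁ W₂ : C(Circ, Modes k)} {κ l₂ o₂ : ℝ}
    (hJ : BranchJets m lamS omS Y W μ Y₁ Y₂ W₁ W₂ κ l₂ o₂) :
    S.IsNormalForm lamS (normalFormOf (fun θ => Y₁ θ) (fun θ => Y₂ θ) κ
      (-deriv S.αR lamS * l₂) (o₂ - deriv S.αI lamS * l₂)) := by
  set N := normalFormOf (fun θ => Y₁ θ) (fun θ => Y₂ θ) κ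
      (-deriv S.αR lamS * l₂) (o₂ - deriv S.αI lamS * l₂) with hN
  have hm₁ : N.modes₁ = fun θ : ℝ => Y₁ θ := normalFormOf_modes₁ (fun θ => hJ.parity₁ θ) _ _ _ _
  have hm₂ : N.modes₂ = fun θ : ℝ => hatPart (Y₂ θ) :=
    normalFormOf_modes₂ _ (fun θ => hJ.parity₂ θ) _ _ _
  have s₁ := contDiff_pi.1 hJ.contDiff.1
  have s₂ := contDiff_pi.1 hJ.contDiff.2
  have hph : ∀ {y : C(Circ, Modes k)}, phaseL k (∫ s in (0 : ℝ)..2 * Real.pi, y s) = 0 →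
      mean (fun θ => (y θ 1).1 0) + mean (fun θ => (y θ 2).1 1) = 0 ∧
      mean (fun θ => (y θ 1).1 1) - mean (fun θ => (y θ 2).1 0) = 0 ∧
      mean (fun θ => (y θ 0).2.2) = 0 := fun {y} h => by
    rw [phaseL_integral (continuous_coe_circ y), smul_eq_zero] at h
    have := h.resolve_left Real.two_pi_pos.ne'
    simpa [Prod.ext_iff] using this
  have key := fun θ φ => (hS.gdag_iff hE.self_of_nhds hG N θ φ (d₁ := W₁ θ) (d₂ := hatPart (W₂ θ))
    (by rw [hm₁]; exact hJ.deriv₁ θ)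
    (by rw [hm₂]; exact (hatPart (k := k)).hasFDerivAt.comp_hasDerivAt θ (hJ.deriv₂ θ))).2
    ⟨by rw [hm₁]; exact hJ.equation₁ θ φ, by
      have h := congrArg Prod.fst (hJ.equation₂ θ φ)
      rw [Expansion.ord₂, hS.deriv_E_aStar hE] at h
      rw [hm₁, hm₂, rot_hatPart, ev_hatPart, ev_hatPart, ev_hatPart]
      simp only [Expansion.ord₂, hE.self_of_nhds, hS.E_eq, Prod.fst_sub,
        Prod.fst_add, Prod.smul_fst, blockE_fst, conf_aHat, aStar, ev_rot_crit] at h ⊢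
      rw [h]
      simp only [hN, normalFormOf]
      module⟩
  refine ⟨?_, ?_, ?_, (hph hJ.phase₂).1, (hph hJ.phase₂).2.1, (hph hJ.phase₁).2.2,
    fun θ φ => (key θ φ).1, fun θ φ => (key θ φ).2.1, fun θ φ => (key θ φ).2.2⟩
  · simp only [List.forall_mem_cons, List.not_mem_nil, IsEmpty.forall_iff, implies_true, and_true]
    refine ⟨⟨(s₁ 0).fst, ?_⟩, ⟨(s₂ 1).fst, ?_⟩, ⟨(s₁ 3).fst, ?_⟩, ⟨(s₂ 5).fst, ?_⟩,
      ⟨(s₂ 2).fst, ?_⟩, ⟨(s₁ 4).fst, ?_⟩, ⟨(s₂ 6).fst, ?_⟩⟩ <;> intro θ <;>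
    simp only [hN, normalFormOf, coe_add_two_pi]
  · simp only [List.forall_mem_cons, List.not_mem_nil, IsEmpty.forall_iff, implies_true, and_true]
    refine ⟨⟨(s₁ 0).snd.fst, ?_⟩, ⟨(s₁ 3).snd.fst, ?_⟩, ⟨(s₁ 4).snd.fst, ?_⟩⟩ <;> intro θ <;>
    simp only [hN, normalFormOf, coe_add_two_pi]
  · simp only [List.forall_mem_cons, List.not_mem_nil, IsEmpty.forall_iff, implies_true, and_true]
    refine ⟨⟨(s₁ 0).snd.snd, ?_⟩, ⟨(s₁ 3).snd.snd, ?_⟩, ⟨(s₁ 4).snd.snd, ?_⟩⟩ <;> intro θ <;>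
    simp only [hN, normalFormOf, coe_add_two_pi]

end NormalFormExistence

end NeimarkSacker

namespace NeimarkSacker

/-! ### Error estimates for the coefficients -/

section Estimates

variable {k : ℕ} {V : Type} [NormedAddCommGroup V] [NormedSpace ℝ V]

theorem toTorus_coef (c : ℝ → Modes k) (ν : Param) (θ : ℝ) :
    coef (fun φ => (toTorus c ν).z θ φ - aStar k φ) = c θ - crit k := by
  simp only [toTorus, ← ev_crit, ← map_sub]
  exact coef_ev _

theorem toTorus_a (c : ℝ → Modes k) (ν : Param) (θ : ℝ) :
    (toTorus c ν).a 0 θ = (c θ - crit k) 0 ∧ (toTorus c ν).a 1 θ = (c θ - crit k) 1 ∧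
      (toTorus c ν).a 2 θ = (c θ - crit k) 3 ∧ (toTorus c ν).a 3 θ = (c θ - crit k) 5 := by
  rw [← toTorus_coef c ν θ]
  exact cosCoeff_eq _

theorem toTorus_b (c : ℝ → Modes k) (ν : Param) (θ : ℝ) :
    (toTorus c ν).b 1 θ = (c θ - crit k) 2 ∧ (toTorus c ν).b 2 θ = (c θ - crit k) 4 ∧
      (toTorus c ν).b 3 θ = (c θ - crit k) 6 := by
  rw [← toTorus_coef c ν θ]
  exact sinCoeff_eq _

theorem isOSq_of_isBigO {R R' : ℝ → C(Circ, Modes k)} (hR : R =O[𝓝[≠] 0] fun ε : ℝ => ε ^ 2)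
    (hR' : R' =O[𝓝[≠] 0] fun ε : ℝ => ε ^ 2)
    (hd : ∀ᶠ ε in 𝓝[≠] (0 : ℝ), ∀ θ : ℝ, HasDerivAt (fun s : ℝ => R ε s) (R' ε θ) θ)
    (L : Modes k →L[ℝ] V) : IsOSq (fun ε θ => L (R ε θ)) := by
  obtain ⟨C, hC⟩ := hR.bound
  obtain ⟨C', hC'⟩ := hR'.bound
  refine ⟨‖L‖ * max C C', ?_⟩
  filter_upwards [hC, hC', hd] with ε h h' hd θ
  have hb : ∀ {y : C(Circ, Modes k)} {c : ℝ}, c ≤ max C C' → ‖y‖ ≤ c * ‖ε ^ 2‖ →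
      ‖L (y θ)‖ ≤ ‖L‖ * max C C' * ε ^ 2 := fun {y c} hc hy => by
    rw [Real.norm_of_nonneg (sq_nonneg ε)] at hy
    rw [mul_assoc]
    refine (L.le_opNorm _).trans (mul_le_mul_of_nonneg_left ?_ (norm_nonneg _))
    exact (y.norm_coe_le_norm θ).trans (hy.trans (mul_le_mul_of_nonneg_right hc (sq_nonneg ε)))
  refine ⟨hb (le_max_left _ _) h, ?_⟩
  have hL : HasDerivAt (fun s : ℝ => L (R ε s)) (L (R' ε θ)) θ :=
    L.hasFDerivAt.comp_hasDerivAt θ (hd θ)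
  rw [hL.deriv]
  exact hb (le_max_right _ _) h'

theorem isBigO_inv_pow_smul {W : Type} [NormedAddCommGroup W] [NormedSpace ℝ W] {f : ℝ → W}
    {n p : ℕ} (hf : f =O[𝓝[≠] 0] fun ε : ℝ => ε ^ (p + n)) :
    (fun ε : ℝ => (ε ^ n)⁻¹ • f ε) =O[𝓝[≠] 0] fun ε : ℝ => ε ^ p := by
  refine ((isBigO_refl (fun ε : ℝ => (ε ^ n)⁻¹) (𝓝[≠] 0)).smul hf).congr' EventuallyEq.rfl ?_
  filter_upwards [self_mem_nhdsWithin] with ε (hε : ε ≠ 0)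
  rw [smul_eq_mul, pow_add]
  field_simp

variable {m : Expansion (Floq k)} {lamS omS : ℝ} {n : ℕ} {Y W : ℝ → C(Circ, Modes k)}
  {μ : ℝ → Param} {Y₁ Y₂ W₁ W₂ : C(Circ, Modes k)} {κ l₂ o₂ : ℝ}

/-- In an even mode, Y plus its half turn is 2Y, with expansion εY₁ doubled and error O(ε³).
Division by ε leaves O(ε²), and the factor −1/2 restores sign and scale. The critical solution has
no even modes. -/
theorem BranchJets.isOSq_quadratic (hJ : BranchJets m lamS omS Y W μ Y₁ Y₂ W₁ W₂ κ l₂ o₂)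
    (hB : Branch m lamS omS n Y W μ) {j : Fin 7} (hj : turnSign j = 1) (L : Floq k →L[ℝ] V) :
    IsOSq (fun ε θ => L (Y₁ θ j) - ε⁻¹ • L ((Y ε θ - crit k) j)) := by
  have hcj : crit k j = 0 := by
    fin_cases j <;> simp [turnSign, crit] at hj ⊢ <;> norm_num at hj
  have h := isOSq_of_isBigO (isBigO_inv_pow_smul (n := 1) (p := 2) hJ.odd_Y)
    (isBigO_inv_pow_smul (n := 1) (p := 2) hJ.odd_W) (by
      filter_upwards [hB.hasDerivAt.filter_mono nhdsWithin_le_nhds] with ε h θ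
      exact (((h θ).add ((halfTurn (k := k)).hasFDerivAt.comp_hasDerivAt θ (h θ))).sub
        (((hJ.deriv₁ θ).const_smul (2 : ℝ)).const_smul ε)).const_smul (ε ^ 1)⁻¹)
    ((-(2 : ℝ)⁻¹) • L.comp (ContinuousLinearMap.proj j))
  obtain ⟨C, hC⟩ := h
  refine ⟨C, ?_⟩
  filter_upwards [hC, self_mem_nhdsWithin] with ε hC (hε : ε ≠ 0)
  have he : (fun θ : ℝ => L (Y₁ θ j) - ε⁻¹ • L ((Y ε θ - crit k) j)) = fun θ : ℝ =>
      ((-(2 : ℝ)⁻¹) • L.comp (ContinuousLinearMap.proj j))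
        (((ε ^ 1)⁻¹ • (Y ε + circTurn (Y ε) - ε • (2 : ℝ) • Y₁)) θ) := by
    funext θ
    simp only [smul_apply, ContinuousLinearMap.comp_apply, ContinuousLinearMap.proj_apply,
      ContinuousMap.smul_apply, ContinuousMap.sub_apply, ContinuousMap.add_apply, circTurn_apply,
      Pi.sub_apply, halfTurn_apply, hj, hcj, map_smul, map_sub,
      map_add, map_zero, pow_one]
    match_scalars <;> field_simp <;> norm_num
  intro θ
  rw [he]
  exact ⟨(congrArg norm (congrFun he θ)).trans_le (hC θ).1, (hC θ).2⟩

/-- In an odd mode it is Y minus its half turn that equals 2Y; the error O(ε⁴) becomes O(ε²) after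
division by ε². -/
theorem BranchJets.isOSq_cubic (hJ : BranchJets m lamS omS Y W μ Y₁ Y₂ W₁ W₂ κ l₂ o₂)
    (hB : Branch m lamS omS n Y W μ) {j : Fin 7} (hj : turnSign j = -1) (L : Floq k →L[ℝ] V) :
    IsOSq (fun ε θ => L (Y₂ θ j) - (ε ^ 2)⁻¹ • L ((Y ε θ - crit k) j)) := by
  have h := isOSq_of_isBigO (isBigO_inv_pow_smul (n := 2) (p := 2) hJ.even_Y)
    (isBigO_inv_pow_smul (n := 2) (p := 2) hJ.even_W) (by
      filter_upwards [hB.hasDerivAt.filter_mono nhdsWithin_le_nhds] with ε h θ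
      exact ((((h θ).sub ((halfTurn (k := k)).hasFDerivAt.comp_hasDerivAt θ (h θ))).sub_const
        ((2 : ℝ) • crit k)).sub
        (((hJ.deriv₂ θ).const_smul (2 : ℝ)).const_smul (ε ^ 2))).const_smul (ε ^ 2)⁻¹)
    ((-(2 : ℝ)⁻¹) • L.comp (ContinuousLinearMap.proj j))
  obtain ⟨C, hC⟩ := h
  refine ⟨C, ?_⟩
  filter_upwards [hC, self_mem_nhdsWithin] with ε hC (hε : ε ≠ 0)
  have he : (fun θ : ℝ => L (Y₂ θ j) - (ε ^ 2)⁻¹ • L ((Y ε θ - crit k) j)) = fun θ : ℝ =>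
      ((-(2 : ℝ)⁻¹) • L.comp (ContinuousLinearMap.proj j))
        (((ε ^ 2)⁻¹ • (Y ε - circTurn (Y ε) - (2 : ℝ) • circConst (crit k) -
          ε ^ 2 • (2 : ℝ) • Y₂)) θ) := by
    funext θ
    simp only [smul_apply, ContinuousLinearMap.comp_apply, ContinuousLinearMap.proj_apply,
      ContinuousMap.smul_apply, ContinuousMap.sub_apply, circTurn_apply, circConst_apply,
      Pi.sub_apply, halfTurn_apply, hj, map_smul, map_sub]
    match_scalars <;> field_simp <;> norm_num
  intro θ
  rw [he]
  exact ⟨(congrArg norm (congrFun he θ)).trans_le (hC θ).1, (hC θ).2⟩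

theorem BranchJets.isBigO_param (hJ : BranchJets m lamS omS Y W μ Y₁ Y₂ W₁ W₂ κ l₂ o₂)
    (p q : ℝ) :
    ((fun ε : ℝ => -p * l₂ - (-p * (((μ ε).1 - lamS) / ε ^ 2))) =O[𝓝[≠] 0] fun ε : ℝ => ε ^ 2) ∧
    ((fun ε : ℝ => (o₂ - q * l₂) - (((μ ε).2.1 - omS) / ε ^ 2 - q * (((μ ε).1 - lamS) / ε ^ 2)))
      =O[𝓝[≠] 0] fun ε : ℝ => ε ^ 2) ∧
    ((fun ε : ℝ => κ - (μ ε).2.2 / ε) =O[𝓝[≠] 0] fun ε : ℝ => ε ^ 2) := by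
  have hl := isBigO_inv_pow_smul (n := 2) (p := 2) hJ.lam
  have ho := isBigO_inv_pow_smul (n := 2) (p := 2) hJ.om
  have he := isBigO_inv_pow_smul (n := 1) (p := 2) hJ.eta
  refine ⟨(hl.const_mul_left p).congr' ?_ EventuallyEq.rfl,
    ((hl.const_mul_left q).sub ho).congr' ?_ EventuallyEq.rfl,
    he.neg_left.congr' ?_ EventuallyEq.rfl⟩ <;>
  · filter_upwards [self_mem_nhdsWithin] with ε (hε : ε ≠ 0)
    simp only [smul_eq_mul]
    field_simp
    ring

end Estimates

end NeimarkSacker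

/-! ### Assembly of the theorem -/

theorem mainTheorem2 (k : ℕ) (S : NeimarkSacker.Family k) (Λ : Set ℝ) (lamS omS : ℝ)
    (hS : S.IsNSPoint Λ lamS omS) :
    ∃ (N : NeimarkSacker.NormalForm k) (sol : ℝ → NeimarkSacker.Torus k),
      -- the normal form at `lamS` exists and is unique
      (S.IsNormalForm lamS N ∧ ∀ N', S.IsNormalForm lamS N' → N' = N) ∧
      -- the locally unique solution of the equations with three Fourier modes
      (∀ᶠ ε in 𝓝[≠] (0 : ℝ), S.IsFourierSol ε (sol ε)) ∧
      (∀ r > 0, ∀ᶠ ε in 𝓝[≠] (0 : ℝ), (sol ε).Near lamS omS r) ∧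
      (∃ r > 0, ∀ᶠ ε in 𝓝[≠] (0 : ℝ), ∀ u : NeimarkSacker.Torus k,
        S.IsFourierSol ε u → u.Near lamS omS r → u = sol ε) ∧
      -- the Lyapunov coefficients and `κ`
      ((fun ε : ℝ => N.βR - (-deriv S.αR lamS * (((sol ε).lam - lamS) / ε ^ 2)))
        =O[𝓝[≠] 0] fun ε : ℝ => ε ^ 2) ∧
      ((fun ε : ℝ => N.βI - (((sol ε).om - omS) / ε ^ 2
          - deriv S.αI lamS * (((sol ε).lam - lamS) / ε ^ 2)))
        =O[𝓝[≠] 0] fun ε : ℝ => ε ^ 2) ∧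
      ((fun ε : ℝ => N.κ - (sol ε).eta / ε) =O[𝓝[≠] 0] fun ε : ℝ => ε ^ 2) ∧
      -- the quadratic coefficients of the three maps
      NeimarkSacker.IsOSq (fun ε θ => N.ah0 θ - ε⁻¹ • ((sol ε).a 0 θ).1) ∧
      NeimarkSacker.IsOSq (fun ε θ => N.ah2 θ - ε⁻¹ • ((sol ε).a 2 θ).1) ∧
      NeimarkSacker.IsOSq (fun ε θ => N.bh2 θ - ε⁻¹ • ((sol ε).b 2 θ).1) ∧
      NeimarkSacker.IsOSq (fun ε θ => N.at0 θ - ε⁻¹ • ((sol ε).a 0 θ).2.1) ∧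
      NeimarkSacker.IsOSq (fun ε θ => N.at2 θ - ε⁻¹ • ((sol ε).a 2 θ).2.1) ∧
      NeimarkSacker.IsOSq (fun ε θ => N.bt2 θ - ε⁻¹ • ((sol ε).b 2 θ).2.1) ∧
      NeimarkSacker.IsOSq (fun ε θ => N.ar0 θ - ε⁻¹ • ((sol ε).a 0 θ).2.2) ∧
      NeimarkSacker.IsOSq (fun ε θ => N.ar2 θ - ε⁻¹ • ((sol ε).a 2 θ).2.2) ∧
      NeimarkSacker.IsOSq (fun ε θ => N.br2 θ - ε⁻¹ • ((sol ε).b 2 θ).2.2) ∧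
      -- the cubic coefficients of the first map
      NeimarkSacker.IsOSq (fun ε θ => N.ah1 θ - (ε ^ 2)⁻¹ • ((sol ε).a 1 θ).1) ∧
      NeimarkSacker.IsOSq (fun ε θ => N.bh1 θ - (ε ^ 2)⁻¹ • ((sol ε).b 1 θ).1) ∧
      NeimarkSacker.IsOSq (fun ε θ => N.ah3 θ - (ε ^ 2)⁻¹ • ((sol ε).a 3 θ).1) ∧
      NeimarkSacker.IsOSq (fun ε θ => N.bh3 θ - (ε ^ 2)⁻¹ • ((sol ε).b 3 θ).1) := by
  obtain ⟨m, δ, hδ, hEδ, hG⟩ := hS.exists_expansion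
  have hE : ∀ᶠ lam in 𝓝 lamS, m.E lam = S.E lam := by
    filter_upwards [Metric.ball_mem_nhds lamS hδ] with lam h
    exact (hEδ lam (by simpa [Real.dist_eq] using h)).2
  have hG0 : ∀ z η θ ε, ε ≠ 0 → S.G z lamS η θ ε = m.G z lamS η θ ε := fun z η θ ε =>
    hG z lamS η θ ε (by simpa using hδ)
  -- Four derivatives in ε are what the O(ε⁴) remainders of the even quantities require.
  obtain ⟨Y, W, μ, hB⟩ := hS.exists_torus_branch hE 4
  obtain ⟨Y₁, Y₂, W₁, W₂, κ, l₂, o₂, hJ⟩ := hB.exists_jets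
  have hN := hS.isNormalForm hE hG0 hJ
  have hp := hJ.isBigO_param (deriv S.αR lamS) (deriv S.αI lamS)
  have h1 := fun {V : Type} [NormedAddCommGroup V] [NormedSpace ℝ V] {j : Fin 7} =>
    hJ.isOSq_quadratic (V := V) hB (j := j)
  have h2 := fun {j : Fin 7} (hj : NeimarkSacker.turnSign j = -1) =>
    hJ.isOSq_cubic hB hj (ContinuousLinearMap.fst ℝ _ _)
  have ha := fun ε θ => NeimarkSacker.toTorus_a (fun θ : ℝ => Y ε θ) (μ ε) θ
  have hb := fun ε θ => NeimarkSacker.toTorus_b (fun θ : ℝ => Y ε θ) (μ ε) θ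
  let L₁ := ContinuousLinearMap.fst ℝ (EuclideanSpace ℝ (Fin 2)) (EuclideanSpace ℝ (Fin k) × ℝ)
  let L := ContinuousLinearMap.snd ℝ (EuclideanSpace ℝ (Fin 2)) (EuclideanSpace ℝ (Fin k) × ℝ)
  let L₂ := (ContinuousLinearMap.fst ℝ (EuclideanSpace ℝ (Fin k)) ℝ).comp L
  let L₃ := (ContinuousLinearMap.snd ℝ (EuclideanSpace ℝ (Fin k)) ℝ).comp L
  refine ⟨_, fun ε => NeimarkSacker.toTorus (fun θ : ℝ => Y ε θ) (μ ε),
    ⟨hN, fun N' hN' => hS.normalForm_unique hE.self_of_nhds hG0 hN hN'⟩,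
    hB.isFourierSol hδ hG, fun r hr => (hB.near hr).filter_mono nhdsWithin_le_nhds,
    hB.exists_unique hδ hG, hp.1, hp.2.1, hp.2.2, ?_⟩
  simp only [(ha _ _).1, (ha _ _).2.1, (ha _ _).2.2.1, (ha _ _).2.2.2, (hb _ _).1, (hb _ _).2.1,
    (hb _ _).2.2]
  have s0 : NeimarkSacker.turnSign 0 = 1 := rfl
  have s1 : NeimarkSacker.turnSign 1 = -1 := rfl
  have s2 : NeimarkSacker.turnSign 2 = -1 := rfl
  have s3 : NeimarkSacker.turnSign 3 = 1 := rfl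
  have s4 : NeimarkSacker.turnSign 4 = 1 := rfl
  have s5 : NeimarkSacker.turnSign 5 = -1 := rfl
  have s6 : NeimarkSacker.turnSign 6 = -1 := rfl
  exact ⟨h1 s0 L₁, h1 s3 L₁, h1 s4 L₁, h1 s0 L₂, h1 s3 L₂, h1 s4 L₂, h1 s0 L₃, h1 s3 L₃, h1 s4 L₃,
    h2 s1, h2 s2, h2 s5, h2 s6⟩
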